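/- Let $M$ be a lattice (a free abelian group of finite rank), $T=\operatorname{Spec}\mathbb C[M]$, $N=\operatorname{Hom}(M,\mathbb Z)$, let $\sigma\subset N_{\mathbb Q}$ be a pointed polyhedral cone, and let $\omega\subset M_{\mathbb Q}$ be its dual cone. Let $Y$ be a nonsingular curve over $\mathbb C$, contained as an open subset in a complete nonsingular curve $C$. Let $\mathcal D=\sum_{P}\Delta_P\otimes P$ be a proper polyhedral divisor on $Y$: for each closed point $P\in Y$ the coefficient $\Delta_P\subset N_{\mathbb Q}$ is the Minkowski sum of a nonempty polytope and $\sigma$, one has $\Delta_P=\sigma$ for all but finitely many $P$, and the $\mathbb Q$-divisor $\mathcal D(u)=\sum_P\min\langle u,\Delta_P\rangle\cdot P$ is semiample for every $u\in\omega\cap M$ and big for every $u\in M$ in the relative interior of $\omega$. (Here, for a $\mathbb Q$-divisor $E$, let $\Gamma(V,\mathcal O_Y(E))$ be the set of rational functions $f$ with $f=0$ or $\operatorname{div}f+E\ge0$ on $V$, and for $f\neq0$ put $Y_f=Y\setminus\operatorname{Supp}(\operatorname{div}f+nE)$ when $f\in\Gamma(Y,\mathcal O_Y(nE))$; $E$ is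 semiample if for some $n>0$ the sets $Y_f$ with $0\ne f\in\Gamma(Y,\mathcal O_Y(nE))$ cover $Y$, and big if for some $n>0$ and some $0\neq f\in\Gamma(Y,\mathcal O_Y(nE))$ the set $Y_f$ is affine.) Put $\mathcal A=\bigoplus_{u\in\omega\cap M}\mathcal O_Y(\mathcal D(u))\,\chi^u$, a quasi-coherent sheaf of $\mathcal O_Y$-algebras, let $\pi\colon\widetilde X=\operatorname{Spec}_Y(\mathcal A)\to Y$ be its relative spectrum, $X=\operatorname{Spec}\Gamma(Y,\mathcal A)$, and let $r\colon\widetilde X\to X$ be the canonical contraction morphism. Then there is exactly one rational map $p\colon X\dashrightarrow C$ over $\mathbb C$ (the rational quotient map) such that, for some nonempty affine open $U\subset Y$ with $\Delta_P=\sigma$ for all $P\in U$, the natural morphism $U\times T\to X$ (given by the inclusion $\Gamma(Y,\mathcal A)\subset\Gamma(U,\mathcal O_Y)[M]$) is an open immersion, and $p$ restricts on $U\times T$ to the projection $U\times T\to U\subset C$. Let $X'$ be the closure of the graph of $p$ in $X\times C$, with its reduced structure, and let $X''$ be the normalization of $X'$. Then $\widetilde X$ is canonically isomorphic to $X''$: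 there is exactly one isomorphism $\widetilde X\to X''$ which is compatible with the morphisms $r\colon\widetilde X\to X$ and $X''\to X$ and with the morphisms $\pi\colon\widetilde X\to Y\subset C$ and $X''\to C$. -/

import Mathlib

open CategoryTheory CategoryTheory.Limits AlgebraicGeometry TopologicalSpace

noncomputable section

namespace PolyDiv

/-- The base scheme `Spec ℂ`. -/
abbrev SpecC : Scheme.{0} := Spec (CommRingCat.of ℂ)

/-! ## Curves -/

/-- A nonsingular curve over `ℂ`: an integral separated scheme of finite type over `ℂ` whose local
rings at closed points are regular of dimension one, i.e. discrete valuation rings. -/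
class IsNonsingularCurve (Y : Scheme.{0}) [Y.Over SpecC] : Prop where
  isIntegral : IsIntegral Y
  isSeparated : IsSeparated (Y ↘ SpecC)
  locallyOfFiniteType : LocallyOfFiniteType (Y ↘ SpecC)
  quasiCompact : QuasiCompact (Y ↘ SpecC)
  isDVR : ∀ x ∈ closedPoints Y, IsDiscreteValuationRing (Y.presheaf.stalk x)

attribute [instance] IsNonsingularCurve.isIntegral IsNonsingularCurve.isSeparated
  IsNonsingularCurve.locallyOfFiniteType IsNonsingularCurve.quasiCompact

section Curve

variable (Y : Scheme.{0}) [Y.Over SpecC] [IsNonsingularCurve Y]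

instance isNoetherian_curve : IsNoetherian Y where
  toIsLocallyNoetherian := LocallyOfFiniteType.isLocallyNoetherian (Y ↘ SpecC)
  toCompactSpace := QuasiCompact.compactSpace_of_compactSpace (Y ↘ SpecC)

instance isSeparated_curve : Y.IsSeparated :=
  ⟨by rw [← terminal.comp_from (Y ↘ SpecC)]; infer_instance⟩

instance isDVR_curve (x : closedPoints Y) : IsDiscreteValuationRing (Y.presheaf.stalk x.1) :=
  IsNonsingularCurve.isDVR _ x.2

variable {Y} in
theorem mem_closedPoints_of_ne {t : Y} (ht : t ≠ genericPoint Y) : t ∈ closedPoints Y := by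
  obtain ⟨y, hy, hyc⟩ := (isClosed_closure (s := {t})).exists_closed_singleton ⟨t, subset_closure rfl⟩
  have hty : t ⤳ y := specializes_iff_mem_closure.mpr hy
  have key (q : PrimeSpectrum (Y.presheaf.stalk y)) :
      q.asIdeal = ⊥ ∨ q = IsLocalRing.closedPoint (Y.presheaf.stalk y) := by
    have : IsDiscreteValuationRing (Y.presheaf.stalk y) := isDVR_curve Y ⟨y, hyc⟩
    by_cases h : q.asIdeal = ⊥
    · exact .inl h
    · right
      ext1
      exact IsLocalRing.eq_maximalIdeal (q.2.isMaximal h)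
  have hr (s : Y) (hs : s ⤳ y) : ∃ q, Y.fromSpecStalk y q = s := by
    change s ∈ Set.range (Y.fromSpecStalk y)
    rw [Scheme.range_fromSpecStalk]; exact hs
  obtain ⟨q, rfl⟩ := hr t hty
  rcases key q with hq | rfl
  · exfalso
    have hη := (genericPoint_spec Y).specializes (Set.mem_univ y)
    obtain ⟨q', hq'⟩ := hr _ hη
    rcases key q' with h' | rfl
    · exact ht (by rw [← hq', PrimeSpectrum.ext (hq.trans h'.symm)])
    · rw [Scheme.fromSpecStalk_closedPoint] at hq'
      have h1 := (genericPoint_spec Y).def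
      rw [← hq', (mem_closedPoints_iff.mp hyc).closure_eq] at h1
      apply ht
      rw [← hq', ← Set.mem_singleton_iff, h1]
      trivial
  · rwa [Scheme.fromSpecStalk_closedPoint]

variable {Y} in
theorem finite_compl {W : Y.Opens} (hW : genericPoint Y ∈ W) : ((W : Set Y)ᶜ).Finite := by
  obtain ⟨S, hS, hS', hS''⟩ := NoetherianSpace.exists_finite_set_isClosed_irreducible
    (s := (W : Set Y)ᶜ) W.isOpen.isClosed_compl
  rw [hS''.2]
  refine Set.Finite.sUnion hS fun T hT ↦ ?_
  obtain ⟨t, ht⟩ := QuasiSober.sober (hS''.1 T hT) (hS' T hT)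
  have htT : t ∈ T := by rw [← ht.def]; exact subset_closure rfl
  have htW : t ∈ (W : Set Y)ᶜ := by rw [hS''.2]; exact ⟨T, hT, htT⟩
  have htc := mem_closedPoints_of_ne (t := t) (by rintro rfl; exact htW hW)
  rw [← ht.def, (mem_closedPoints_iff.mp htc).closure_eq]
  exact Set.finite_singleton _

end Curve

/-! ## Sections of `ℚ`-divisors

A `ℚ`-divisor on a curve is given by its coefficients at the closed points. -/

section Divisors

variable {Y : Scheme.{0}} [Y.Over SpecC] [IsNonsingularCurve Y]

/-- `Γ(V, 𝒪_Y(E))` for a `ℚ`-divisor `E`: the rational functions `f` with `f = 0` or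
`div f + E ≥ 0` on `V`. -/
def divisorSections (E : closedPoints Y → ℚ) (V : Y.Opens) : AddSubgroup Y.functionField where
  carrier := {f | f ≠ 0 → ∀ P : closedPoints Y, P.1 ∈ V → 0 ≤ (Scheme.ord f P.1 : ℚ) + E P}
  zero_mem' h := absurd rfl h
  add_mem' {f g} hf hg hfg P hP := by
    by_cases hf0 : f = 0
    · subst hf0; simp only [zero_add] at hfg ⊢; exact hg hfg P hP
    by_cases hg0 : g = 0
    · subst hg0; simp only [add_zero] at hfg ⊢; exact hf hfg P hP
    have h1 := hf hf0 P hP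
    have h2 := hg hg0 P hP
    have h3 : ((min (Scheme.ord f P.1) (Scheme.ord g P.1) : ℤ) : ℚ) ≤
      Scheme.ord (f + g) P.1 := by exact_mod_cast Scheme.ord_add hfg
    rcases min_choice (Scheme.ord f P.1) (Scheme.ord g P.1) with h | h <;>
      (rw [h] at h3; linarith)
  neg_mem' {f} hf hf0 P hP := by
    have hf0' : f ≠ 0 := by simpa using hf0
    have h1 := hf hf0' P hP
    have : Nonempty (⊤ : Y.Opens) := ⟨⟨P.1, trivial⟩⟩
    have h2 := Scheme.ord_le_smul (U := ⊤) (x := P.1) trivial (a := -1) (by simp) f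
    rw [neg_smul, one_smul] at h2
    have h3 : (Scheme.ord f P.1 : ℚ) ≤ Scheme.ord (-f) P.1 := by exact_mod_cast h2
    linarith

theorem mul_mem_divisorSections {E E' E'' : closedPoints Y → ℚ} {V : Y.Opens}
    (h : ∀ P, E P + E' P ≤ E'' P) {f g : Y.functionField}
    (hf : f ∈ divisorSections E V) (hg : g ∈ divisorSections E' V) :
    f * g ∈ divisorSections E'' V := by
  intro hfg P hP
  have hf0 := left_ne_zero_of_mul hfg
  have hg0 := right_ne_zero_of_mul hfg
  rw [Scheme.ord_mul hf0 hg0]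
  push_cast
  linarith [hf hf0 P hP, hg hg0 P hP, h P]

theorem divisorSections_anti (E : closedPoints Y → ℚ) {V W : Y.Opens} (h : V ≤ W) :
    divisorSections E W ≤ divisorSections E V :=
  fun _ hf hf0 P hP ↦ hf hf0 P (h hP)

theorem ord_germ_nonneg {V : Y.Opens} {x : Y} (hx : x ∈ V) (f : Γ(Y, V)) :
    0 ≤ Scheme.ord (algebraMap (Y.presheaf.stalk x) Y.functionField (Y.presheaf.germ V x hx f)) x := by
  have : Nonempty V := ⟨⟨x, hx⟩⟩
  rw [Scheme.algebraMap_germ_eq_germToFunctionField]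
  by_cases hf : f = 0
  · simp [hf]
  have h := Scheme.ord_le_smul hx hf (1 : Y.functionField)
  rw [Algebra.smul_def, mul_one] at h
  refine le_trans ?_ h
  have h1 := Scheme.ord_of_isUnit (f := (1 : Γ(Y, V))) isUnit_one hx
  rw [map_one] at h1
  exact h1.ge

/-- The complement `Y_f` of the support of `div f + E`. -/
def nonvanishingLocus (E : closedPoints Y → ℚ) (f : Y.functionField) : Set Y :=
  {x | ∀ h : x ∈ closedPoints Y, (Scheme.ord f x : ℚ) + E ⟨x, h⟩ = 0}

/-- A `ℚ`-divisor `E` is semiample if for some positive multiple `nE` the curve is covered by the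
sets `Y_f` with `f` a nonzero global section of `𝒪_Y(nE)`. -/
def IsSemiample (E : closedPoints Y → ℚ) : Prop :=
  ∃ n : ℕ, 0 < n ∧ ∀ x : Y, ∃ f : Y.functionField, f ≠ 0 ∧ f ∈ divisorSections (n • E) ⊤ ∧
    x ∈ nonvanishingLocus (n • E) f

/-- A `ℚ`-divisor `E` is big if some positive multiple `nE` has a nonzero global section `f` such
that `Y_f` is affine. -/
def IsBig (E : closedPoints Y → ℚ) : Prop :=
  ∃ n : ℕ, 0 < n ∧ ∃ f : Y.functionField, f ≠ 0 ∧ f ∈ divisorSections (n • E) ⊤ ∧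
    ∃ W : Y.Opens, (W : Set Y) = nonvanishingLocus (n • E) f ∧ IsAffineOpen W

variable {M : Type} [AddCommGroup M]

open AddMonoidAlgebra in
/-- The ring `⨁_{u ∈ S} Γ(V, 𝒪_Y(E u)) χ^u ⊆ K(Y)[M]` attached to a submonoid `S ⊆ M` and a
superadditive family of `ℚ`-divisors `E u`. -/
def gradedSections (S : AddSubmonoid M) (E : M → closedPoints Y → ℚ)
    (h0 : ∀ P, 0 ≤ E 0 P) (hE : ∀ u ∈ S, ∀ w ∈ S, ∀ P, E u P + E w P ≤ E (u + w) P)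
    (V : Y.Opens) : Subring (AddMonoidAlgebra Y.functionField M) where
  carrier := {a | ∀ u, a.coeff u ≠ 0 → u ∈ S ∧ a.coeff u ∈ divisorSections (E u) V}
  zero_mem' u hu := by simp at hu
  add_mem' {a b} ha hb u hu := by
    rw [coeff_add, Finsupp.add_apply] at hu ⊢
    have ha' : a.coeff u ∈ divisorSections (E u) V := by
      by_cases h : a.coeff u = 0
      · rw [h]; exact zero_mem _
      · exact (ha u h).2
    have hb' : b.coeff u ∈ divisorSections (E u) V := by
      by_cases h : b.coeff u = 0
      · rw [h]; exact zero_mem _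
      · exact (hb u h).2
    refine ⟨?_, add_mem ha' hb'⟩
    by_cases h : a.coeff u = 0
    · exact (hb u (by intro h'; simp [h, h'] at hu)).1
    · exact (ha u h).1
  neg_mem' {a} ha u hu := by
    rw [coeff_neg, Finsupp.neg_apply] at hu ⊢
    have := ha u (by simpa using hu)
    exact ⟨this.1, neg_mem this.2⟩
  one_mem' u hu := by
    classical
    rw [AddMonoidAlgebra.one_def, coeff_single, Finsupp.single_apply] at hu ⊢
    split_ifs at hu ⊢ with h
    · subst h
      refine ⟨zero_mem _, fun _ P hP ↦ ?_⟩
      have := ord_germ_nonneg (V := ⊤) (x := P.1) trivial (1 : Γ(Y, ⊤))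
      rw [map_one, map_one] at this
      have h2 : (0 : ℚ) ≤ Scheme.ord (1 : Y.functionField) P.1 := by exact_mod_cast this
      linarith [h0 P]
    · exact absurd rfl hu
  mul_mem' {a b} ha hb u hu := by
    classical
    have key (v w : M) (hv : v ∈ a.coeff.support) (hw : w ∈ b.coeff.support) (h : v + w = u) :
        u ∈ S ∧ a.coeff v * b.coeff w ∈ divisorSections (E u) V := by
      have h1 := ha v (Finsupp.mem_support_iff.mp hv)
      have h2 := hb w (Finsupp.mem_support_iff.mp hw)
      subst h
      exact ⟨add_mem h1.1 h2.1, mul_mem_divisorSections (hE v h1.1 w h2.1) h1.2 h2.2⟩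
    rw [coeff_mul, Finsupp.sum] at hu ⊢
    constructor
    · by_contra hS
      apply hu
      refine Finset.sum_eq_zero fun v hv ↦ Finset.sum_eq_zero fun w hw ↦ ?_
      dsimp only
      split_ifs with h
      · exact absurd (key v w hv hw h).1 hS
      · rfl
    · refine sum_mem fun v hv ↦ sum_mem fun w hw ↦ ?_
      dsimp only
      split_ifs with h
      · exact (key v w hv hw h).2
      · exact zero_mem _


variable (M) in
/-- The coordinate ring `Γ(U, 𝒪_Y)[M] ⊆ K(Y)[M]` of `U × T`, for `U ⊆ Y` affine open and nonempty,
where `T = Spec ℂ[M]`. As `Y` is normal, a rational function is regular on `U` if and only if it has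
no poles on `U`, that is, if and only if it is a section of `𝒪_Y(0)` over `U`. -/
def torusSections (U : Y.Opens) : Subring (AddMonoidAlgebra Y.functionField M) :=
  gradedSections ⊤ 0 (fun _ ↦ le_rfl) (fun _ _ _ _ _ ↦ by simp) U

variable (M) in
/-- `U × T` for `U ⊆ Y` affine open and nonempty. -/
def torus (U : Y.Opens) : Scheme.{0} := Spec (CommRingCat.of (torusSections M U))

variable (M) in
/-- The inclusion `Γ(U, 𝒪_Y) ⟶ Γ(U, 𝒪_Y)[M]`. -/
def toTorusSections (U : Y.Opens) [Nonempty U] : Γ(Y, U) →+* torusSections M U :=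
  ((AddMonoidAlgebra.singleZeroRingHom (R := Y.functionField) (M := M)).comp
    (Y.germToFunctionField U).hom).codRestrict _ (fun f u hu ↦ by
      classical
      change (AddMonoidAlgebra.single (0 : M) (Y.germToFunctionField U f)).coeff u ≠ 0 at hu
      change u ∈ (⊤ : AddSubmonoid M) ∧
        (AddMonoidAlgebra.single (0 : M) (Y.germToFunctionField U f)).coeff u ∈
          divisorSections _ U
      rw [AddMonoidAlgebra.coeff_single, Finsupp.single_apply] at hu ⊢
      split_ifs at hu ⊢ with h
      · refine ⟨trivial, fun _ P hP ↦ ?_⟩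
        have h1 := ord_germ_nonneg hP f
        rw [Scheme.algebraMap_germ_eq_germToFunctionField] at h1
        simp only [Pi.zero_apply, add_zero]
        exact_mod_cast h1
      · exact absurd rfl hu)

variable (M) in
/-- The projection `U × T ⟶ U ⊆ Y`. -/
def torusProj {U : Y.Opens} (hU : IsAffineOpen U) [Nonempty U] : torus M U ⟶ Y :=
  Spec.map (CommRingCat.ofHom (toTorusSections M U)) ≫ hU.fromSpec


end Divisors

/-! ## Polyhedral divisors

`M` is the character lattice. The vector space `N_ℚ = Hom(M, ℤ) ⊗ ℚ` is represented by
`Hom(M, ℚ)`, so the pairing `⟨u, v⟩` is `v u`. -/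

section Polyhedral

/-- The rational vector space `N_ℚ`. -/
abbrev NQ (M : Type) [AddCommGroup M] : Type := M →ₗ[ℤ] ℚ

variable {M : Type} [AddCommGroup M]

open scoped Pointwise in
/-- `Δ` is a polyhedron with tail cone `σ`: the Minkowski sum of `σ` and a (nonempty) polytope. -/
def IsPolyhedronWithTail (σ : PointedCone ℚ (NQ M)) (Δ : Set (NQ M)) : Prop :=
  ∃ F : Finset (NQ M), F.Nonempty ∧ Δ = convexHull ℚ (F : Set (NQ M)) + (σ : Set (NQ M))

/-- `min ⟨u, Δ⟩`. -/
def minPairing (u : M) (Δ : Set (NQ M)) : ℚ :=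
  Classical.epsilon (IsLeast ((fun v : NQ M ↦ v u) '' Δ))

/-- The weight monoid `ω ∩ M`, where `ω` is the dual cone of `σ`. -/
def weightMonoid (σ : PointedCone ℚ (NQ M)) : AddSubmonoid M where
  carrier := {u | ∀ v ∈ σ, 0 ≤ v u}
  zero_mem' v _ := by simp
  add_mem' {u w} hu hw v hv := by rw [map_add]; exact add_nonneg (hu v hv) (hw v hv)

/-- The lattice points of the relative interior of `ω`: those `u ∈ ω ∩ M` such that for every
`w ∈ ω ∩ M` one can move from `u` a little in the direction `-w` without leaving `ω`. -/
def interiorWeights (σ : PointedCone ℚ (NQ M)) : Set M :=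
  {u | u ∈ weightMonoid σ ∧ ∀ w ∈ weightMonoid σ, ∃ n : ℕ, n • u - w ∈ weightMonoid σ}

theorem IsPolyhedronWithTail.isLeast {σ : PointedCone ℚ (NQ M)} {Δ : Set (NQ M)}
    (h : IsPolyhedronWithTail σ Δ) {u : M} (hu : u ∈ weightMonoid σ) :
    IsLeast ((fun v : NQ M ↦ v u) '' Δ) (minPairing u Δ) := by
  refine Classical.epsilon_spec (p := IsLeast ((fun v : NQ M ↦ v u) '' Δ)) ?_
  obtain ⟨F, hF, rfl⟩ := h
  obtain ⟨v₀, hv₀, hmin⟩ := F.exists_min_image (fun v ↦ v u) hF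
  refine ⟨v₀ u, ⟨v₀, ⟨v₀, subset_convexHull _ _ hv₀, 0, σ.zero_mem, add_zero _⟩, rfl⟩, ?_⟩
  rintro _ ⟨_, ⟨v, hv, w, hw, rfl⟩, rfl⟩
  have hsub : convexHull ℚ (F : Set (NQ M)) ⊆ {v | v₀ u ≤ v u} := by
    refine convexHull_min (fun v hv ↦ hmin v hv) ?_
    intro x hx y hy a b ha hb hab
    simp only [Set.mem_ofPred_eq, LinearMap.add_apply, LinearMap.smul_apply, smul_eq_mul] at *
    have : v₀ u = a * v₀ u + b * v₀ u := by rw [← add_mul, hab, one_mul]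
    rw [this]
    gcongr
  have h1 : v₀ u ≤ v u := hsub hv
  have h2 : 0 ≤ w u := hu w hw
  simp only [LinearMap.add_apply]
  linarith

/-- A polyhedral divisor `𝒟 = ∑ Δ_P ⊗ P` on the curve `Y` whose coefficients are polyhedra with
tail cone `σ`, all but finitely many of them equal to `σ`. -/
structure PolyhedralDivisor (Y : Scheme.{0}) (σ : PointedCone ℚ (NQ M)) where
  coeff : closedPoints Y → Set (NQ M)
  isPolyhedron : ∀ P, IsPolyhedronWithTail σ (coeff P)
  finite_nontrivial : {P | coeff P ≠ (σ : Set (NQ M))}.Finite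

namespace PolyhedralDivisor

variable {Y : Scheme.{0}} {σ : PointedCone ℚ (NQ M)} (D : PolyhedralDivisor Y σ)

/-- The `ℚ`-divisor `𝒟(u) = ∑ min ⟨u, Δ_P⟩ · P`. -/
def eval (u : M) : closedPoints Y → ℚ := fun P ↦ minPairing u (D.coeff P)

theorem eval_zero (P : closedPoints Y) : D.eval 0 P = 0 := by
  obtain ⟨v, -, hv⟩ := ((D.isPolyhedron P).isLeast (zero_mem _)).1
  rw [eval, ← hv]
  simp

theorem eval_add_le {u w : M} (hu : u ∈ weightMonoid σ) (hw : w ∈ weightMonoid σ)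
    (P : closedPoints Y) : D.eval u P + D.eval w P ≤ D.eval (u + w) P := by
  obtain ⟨v, hv, hv'⟩ := ((D.isPolyhedron P).isLeast (add_mem hu hw)).1
  have h1 := ((D.isPolyhedron P).isLeast hu).2 ⟨v, hv, rfl⟩
  have h2 := ((D.isPolyhedron P).isLeast hw).2 ⟨v, hv, rfl⟩
  simp only [map_add] at hv'
  rw [eval, eval, eval, ← hv']
  exact add_le_add h1 h2

variable [Y.Over SpecC] [IsNonsingularCurve Y]

/-- `𝒟` is proper: `𝒟(u)` is semiample for all `u ∈ ω ∩ M` and big for all `u` in the relative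
interior of `ω`. -/
structure IsProper : Prop where
  semiample : ∀ u ∈ weightMonoid σ, IsSemiample (D.eval u)
  big : ∀ u ∈ interiorWeights σ, IsBig (D.eval u)

/-- The ring `Γ(V, 𝒜) = ⨁_{u ∈ ω ∩ M} Γ(V, 𝒪_Y(𝒟(u))) χ^u ⊆ K(Y)[M]` for nonempty open `V`. -/
def sections (V : Y.Opens) : Subring (AddMonoidAlgebra Y.functionField M) :=
  gradedSections (weightMonoid σ) D.eval (fun P ↦ (D.eval_zero P).ge)
    (fun _ hu _ hw P ↦ D.eval_add_le hu hw P) V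

theorem sections_anti {V W : Y.Opens} (h : V ≤ W) : D.sections W ≤ D.sections V :=
  fun _ ha u hu ↦ ⟨(ha u hu).1, divisorSections_anti _ h (ha u hu).2⟩

theorem structureMap_mem (V : Y.Opens) (f : Γ(Y, V)) :
    (fun x : V ↦ AddMonoidAlgebra.single (0 : M) (algebraMap (Y.presheaf.stalk x.1) Y.functionField
      (Y.presheaf.germ V x.1 x.2 f))) ∈ (D.sections V).map (Pi.constRingHom V _) := by
  classical
  rcases isEmpty_or_nonempty V with hV | hV
  · exact ⟨0, (D.sections V).zero_mem, Subsingleton.elim _ _⟩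
  refine ⟨AddMonoidAlgebra.single (0 : M) (Y.germToFunctionField V f), fun u hu ↦ ?_, ?_⟩
  · rw [AddMonoidAlgebra.coeff_single, Finsupp.single_apply] at hu ⊢
    split_ifs at hu ⊢ with h
    · subst h
      refine ⟨zero_mem _, fun _ P hP ↦ ?_⟩
      have h1 := ord_germ_nonneg hP f
      rw [Scheme.algebraMap_germ_eq_germToFunctionField] at h1
      rw [D.eval_zero, add_zero]
      exact_mod_cast h1
    · exact absurd rfl hu
  · funext x
    simp only [Scheme.algebraMap_germ_eq_germToFunctionField, Pi.constRingHom_apply]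
    rfl


/-! ### The sheaf of algebras and its relative spectrum -/



/-- The ring `Γ(V, 𝒜)` for every open `V`. Its elements are the constant functions on `V` with
value in `D.sections V`; thus it is a copy of `D.sections V` if `V` is nonempty, and it is the zero
ring if `V` is empty. -/
def sheafSections (V : Y.Opens) : Subring (V → AddMonoidAlgebra Y.functionField M) :=
  (D.sections V).map (Pi.constRingHom V _)

/-- The restriction maps of `𝒜`. -/
def res {V W : Y.Opens} (h : V ≤ W) : D.sheafSections W →+* D.sheafSections V :=
  (RingHom.pi fun x : V ↦ Pi.evalRingHom (fun _ : W ↦ AddMonoidAlgebra Y.functionField M)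
    ⟨x.1, h x.2⟩).restrict _ _ (by
      rintro _ ⟨a, ha, rfl⟩
      exact ⟨a, D.sections_anti h ha, rfl⟩)

/-- The structure maps `Γ(V, 𝒪_Y) ⟶ Γ(V, 𝒜)`, onto the part of degree `0`. -/
def structureMap (V : Y.Opens) : Γ(Y, V) →+* D.sheafSections V :=
  (RingHom.pi fun x : V ↦ (AddMonoidAlgebra.singleZeroRingHom (R := Y.functionField) (M := M)).comp
    ((algebraMap (Y.presheaf.stalk x.1) Y.functionField).comp
      (Y.presheaf.germ V x.1 x.2).hom)).codRestrict _ (D.structureMap_mem V)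

/-- The sheaf `𝒜` as a presheaf of rings on `Y`. -/
def sheaf : Y.Opensᵒᵖ ⥤ CommRingCat where
  obj V := .of (D.sheafSections V.unop)
  map i := CommRingCat.ofHom (D.res i.unop.le)
  map_id _ := rfl
  map_comp _ _ := rfl

/-- The `𝒪_Y`-algebra structure of `𝒜`. -/
def structureHom : Y.presheaf ⟶ D.sheaf where
  app V := CommRingCat.ofHom (D.structureMap V.unop)
  naturality {V W} i := by
    ext f
    apply Subtype.ext
    funext x
    change AddMonoidAlgebra.single 0 (algebraMap (Y.presheaf.stalk x.1) Y.functionField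
      (Y.presheaf.germ W.unop x.1 x.2 (Y.presheaf.map i f))) = AddMonoidAlgebra.single 0
      (algebraMap (Y.presheaf.stalk x.1) Y.functionField
        (Y.presheaf.germ V.unop x.1 (i.unop.le x.2) f))
    rw [TopCat.Presheaf.germ_res_apply']

theorem exists_mul_mem {V : Y.Opens} [Nonempty V] {f : Γ(Y, V)} (hf : f ≠ 0)
    {a : AddMonoidAlgebra Y.functionField M} (ha : a ∈ D.sections (Y.basicOpen f)) :
    ∃ n : ℕ, AddMonoidAlgebra.single (0 : M) (Y.germToFunctionField V f ^ n) * a ∈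
      D.sections V := by
  set φ := Y.germToFunctionField V f with hφ
  have hφ0 : φ ≠ 0 := by
    rw [hφ, Ne, map_eq_zero_iff _ (Y.germToFunctionField_injective V)]; exact hf
  have hfin : ((Y.basicOpen f : Set Y)ᶜ).Finite := by
    refine finite_compl ?_
    rw [Scheme.mem_basicOpen _ _ _ (((genericPoint_spec Y).mem_open_set_iff V.isOpen).mpr
      (by simpa using ‹Nonempty V›))]
    exact isUnit_iff_ne_zero.mpr hφ0
  have hpos (x : closedPoints Y) (hx : x.1 ∈ V) (hxf : x.1 ∉ Y.basicOpen f) :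
      1 ≤ Scheme.ord φ x.1 := by
    have h0 := ord_germ_nonneg hx f
    rw [Scheme.algebraMap_germ_eq_germToFunctionField, ← hφ] at h0
    by_contra hlt
    have hz : Scheme.ord φ x.1 = 0 := by lia
    have hco : Order.coheight x.1 = 1 := by
      have h1 := ringKrullDim_stalk_eq_coheight x.1
      rw [IsDiscreteValuationRing.ringKrullDim_eq_one] at h1
      exact_mod_cast h1.symm
    rw [Scheme.ord_eq_iff hco hφ0] at hz
    refine hxf ((Y.mem_basicOpen f x.1 hx).mpr ?_)
    rw [Ring.isUnit_iff_ordFrac_one_of_isDiscreteValuationRing (K := Y.functionField),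
      Scheme.algebraMap_germ_eq_germToFunctionField]
    exact hz
  have hpow (n : ℕ) (x : Y) : Scheme.ord (φ ^ n) x = n * Scheme.ord φ x := by
    induction n with
    | zero =>
      have := Scheme.ord_mul (x := x) (one_ne_zero (α := Y.functionField)) one_ne_zero
      simp at this ⊢
      exact this
    | succ n ih =>
      rw [pow_succ, Scheme.ord_mul (pow_ne_zero _ hφ0) hφ0, ih]; push_cast; ring
  -- a bound for all relevant poles
  obtain ⟨n, hn⟩ : ∃ n : ℕ, ∀ u ∈ a.coeff.support, ∀ P : closedPoints Y, P.1 ∉ Y.basicOpen f →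
      -((Scheme.ord (a.coeff u) P.1 : ℚ) + D.eval u P) ≤ n := by
    have hfin' : {P : closedPoints Y | P.1 ∉ Y.basicOpen f}.Finite :=
      hfin.preimage Subtype.val_injective.injOn
    obtain ⟨B, hB⟩ := ((a.coeff.support.finite_toSet.prod hfin').image
      (fun q ↦ -((Scheme.ord (a.coeff q.1) q.2.1 : ℚ) + D.eval q.1 q.2))).bddAbove
    obtain ⟨n, hn⟩ := exists_nat_ge B
    exact ⟨n, fun u hu P hP ↦ (hB ⟨(u, P), ⟨hu, hP⟩, rfl⟩).trans hn⟩
  refine ⟨n, fun u hu ↦ ?_⟩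
  rw [AddMonoidAlgebra.coeff_single_zero_mul] at hu ⊢
  have hu' := right_ne_zero_of_mul hu
  obtain ⟨h1, h2⟩ := ha u hu'
  refine ⟨h1, fun _ P hP ↦ ?_⟩
  rw [Scheme.ord_mul (left_ne_zero_of_mul hu) hu', hpow]
  push_cast
  by_cases hPf : P.1 ∈ Y.basicOpen f
  · have h3 := ord_germ_nonneg hP f
    rw [Scheme.algebraMap_germ_eq_germToFunctionField, ← hφ] at h3
    have h3' : (0 : ℚ) ≤ Scheme.ord φ P.1 := by exact_mod_cast h3
    have h4 := h2 hu' P hPf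
    have : (0 : ℚ) ≤ n * Scheme.ord φ P.1 := by positivity
    linarith
  · have h3 := hn u (Finsupp.mem_support_iff.mpr hu') P hPf
    have h4 : (1 : ℚ) ≤ Scheme.ord φ P.1 := by exact_mod_cast hpos P hP hPf
    have : (n : ℚ) * 1 ≤ n * Scheme.ord φ P.1 := by gcongr
    linarith

/-- `𝒜` is quasi-coherent: `Γ(V_f, 𝒜) = Γ(V, 𝒜)_f` for affine open `V` and `f ∈ Γ(V, 𝒪_Y)`. -/
theorem coequifibered_structureHom :
    ((Scheme.AffineZariskiSite.toOpensFunctor Y).op.whiskerLeft D.structureHom).Coequifibered := by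
  refine Scheme.AffineZariskiSite.coequifibered_iff_forall_isLocalizationAway.mpr fun V f ↦ ?_
  let ρ : D.sheafSections V.1 →+* D.sheafSections (Y.basicOpen f) := D.res (Y.basicOpen_le f)
  let : Algebra (D.sheafSections V.1) (D.sheafSections (Y.basicOpen f)) := ρ.toAlgebra
  change IsLocalization.Away (D.structureMap V.1 f) (D.sheafSections (Y.basicOpen f))
  have hnat : ρ (D.structureMap V.1 f) = D.structureMap (Y.basicOpen f)
      (Y.presheaf.map (homOfLE (Y.basicOpen_le f)).op f) :=
    congr($(D.structureHom.naturality (homOfLE (Y.basicOpen_le f)).op).hom f).symm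
  have hval (x : V.1) [Nonempty V.1] : (D.structureMap V.1 f).1 x =
      AddMonoidAlgebra.single 0 (Y.germToFunctionField V.1 f) := by
    rw [← Scheme.algebraMap_germ_eq_germToFunctionField (X := Y) x.2]
    rfl
  refine IsLocalization.Away.mk _ ?_ ?_ ?_
  · change IsUnit (ρ (D.structureMap V.1 f))
    rw [hnat]
    exact (Y.toRingedSpace.isUnit_res_basicOpen f).map _
  · rintro ⟨_, a, ha, rfl⟩
    rcases isEmpty_or_nonempty (Y.basicOpen f) with hE | hE
    · exact ⟨0, 0, Subtype.ext (funext fun x ↦ hE.elim x)⟩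
    have : Nonempty V.1 := ⟨⟨hE.some.1, Y.basicOpen_le f hE.some.2⟩⟩
    have hf : f ≠ 0 := by
      intro h
      obtain ⟨x, hx⟩ := hE
      rw [h, Scheme.basicOpen_zero] at hx
      exact hx
    obtain ⟨n, hn⟩ := D.exists_mul_mem hf ha
    refine ⟨n, ⟨_, _, hn, rfl⟩, Subtype.ext (funext fun x ↦ ?_)⟩
    change a * (D.structureMap V.1 f).1 ⟨x.1, Y.basicOpen_le f x.2⟩ ^ n = _ * a
    rw [hval, AddMonoidAlgebra.single_pow, nsmul_zero, mul_comm]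
  · rintro ⟨_, a, ha, rfl⟩ ⟨_, b, hb, rfl⟩ hab
    rcases isEmpty_or_nonempty (Y.basicOpen f) with hE | hE
    · have hf : f = 0 := by
        rw [← basicOpen_eq_bot_iff]
        ext x
        exact ⟨fun hx ↦ hE.elim ⟨x, hx⟩, fun hx ↦ hx.elim⟩
      exact ⟨1, by rw [hf, map_zero]; simp⟩
    · have h1 : a = b := congrFun (congrArg Subtype.val hab) hE.some
      subst h1
      exact ⟨0, rfl⟩

/-- The gluing datum of the affine schemes `Spec Γ(V, 𝒜)`, with `V ⊆ Y` affine open. -/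
def glueData := Scheme.AffineZariskiSite.relativeGluingData D.coequifibered_structureHom

instance : (D.glueData.functor ⋙ Scheme.forget).IsLocallyDirected :=
  Scheme.Cover.RelativeGluingData.instIsLocallyDirectedI₀CompFunctorForgetOfIsThin ..

/-- `X̃ = Spec_Y 𝒜`, the relative spectrum of `𝒜`. -/
def Xtilde : Scheme.{0} := D.glueData.glued

/-- The structure morphism `π : X̃ ⟶ Y`. -/
def π : D.Xtilde ⟶ Y := D.glueData.toBase

/-- `X = Spec Γ(Y, 𝒜)`. -/
def X : Scheme.{0} := Spec (CommRingCat.of (D.sheafSections ⊤))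

/-- The contraction morphism `X̃ ⟶ X`, induced by the maps `Γ(Y, 𝒜) ⟶ Γ(V, 𝒜)`. -/
def contraction : D.Xtilde ⟶ D.X :=
  colimit.desc D.glueData.functor
    { pt := D.X
      ι :=
        { app := fun V ↦ Spec.map (CommRingCat.ofHom (D.res (le_top : V.1 ≤ ⊤)))
          naturality := fun V W i ↦ by
            change Spec.map (CommRingCat.ofHom (D.res (Scheme.AffineZariskiSite.toOpens_mono i.le)))
              ≫ Spec.map (CommRingCat.ofHom (D.res (le_top : W.1 ≤ ⊤))) =
              Spec.map (CommRingCat.ofHom (D.res (le_top : V.1 ≤ ⊤))) ≫ 𝟙 _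
            rw [Category.comp_id, ← Spec.map_comp]
            rfl } }

/-- `X` as a scheme over `ℂ`, through `ℂ ⟶ Γ(Y, 𝒪_Y) ⟶ Γ(Y, 𝒜)`. -/
instance : D.X.Over SpecC :=
  ⟨Spec.map ((Scheme.ΓSpecIso (CommRingCat.of ℂ)).inv ≫ (Y ↘ SpecC).appTop ≫
    CommRingCat.ofHom (D.structureMap ⊤))⟩

instance : IsAffine D.X := inferInstanceAs (IsAffine (Spec _))

/-! ### The rational quotient map -/

/-- All coefficients of `𝒟` at the points of `U` are trivial. -/
def IsTrivialOn (U : Y.Opens) : Prop :=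
  ∀ P : closedPoints Y, P.1 ∈ U → D.coeff P = (σ : Set (NQ M))

theorem IsTrivialOn.mem_torusSections {D : PolyhedralDivisor Y σ} {U : Y.Opens}
    (h : D.IsTrivialOn U) {a : AddMonoidAlgebra Y.functionField M} (ha : a ∈ D.sections ⊤) :
    a ∈ torusSections M U := by
  intro u hu
  refine ⟨trivial, fun h0 P hP ↦ ?_⟩
  obtain ⟨h1, h2⟩ := ha u hu
  have h3 := h2 h0 P trivial
  have h4 : D.eval u P ≤ 0 := by
    refine ((D.isPolyhedron P).isLeast h1).2 ⟨0, ?_, by simp⟩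
    rw [h P hP]
    exact σ.zero_mem
  simp only [Pi.zero_apply, add_zero]
  linarith

/-- The morphism `U × T ⟶ X` for an open subset `U` of `Y` on which `𝒟` is trivial: on rings it is
the inclusion `Γ(Y, 𝒜) ⊆ Γ(U, 𝒪_Y)[M]`. -/
def torusToX {U : Y.Opens} (h : D.IsTrivialOn U) : torus M U ⟶ D.X :=
  Spec.map (CommRingCat.ofHom ((Pi.evalRingHom
    (fun _ : (⊤ : Y.Opens) ↦ AddMonoidAlgebra Y.functionField M) ⟨genericPoint Y, trivial⟩).restrict
      (D.sheafSections ⊤) (torusSections M U) (by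
        rintro _ ⟨a, ha, rfl⟩
        exact h.mem_torusSections ha)))

/-- `p : X ⤏ C` is the rational quotient map: for some nonempty affine open `U ⊆ Y` on which `𝒟` is
trivial, `U × T` is an open subscheme of `X`, and on it `p` is the projection
`U × T ⟶ U ⊆ Y ⊆ C`. Here `j : Y ⟶ C` is the inclusion. -/
def IsRationalQuotientMap {C : Scheme.{0}} (j : Y ⟶ C) (p : D.X ⤏ C) : Prop :=
  ∃ (U : Y.Opens) (hU : IsAffineOpen U) (_ : Nonempty U) (h : D.IsTrivialOn U),
    IsOpenImmersion (D.torusToX h) ∧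
    ∃ f : D.X.PartialMap C, f.toRationalMap = p ∧ ∃ g : torus M U ⟶ f.domain,
      g ≫ f.domain.ι = D.torusToX h ∧ g ≫ f.hom = torusProj M hU ≫ j

instance isIntegral_X [Module.Free ℤ M] : IsIntegral D.X := by
  have : TwoUniqueSums M := by
    let b := Module.Free.chooseBasis ℤ M
    exact b.repr.toAddEquiv.twoUniqueSums_iff.mpr inferInstance
  have : IsDomain (D.sheafSections ⊤) := by
    let e : D.sheafSections ⊤ →+* AddMonoidAlgebra Y.functionField M :=
      (Pi.evalRingHom (fun _ : (⊤ : Y.Opens) ↦ AddMonoidAlgebra Y.functionField M)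
        ⟨genericPoint Y, trivial⟩).comp (D.sheafSections ⊤).subtype
    have he : Function.Injective e := by
      rintro ⟨_, a, ha, rfl⟩ ⟨_, b, hb, rfl⟩ hab
      have h1 : a = b := hab
      subst h1
      rfl
    have : IsDomain (AddMonoidAlgebra Y.functionField M) := { }
    exact he.isDomain e
  exact inferInstanceAs (IsIntegral (Spec _))

end PolyhedralDivisor

end Polyhedral

/-! ## Graphs of rational maps and normalization -/

section Graph

variable {X C : Scheme.{0}} [X.Over SpecC] [C.Over SpecC] [IsIntegral X] [C.IsSeparated]
  (p : X ⤏ C) [p.IsOver SpecC]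

/-- The graph `x ↦ (x, p(x))` of a rational map `p : X ⤏ C` over `ℂ`, as a morphism from the domain
of definition of `p` to `X × C`. -/
def graph : (p.toPartialMap.domain : Scheme.{0}) ⟶ pullback (X ↘ SpecC) (C ↘ SpecC) :=
  pullback.lift p.toPartialMap.domain.ι p.toPartialMap.hom (by
    have := p.toPartialMap.isOver_iff (S := SpecC) |>.mp inferInstance
    exact this.symm)

/-- The closure of the graph of `p` in `X × C`, as a closed subset. -/
def graphClosureSet : Closeds (pullback (X ↘ SpecC) (C ↘ SpecC) : Scheme.{0}) :=
  Closeds.closure (Set.range (graph p))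

/-- The closure of the graph of `p` in `X × C`, with its reduced scheme structure. -/
def graphClosure : Scheme.{0} :=
  (Scheme.IdealSheafData.vanishingIdeal (graphClosureSet p)).subscheme

/-- The inclusion of the closure of the graph into `X × C`. -/
def graphClosureι : graphClosure p ⟶ pullback (X ↘ SpecC) (C ↘ SpecC) :=
  (Scheme.IdealSheafData.vanishingIdeal (graphClosureSet p)).subschemeι

instance : IsClosedImmersion (graphClosureι p) :=
  inferInstanceAs (IsClosedImmersion
    (Scheme.IdealSheafData.vanishingIdeal (graphClosureSet p)).subschemeι)

instance : IrreducibleSpace (graphClosure p) := by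
  have : Nonempty p.toPartialMap.domain := p.toPartialMap.dense_domain.nonempty.to_subtype
  have h : IsIrreducible (graphClosureSet p : Set (pullback (X ↘ SpecC) (C ↘ SpecC) : Scheme.{0})) := by
    rw [graphClosureSet, Closeds.coe_closure]
    refine IsIrreducible.closure ?_
    rw [← Set.image_univ]
    exact (IrreducibleSpace.isIrreducible_univ _).image _ (graph p).continuous.continuousOn
  exact Subtype.irreducibleSpace h

instance : IsReduced (graphClosure p) := by
  let I := Scheme.IdealSheafData.vanishingIdeal (graphClosureSet p)
  have (U : I.subschemeCover.openCover.I₀) : IsReduced (I.subschemeCover.openCover.X U) := by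
    have : _root_.IsReduced (_ ⧸ I.ideal U) :=
      (Ideal.isRadical_iff_quotient_reduced _).mp (PrimeSpectrum.isRadical_vanishingIdeal _)
    exact inferInstanceAs (IsReduced (Spec (CommRingCat.of (_ ⧸ I.ideal U))))
  exact IsReduced.of_openCover I.subscheme I.subschemeCover.openCover

instance : IsIntegral (graphClosure p) := isIntegral_of_irreducibleSpace_of_isReduced _

end Graph

/-- The morphism `Spec K(Z) ⟶ Z` from the generic point of an integral scheme. -/
abbrev fromGenericPoint (Z : Scheme.{0}) [IsIntegral Z] : Spec Z.functionField ⟶ Z :=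
  Z.fromSpecStalk (genericPoint Z)

/-- The normalization of an integral scheme `Z`: the relative normalization of `Z` in its function
field. -/
def normalization (Z : Scheme.{0}) [IsIntegral Z] [QuasiSeparatedSpace Z] : Scheme.{0} :=
  (fromGenericPoint Z).normalization

/-- The normalization morphism. -/
def fromNormalization (Z : Scheme.{0}) [IsIntegral Z] [QuasiSeparatedSpace Z] :
    normalization Z ⟶ Z :=
  (fromGenericPoint Z).fromNormalization

section Xdoubleprime

variable {X C : Scheme.{0}} [X.Over SpecC] [C.Over SpecC] [IsIntegral X] [IsAffine X]
  [C.IsSeparated] (p : X ⤏ C) [p.IsOver SpecC]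

instance : QuasiSeparatedSpace (graphClosure p) := by
  have : IsSeparated (C ↘ SpecC) := inferInstance
  exact quasiSeparatedSpace_of_quasiSeparated
    (graphClosureι p ≫ pullback.fst (X ↘ SpecC) (C ↘ SpecC))

/-- `X''`, the normalization of the closure `X'` of the graph of `p`. -/
def Xdd : Scheme.{0} := normalization (graphClosure p)

/-- The morphism `X'' ⟶ X' ⊆ X × C ⟶ X`. -/
def XddToX : Xdd p ⟶ X := fromNormalization _ ≫ graphClosureι p ≫ pullback.fst _ _

/-- The morphism `X'' ⟶ X' ⊆ X × C ⟶ C`. -/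
def XddToC : Xdd p ⟶ C := fromNormalization _ ≫ graphClosureι p ≫ pullback.snd _ _

end Xdoubleprime


end PolyDiv

end

/-! Everything takes place inside the group algebra `K[M]`, where `K` is the function field of `Y`.
An element `∑ a_u χ^u` lies in `Γ(V, 𝒜)` exactly when, for all `u` with `a_u ≠ 0`, one has `v(u) ≥
0` for `v ∈ σ` and `ord_P(a_u) + v(u) ≥ 0` for `P ∈ V`, `v ∈ Δ_P`. So `Γ(V, 𝒜)` is cut out of `K[M]`
by Gauss valuations (`mem_sections_iff_gaussMin`). As `K[M]` is normal, `X̃` is normal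
(`isIntegrallyClosed_sections`).

Bigness gives the quotient map. For `u` interior to `ω`, some multiple `w` of `u` carries a global
section `g χ^w` that vanishes at all points outside a small affine `U`. Inverting it turns `Γ(Y, 𝒜)`
into `Γ(U, 𝒪_Y)[M]` (`exists_section_localizing`). Hence `U × T` is a principal open subset of `X`,
which defines `p` and shows that `r` is birational. Uniqueness of `p` holds because its values are
prescribed on `Spec K[M]`, which dominates `X`.

Semiampleness makes `X̃ ⟶ X × C` integral (`isIntegralHom_toProduct`). On an affine `V ⊆ Y`, some
power of a homogeneous section is locally a regular function times a global section, so `Γ(V, 𝒜)` is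
integral over the ring generated by `Γ(Y, 𝒜)` and `Γ(V, 𝒪_Y)`. At a point `c` of `C` outside `Y`,
one takes `V'` with `V' ∩ Y = V' ∖ {c}` and needs the functions on `V' ∩ Y` to be integral over
those on `V'` and on `Y`. This follows once there is a function regular on `Y` with a pole at `c`
(`exists_pole`); it comes from the finiteness of the first cohomology of the structure sheaf,
computed with the two charts of a finite map to the projective line.

Finally `X̃ ⟶ X × C` agrees with the graph of `p` on a dense torus, so it factors through `X'`. The
resulting morphism is dominant, integral and birational with normal source, and therefore is the
normalization (`exists_iso_normalization`). Two comparison isomorphisms differ by an automorphism of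
`X̃` over `X'`, which is trivial at the generic point and hence everywhere (`eq_id_of_comp_eq`). -/

noncomputable section

namespace PolyDiv

/-! ## Gauss valuations on group algebras -/

section Gauss

variable {K M : Type*} [Field K] [AddCommGroup M] (ν : AddValuation K (WithTop ℚ)) (v : M →+ ℚ)

/-- The minimum of `ν (a_u) + v u` over the exponents `u` of `a = ∑ a_u χ^u`. -/
def gaussMin (a : AddMonoidAlgebra K M) : WithTop ℚ :=
  a.coeff.support.inf fun u ↦ ν (a.coeff u) + (v u : ℚ)

-- Zero coefficients have value `⊤`, so a bound over the support is a bound over all exponents.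
variable {ν v} in
theorem le_gaussMin_iff {a : AddMonoidAlgebra K M} {c : WithTop ℚ} :
    c ≤ gaussMin ν v a ↔ ∀ u, c ≤ ν (a.coeff u) + (v u : ℚ) := by
  rw [gaussMin, Finset.le_inf_iff]
  refine ⟨fun h u ↦ ?_, fun h u _ ↦ h u⟩
  by_cases hu : a.coeff u = 0
  · rw [hu, AddValuation.map_zero, WithTop.top_add]
    exact le_top
  · exact h u (Finsupp.mem_support_iff.mpr hu)

theorem gaussMin_le (a : AddMonoidAlgebra K M) (u : M) :
    gaussMin ν v a ≤ ν (a.coeff u) + (v u : ℚ) :=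
  le_gaussMin_iff.mp le_rfl u

theorem min_gaussMin_le_gaussMin_add (a b : AddMonoidAlgebra K M) :
    min (gaussMin ν v a) (gaussMin ν v b) ≤ gaussMin ν v (a + b) := by
  refine le_gaussMin_iff.mpr fun u ↦ ?_
  rw [AddMonoidAlgebra.coeff_add, Finsupp.add_apply]
  calc min (gaussMin ν v a) (gaussMin ν v b)
      ≤ min (ν (a.coeff u) + (v u : ℚ)) (ν (b.coeff u) + (v u : ℚ)) :=
        min_le_min (gaussMin_le ν v a u) (gaussMin_le ν v b u)
    _ = min (ν (a.coeff u)) (ν (b.coeff u)) + (v u : ℚ) := (min_add_add_right _ _ _)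
    _ ≤ _ := by gcongr; exact ν.map_add _ _

theorem gaussMin_one : gaussMin ν v (1 : AddMonoidAlgebra K M) = 0 := by
  classical
  refine le_antisymm ?_ (le_gaussMin_iff.mpr fun u ↦ ?_)
  · refine (gaussMin_le ν v 1 0).trans ?_
    simp [AddMonoidAlgebra.one_def]
  · rw [AddMonoidAlgebra.one_def, AddMonoidAlgebra.coeff_single, Finsupp.single_apply]
    split_ifs with h
    · subst h; simp
    · simp

theorem add_gaussMin_le_gaussMin_mul (a b : AddMonoidAlgebra K M) :
    gaussMin ν v a + gaussMin ν v b ≤ gaussMin ν v (a * b) := by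
  classical
  refine le_gaussMin_iff.mpr fun u ↦ ?_
  rw [AddMonoidAlgebra.coeff_mul, Finsupp.sum]
  simp only [Finsupp.sum]
  -- Moving `v u` to the left leaves a bound on the valuation of a sum, which can be checked term by
  -- term.
  suffices H : gaussMin ν v a + gaussMin ν v b + ((-v u : ℚ) : WithTop ℚ) ≤
      ν (∑ x ∈ a.coeff.support, ∑ y ∈ b.coeff.support,
        if x + y = u then a.coeff x * b.coeff y else 0) by
    calc gaussMin ν v a + gaussMin ν v b
        = gaussMin ν v a + gaussMin ν v b + ((-v u : ℚ) : WithTop ℚ) + (v u : ℚ) := by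
          rw [add_assoc, ← WithTop.coe_add, neg_add_cancel, WithTop.coe_zero, add_zero]
      _ ≤ _ := by gcongr
  refine AddValuation.map_le_sum _ fun x _ ↦ AddValuation.map_le_sum _ fun y _ ↦ ?_
  split_ifs with h
  · subst h
    rw [AddValuation.map_mul, map_add]
    calc gaussMin ν v a + gaussMin ν v b + ((-(v x + v y) : ℚ) : WithTop ℚ)
        ≤ (ν (a.coeff x) + (v x : ℚ)) + (ν (b.coeff y) + (v y : ℚ)) +
            ((-(v x + v y) : ℚ) : WithTop ℚ) := by
          gcongr
          · exact gaussMin_le ν v a x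
          · exact gaussMin_le ν v b y
      _ = ν (a.coeff x) + ν (b.coeff y) +
            (((v x : ℚ) : WithTop ℚ) + (v y : ℚ) + ((-(v x + v y) : ℚ) : WithTop ℚ)) := by abel
      _ = _ := by
          rw [← WithTop.coe_add, ← WithTop.coe_add, add_neg_cancel, WithTop.coe_zero, add_zero]
  · rw [AddValuation.map_zero]; exact le_top

theorem gaussMin_ne_top {a : AddMonoidAlgebra K M} (ha : a ≠ 0) : gaussMin ν v a ≠ ⊤ := by
  obtain ⟨u, hu⟩ : ∃ u, a.coeff u ≠ 0 := by
    by_contra! h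
    exact ha (AddMonoidAlgebra.ext (Finsupp.ext h))
  intro h
  have h1 := gaussMin_le ν v a u
  rw [h, top_le_iff, WithTop.add_eq_top] at h1
  exact h1.elim (fun h ↦ hu (ν.top_iff.mp h)) (WithTop.coe_ne_top)

theorem exists_gaussMin_eq {a : AddMonoidAlgebra K M} (ha : a ≠ 0) :
    ∃ u, ν (a.coeff u) + (v u : ℚ) = gaussMin ν v a := by
  have hne : a.coeff.support.Nonempty := by
    rw [Finsupp.support_nonempty_iff]
    exact fun h ↦ ha (AddMonoidAlgebra.ext h)
  obtain ⟨u, -, hu⟩ := Finset.exists_mem_eq_inf a.coeff.support hne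
    fun u ↦ ν (a.coeff u) + ((v u : ℚ) : WithTop ℚ)
  exact ⟨u, hu.symm⟩

/-- Gauss's lemma. -/
theorem gaussMin_mul [UniqueSums M] (a b : AddMonoidAlgebra K M) :
    gaussMin ν v (a * b) = gaussMin ν v a + gaussMin ν v b := by
  classical
  refine le_antisymm ?_ (add_gaussMin_le_gaussMin_mul ν v a b)
  by_cases ha : a = 0
  · subst ha; simp [gaussMin]
  by_cases hb : b = 0
  · subst hb; simp [gaussMin]
  -- The exponents at which the minimum is attained. Two of them with a unique sum give a
  -- coefficient of the product in which exactly one term has least value, so nothing cancels there.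
  let F (c : AddMonoidAlgebra K M) : Finset M :=
    {u ∈ c.coeff.support | ν (c.coeff u) + (v u : ℚ) = gaussMin ν v c}
  have hF {c : AddMonoidAlgebra K M} (hc : c ≠ 0) : (F c).Nonempty := by
    obtain ⟨u, hu⟩ := exists_gaussMin_eq ν v hc
    refine ⟨u, Finset.mem_filter.mpr ⟨Finsupp.mem_support_iff.mpr fun h ↦ ?_, hu⟩⟩
    rw [h, AddValuation.map_zero, WithTop.top_add] at hu
    exact gaussMin_ne_top ν v hc hu.symm
  obtain ⟨x₀, hx₀, y₀, hy₀, huniq⟩ := UniqueSums.uniqueAdd_of_nonempty (hF ha) (hF hb)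
  have hx := (Finset.mem_filter.mp hx₀)
  have hy := (Finset.mem_filter.mp hy₀)
  obtain ⟨p, hp⟩ := WithTop.ne_top_iff_exists.mp (gaussMin_ne_top ν v ha)
  obtain ⟨q, hq⟩ := WithTop.ne_top_iff_exists.mp (gaussMin_ne_top ν v hb)
  have key : ν ((a * b).coeff (x₀ + y₀)) = ν (a.coeff x₀ * b.coeff y₀) := by
    have hsplit : (a * b).coeff (x₀ + y₀) = a.coeff x₀ * b.coeff y₀ +
        ∑ z ∈ (a.coeff.support ×ˢ b.coeff.support).erase (x₀, y₀),
          if z.1 + z.2 = x₀ + y₀ then a.coeff z.1 * b.coeff z.2 else 0 := by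
      rw [AddMonoidAlgebra.coeff_mul, Finsupp.sum]
      simp only [Finsupp.sum]
      rw [← Finset.sum_product', ← Finset.add_sum_erase _ _
        (Finset.mk_mem_product hx.1 hy.1)]
      simp
    rw [hsplit]
    have hval : ν (a.coeff x₀ * b.coeff y₀) + ((v x₀ + v y₀ : ℚ) : WithTop ℚ) =
        ((p + q : ℚ) : WithTop ℚ) := by
      rw [AddValuation.map_mul, WithTop.coe_add, add_add_add_comm, hx.2, hy.2, ← hp, ← hq,
        WithTop.coe_add]
    refine AddValuation.map_add_eq_of_lt_left _ ?_
    have hfin : ν (a.coeff x₀ * b.coeff y₀) ≠ ⊤ := by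
      rw [ν.ne_top_iff]
      exact mul_ne_zero (Finsupp.mem_support_iff.mp hx.1) (Finsupp.mem_support_iff.mp hy.1)
    refine AddValuation.map_lt_sum _ hfin fun z hz ↦ ?_
    obtain ⟨hz1, hz2⟩ := Finset.mem_erase.mp hz
    obtain ⟨hz2, hz3⟩ := Finset.mem_product.mp hz2
    split_ifs with h
    swap
    · rw [AddValuation.map_zero]; exact lt_top_iff_ne_top.mpr hfin
    have h1 := gaussMin_le ν v a z.1
    have h2 := gaussMin_le ν v b z.2
    have h3 : ¬ (gaussMin ν v a = ν (a.coeff z.1) + (v z.1 : ℚ) ∧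
        gaussMin ν v b = ν (b.coeff z.2) + (v z.2 : ℚ)) := by
      rintro ⟨h4, h5⟩
      obtain ⟨h6, h7⟩ := huniq (Finset.mem_filter.mpr ⟨hz2, h4.symm⟩)
        (Finset.mem_filter.mpr ⟨hz3, h5.symm⟩) h
      exact hz1 (Prod.ext h6 h7)
    rw [AddValuation.map_mul] at hval hfin ⊢
    rw [AddValuation.map_mul]
    obtain ⟨r, hr⟩ := WithTop.ne_top_iff_exists.mp hfin
    obtain ⟨s, hs⟩ := WithTop.ne_top_iff_exists.mp (ν.ne_top_iff.mpr (Finsupp.mem_support_iff.mp hz2))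
    obtain ⟨t, ht⟩ := WithTop.ne_top_iff_exists.mp (ν.ne_top_iff.mpr (Finsupp.mem_support_iff.mp hz3))
    rw [← hr] at hval ⊢
    rw [← hs, ← hp] at h1 h3
    rw [← ht, ← hq] at h2 h3
    rw [← hs, ← ht]
    -- The linear parts of the two terms agree. If the other term were not larger, both of its
    -- exponents would attain their minima, against uniqueness of the sum.
    have h8 : v z.1 + v z.2 = v x₀ + v y₀ := by rw [← map_add, h, map_add]
    norm_cast at h1 h2 h3 hval ⊢
    by_contra! hlt
    apply h3
    constructor <;> linarith
  calc gaussMin ν v (a * b) ≤ _ := gaussMin_le ν v (a * b) (x₀ + y₀)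
    _ = _ := by
      rw [key, AddValuation.map_mul, map_add, WithTop.coe_add, add_add_add_comm, hx.2, hy.2]

/-- The Gauss valuation on `K[M]` attached to a valuation of `K` and an additive map `M → ℚ`. -/
def gaussValuation [UniqueSums M] : AddValuation (AddMonoidAlgebra K M) (WithTop ℚ) :=
  AddValuation.of (gaussMin ν v) (by simp [gaussMin]) (gaussMin_one ν v)
    (min_gaussMin_le_gaussMin_add ν v) (gaussMin_mul ν v)

/-- The elements of nonnegative Gauss valuation form an integrally closed subring of `K[M]`. -/
theorem gaussMin_nonneg_of_isIntegral [UniqueSums M] {R : Subring (AddMonoidAlgebra K M)}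
    (hR : ∀ a ∈ R, 0 ≤ gaussMin ν v a) {a : AddMonoidAlgebra K M} (ha : IsIntegral R a) :
    0 ≤ gaussMin ν v a := by
  let V := AddValuation.toValuation (gaussValuation ν v)
  have hle : R ≤ V.integer := hR
  have h1 : IsIntegral V.integer a := by
    obtain ⟨p, hp, hp'⟩ := ha
    refine ⟨p.map (Subring.inclusion hle), hp.map _, ?_⟩
    rw [Polynomial.eval₂_map]
    exact hp'
  exact (Valuation.integer.integers V).mem_of_integral h1

end Gauss

end PolyDiv

namespace PolyDiv

/-! ## Interior points of the weight cone -/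

section Cones

variable {M : Type} [AddCommGroup M]

/-- A finite set of linear forms without nontrivial nonnegative relation is positive somewhere. -/
theorem exists_forall_pos (s : Finset (NQ M))
    (hs : ∀ c : NQ M → ℚ, (∀ v ∈ s, 0 ≤ c v) → ∑ v ∈ s, c v • v = 0 → ∀ v ∈ s, c v = 0) :
    ∃ u : M, ∀ v ∈ s, 0 < v u := by
  classical
  -- Fourier–Motzkin elimination: induction on the number of forms, with one new form `v` at each
  -- step.
  suffices H : ∀ (n : ℕ) (f : Fin n → NQ M),
      (∀ c : Fin n → ℚ, (∀ i, 0 ≤ c i) → ∑ i, c i • f i = 0 → ∀ i, c i = 0) →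
      ∃ u : M, ∀ i, 0 < f i u by
    obtain ⟨u, hu⟩ := H s.card (fun i ↦ (s.equivFin.symm i : NQ M)) (fun c hc h i ↦ by
      have h1 := hs (fun v ↦ if hv : v ∈ s then c (s.equivFin ⟨v, hv⟩) else 0)
        (fun v hv ↦ by simp [hv, hc]) (by
          rw [← h, ← Finset.sum_coe_sort, ← s.equivFin.sum_comp]
          refine Finset.sum_congr rfl fun x _ ↦ ?_
          simp) _ (s.equivFin.symm i).2
      simpa using h1)
    refine ⟨u, fun v hv ↦ ?_⟩
    simpa using hu (s.equivFin ⟨v, hv⟩)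
  intro n
  induction n with
  | zero => exact fun f _ ↦ ⟨0, fun i ↦ i.elim0⟩
  | succ n ih =>
    intro f hf
    obtain ⟨u, hu⟩ := ih (fun i ↦ f i.castSucc) (fun c hc h i ↦ by
      have := hf (Fin.snoc c 0) (fun j ↦ by
        refine Fin.lastCases ?_ (fun j ↦ ?_) j <;> simp [hc])
        (by rw [Fin.sum_univ_castSucc]; simpa using h) i.castSucc
      simpa using this)
    set v := f (Fin.last n) with hv
    by_cases hvu : 0 < v u
    · exact ⟨u, Fin.lastCases hvu hu⟩
    push Not at hvu
    -- a combination `u' + t u` is positive for a suitable rational number `t`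
    obtain ⟨u', t, ht1, ht2⟩ : ∃ (u' : M) (t : ℚ),
        (∀ i, 0 < f (Fin.castSucc i) u' + t * f (Fin.castSucc i) u) ∧ 0 < v u' + t * v u := by
      have hlow (i : Fin n) (u' : M) (t : ℚ) : -(f i.castSucc u') / f i.castSucc u < t →
          0 < f i.castSucc u' + t * f i.castSucc u := by
        intro h
        rw [div_lt_iff₀ (hu i)] at h
        linarith
      rcases hvu.lt_or_eq with hlt | heq
      -- These combinations of `f i` and `v` vanish at `u`. A nonnegative relation among them is one
      -- among all the forms, in which `v` has coefficient `∑ c i * f i u`; this must vanish, so all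
      -- `c i` do. Their positivity at `u'` says that every lower bound for `t` lies below the upper
      -- bound imposed by `v`.
      · obtain ⟨u', hu'⟩ := ih (fun i ↦ (-v u) • f i.castSucc + (f i.castSucc u) • v)
          (fun c hc h i ↦ by
            have h1 := hf (Fin.snoc (fun i ↦ c i * (-v u)) (∑ i, c i * f i.castSucc u)) (fun j ↦ by
              refine Fin.lastCases ?_ (fun j ↦ ?_) j
              · simpa using Finset.sum_nonneg fun i _ ↦ mul_nonneg (hc i) (hu i).le
              · simpa using mul_nonneg (hc j) (neg_nonneg.mpr hvu))
              (by
                rw [Fin.sum_univ_castSucc]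
                simp only [Fin.snoc_castSucc, Fin.snoc_last]
                rw [← hv, Finset.sum_smul, ← Finset.sum_add_distrib, ← h]
                refine Finset.sum_congr rfl fun i _ ↦ ?_
                rw [smul_add, smul_smul, smul_smul]) (Fin.last n)
            simp only [Fin.snoc_last] at h1
            rw [Finset.sum_eq_zero_iff_of_nonneg
              (fun i _ ↦ mul_nonneg (hc i) (hu i).le)] at h1
            exact (mul_eq_zero.mp (h1 i (Finset.mem_univ i))).resolve_right (hu i).ne')
        simp only [LinearMap.add_apply, LinearMap.smul_apply, smul_eq_mul] at hu'
        obtain ⟨t, h1, h2⟩ : ∃ t, (∀ i : Fin n, -(f i.castSucc u') / f i.castSucc u < t) ∧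
            t < v u' / (-v u) := by
          have h3 (i : Fin n) : -(f i.castSucc u') / f i.castSucc u < v u' / (-v u) := by
            rw [div_lt_div_iff₀ (hu i) (by linarith)]
            linarith [hu' i]
          rcases isEmpty_or_nonempty (Fin n) with hE | hE
          · obtain ⟨t, ht⟩ := exists_lt (v u' / (-v u))
            exact ⟨t, fun i ↦ hE.elim i, ht⟩
          · obtain ⟨i, hi⟩ := Finite.exists_max fun i : Fin n ↦ -(f i.castSucc u') / f i.castSucc u
            obtain ⟨t, ht, ht'⟩ := exists_between (h3 i)
            exact ⟨t, fun k ↦ (hi k).trans_lt ht, ht'⟩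
        refine ⟨u', t, fun i ↦ hlow i u' t (h1 i), ?_⟩
        rw [lt_div_iff₀ (by linarith)] at h2
        linarith
      -- Here `v` vanishes at `u`, so any `u'` with `v u' > 0` works with `t` large.
      · have hv0 : v ≠ 0 := by
          intro h0
          have h1 := hf (Pi.single (Fin.last n) 1) (fun i ↦ by
            by_cases h : i = Fin.last n
            · subst h; simp
            · simp [h]) (by
              rw [Finset.sum_eq_single (Fin.last n)] <;> simp +contextual [← hv, h0]) (Fin.last n)
          simp at h1
        obtain ⟨u', hu'⟩ : ∃ u', 0 < v u' := by
          by_contra! h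
          refine hv0 (LinearMap.ext fun w ↦ le_antisymm (h w) ?_)
          have := h (-w)
          rw [map_neg] at this
          simpa using this
        obtain ⟨t, ht⟩ : ∃ t, ∀ i : Fin n, -(f i.castSucc u') / f i.castSucc u < t := by
          rcases isEmpty_or_nonempty (Fin n) with hE | hE
          · exact ⟨0, fun i ↦ hE.elim i⟩
          · obtain ⟨i, hi⟩ := Finite.exists_max fun i : Fin n ↦ -(f i.castSucc u') / f i.castSucc u
            obtain ⟨t, ht⟩ := exists_gt (-(f i.castSucc u') / f i.castSucc u)
            exact ⟨t, fun k ↦ (hi k).trans_lt ht⟩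
        refine ⟨u', t, fun i ↦ hlow i u' t (ht i), ?_⟩
        rw [heq, mul_zero, add_zero]
        exact hu'
    -- Clearing the denominator of `t` gives a point of the lattice.
    obtain ⟨p, q, hq, rfl⟩ : ∃ (p : ℤ) (q : ℤ), 0 < q ∧ t = p / q :=
      ⟨t.num, t.den, by exact_mod_cast t.pos, by simpa using (Rat.num_div_den t).symm⟩
    have hq' : (0 : ℚ) < q := by exact_mod_cast hq
    have hfin (g : NQ M) (h : 0 < g u' + (p / q : ℚ) * g u) : 0 < g (q • u' + p • u) := by
      rw [map_add, map_zsmul, map_zsmul, zsmul_eq_mul, zsmul_eq_mul]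
      have := mul_pos hq' h
      have h2 : (q : ℚ) * (g u' + p / q * g u) = q * g u' + p * g u := by field_simp
      linarith
    exact ⟨q • u' + p • u, Fin.lastCases (hfin _ ht2) fun i ↦ hfin _ (ht1 i)⟩

/-- If `σ` is generated by a finite set, then `ω` is defined by the corresponding inequalities. -/
theorem mem_weightMonoid_span {s : Set (NQ M)} {u : M} (h : ∀ v ∈ s, 0 ≤ v u) :
    u ∈ weightMonoid (Submodule.span {c : ℚ // 0 ≤ c} s : PointedCone ℚ (NQ M)) := by
  intro v hv
  induction hv using Submodule.span_induction with
  | mem v hv => exact h v hv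
  | zero => simp
  | add v w _ _ hv hw => rw [LinearMap.add_apply]; exact add_nonneg hv hw
  | smul c v _ hv =>
    change 0 ≤ c.1 * v u
    exact mul_nonneg c.2 hv

/-- The weight cone of a pointed polyhedral cone is full-dimensional. -/
theorem exists_interior {σ : PointedCone ℚ (NQ M)} (hσ : σ.FG)
    (hσ' : (σ : ConvexCone ℚ (NQ M)).Salient) :
    ∃ u ∈ interiorWeights σ, ∀ w : M, ∃ n : ℕ, ∀ k ≥ n, k • u + w ∈ weightMonoid σ := by
  classical
  obtain ⟨s, hs⟩ := hσ
  have hmem (v : NQ M) (hv : v ∈ s) : v ∈ σ := hs ▸ Submodule.subset_span hv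
  -- The generator `0` is dropped, as it is positive nowhere. A nonnegative relation with `c v > 0`
  -- would express `-v` as an element of `σ`, against salience.
  obtain ⟨u, hu⟩ := exists_forall_pos (s.erase 0) (fun c hc h v hv ↦ by
    by_contra hcv
    have hpos : 0 < c v := lt_of_le_of_ne (hc v hv) (Ne.symm hcv)
    refine hσ' v (hmem v (Finset.mem_of_mem_erase hv)) (Finset.ne_of_mem_erase hv) ?_
    rw [← Finset.add_sum_erase _ _ hv] at h
    have h1 : -v = (c v)⁻¹ • ∑ w ∈ (s.erase 0).erase v, c w • w := by
      rw [← neg_eq_iff_add_eq_zero] at h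
      rw [← h, smul_neg, smul_smul, inv_mul_cancel₀ hcv, one_smul]
    have h2 : ∑ w ∈ (s.erase 0).erase v, c w • w ∈ σ := by
      refine Submodule.sum_mem _ fun w hw ↦ ?_
      have hw' := Finset.mem_of_mem_erase hw
      exact Submodule.smul_mem σ (⟨c w, hc w hw'⟩ : {c : ℚ // 0 ≤ c}) (hmem w (Finset.mem_of_mem_erase hw'))
    rw [h1]
    exact Submodule.smul_mem σ (⟨(c v)⁻¹, inv_nonneg.mpr hpos.le⟩ : {c : ℚ // 0 ≤ c}) h2)
  have hu0 (v) (hv : v ∈ s) : 0 ≤ v u := by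
    by_cases h : v = 0
    · simp [h]
    · exact (hu v (Finset.mem_erase.mpr ⟨h, hv⟩)).le
  have key (w : M) : ∃ n : ℕ, ∀ k ≥ n, k • u + w ∈ weightMonoid σ := by
    have h1 (v : NQ M) : ∃ n : ℕ, v ∈ s → ∀ k ≥ n, 0 ≤ v (k • u + w) := by
      by_cases hv : v ∈ s.erase 0
      · obtain ⟨n, hn⟩ := exists_nat_ge (-(v w) / v u)
        refine ⟨n, fun _ k hk ↦ ?_⟩
        have h2 := hu v hv
        rw [div_le_iff₀ h2] at hn
        have h3 : (n : ℚ) * v u ≤ k * v u := by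
          gcongr
        rw [map_add, map_nsmul, nsmul_eq_mul]
        linarith
      · refine ⟨0, fun hv' k _ ↦ ?_⟩
        rw [Finset.mem_erase] at hv
        have : v = 0 := by tauto
        simp [this]
    choose n hn using h1
    refine ⟨s.sup n, fun k hk ↦ ?_⟩
    rw [← hs]
    exact mem_weightMonoid_span fun v hv ↦ hn v hv k ((Finset.le_sup hv).trans hk)
  have huω : u ∈ weightMonoid σ := hs ▸ mem_weightMonoid_span fun v hv ↦ hu0 v hv
  refine ⟨u, ⟨huω, fun w _ ↦ ?_⟩, key⟩
  obtain ⟨n, hn⟩ := key (-w)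
  exact ⟨n, by simpa [sub_eq_add_neg] using hn n le_rfl⟩

end Cones

/-! ## Group algebras of lattices are normal -/

section Laurent

variable (K : Type*) [Field K] (ι : Type*)

/-- The Laurent polynomial ring is the localization of a polynomial ring, which is normal, at its
monomials. -/
theorem isIntegrallyClosed_addMonoidAlgebra_finsupp :
    IsIntegrallyClosed (AddMonoidAlgebra K (ι →₀ ℤ)) := by
  classical
  let c : (ι →₀ ℕ) →+ (ι →₀ ℤ) := Finsupp.mapRange.addMonoidHom (Nat.castAddMonoidHom ℤ)
  have hc : Function.Injective c := Finsupp.mapRange_injective _ (map_zero _) Nat.cast_injective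
  let g : MvPolynomial ι K →+* AddMonoidAlgebra K (ι →₀ ℤ) :=
    AddMonoidAlgebra.mapDomainRingHom K c
  let : Algebra (MvPolynomial ι K) (AddMonoidAlgebra K (ι →₀ ℤ)) := g.toAlgebra
  have hg : Function.Injective g := AddMonoidAlgebra.mapDomain_injective hc
  have hgm (m : ι →₀ ℕ) (r : K) : g (MvPolynomial.monomial m r) =
      AddMonoidAlgebra.single (c m) r := AddMonoidAlgebra.mapDomain_single
  let h : Multiplicative (ι →₀ ℕ) →* MvPolynomial ι K := MvPolynomial.monomialOneHom K ι
  have hh (m : Multiplicative (ι →₀ ℕ)) : h m = MvPolynomial.monomial m.toAdd 1 := rfl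
  let S : Submonoid (MvPolynomial ι K) := MonoidHom.mrange h
  have hS : S ≤ nonZeroDivisors (MvPolynomial ι K) := by
    rintro _ ⟨m, rfl⟩
    refine mem_nonZeroDivisors_of_ne_zero ?_
    rw [hh]
    simp
  have : IsLocalization S (AddMonoidAlgebra K (ι →₀ ℤ)) := by
    refine ⟨⟨?_, ?_, ?_⟩⟩
    · rintro ⟨_, m, rfl⟩
      change IsUnit (g (h m))
      rw [hh, hgm]
      refine IsUnit.of_mul_eq_one (AddMonoidAlgebra.single (-c m.toAdd) 1) ?_
      rw [AddMonoidAlgebra.single_mul_single, add_neg_cancel, one_mul, AddMonoidAlgebra.one_def]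
    · intro a
      induction a using AddMonoidAlgebra.induction_linear with
      | zero => exact ⟨(0, 1), by simp⟩
      | add a b ha hb =>
        obtain ⟨⟨x, s⟩, hx⟩ := ha
        obtain ⟨⟨y, t⟩, hy⟩ := hb
        refine ⟨(x * t + y * s, s * t), ?_⟩
        simp only [map_add, map_mul, Submonoid.coe_mul] at hx hy ⊢
        rw [← hx, ← hy]
        ring
      | single m r =>
        -- The positive and negative parts of the exponent: `m = m₁ - m₂`.
        let m₁ : ι →₀ ℕ := m.mapRange Int.toNat rfl
        let m₂ : ι →₀ ℕ := m.mapRange (fun z ↦ (-z).toNat) rfl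
        refine ⟨(MvPolynomial.monomial m₁ r, ⟨h (Multiplicative.ofAdd m₂), MonoidHom.mem_mrange.mpr ⟨_, rfl⟩⟩), ?_⟩
        change _ * g (h (Multiplicative.ofAdd m₂)) = g (MvPolynomial.monomial m₁ r)
        rw [hh, hgm, hgm, AddMonoidAlgebra.single_mul_single,
          mul_one]
        congr 1
        ext i
        simp [c, m₁, m₂]
        omega
    · intro x y h
      exact ⟨1, by rw [hg h]⟩
  exact isIntegrallyClosed_of_isLocalization (R := MvPolynomial ι K) _ S hS

theorem isIntegrallyClosed_addMonoidAlgebra (M : Type*) [AddCommGroup M] [Module.Free ℤ M] :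
    IsIntegrallyClosed (AddMonoidAlgebra K M) := by
  let b := Module.Free.chooseBasis ℤ M
  have := isIntegrallyClosed_addMonoidAlgebra_finsupp K (Module.Free.ChooseBasisIndex ℤ M)
  exact IsIntegrallyClosed.of_equiv
    (AddMonoidAlgebra.domCongr K K b.repr.symm.toAddEquiv).toRingEquiv

end Laurent

end PolyDiv

namespace PolyDiv

/-! ## Functions with a single pole -/

section Pole

open Polynomial

variable {k K : Type*} [Field k] [Field K] [Algebra k K]

/-- Noether normalization in dimension at most one. -/
theorem exists_isIntegral_aeval {B : Type*} [CommRing B] [IsDomain B] [Algebra k B]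
    [Algebra.FiniteType k B] (hB : ∀ p : Ideal B, p.IsPrime → p ≠ ⊥ → p.IsMaximal)
    (hB' : ¬ IsField B) :
    ∃ x : B, Function.Injective (aeval (R := k) x) ∧ (aeval (R := k) x).toRingHom.IsIntegral := by
  obtain ⟨s, g, hg, hgi⟩ := exists_integral_inj_algHom_of_fg k B
  algebraize [g.toRingHom]
  have hint : Algebra.IsIntegral (MvPolynomial (Fin s) k) B := ⟨hgi⟩
  rcases s with _ | _ | s
  · refine absurd ?_ hB'
    refine isField_of_isIntegral_of_isField' (R := MvPolynomial (Fin 0) k) ?_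
    exact MulEquiv.isField (Field.toIsField k) (MvPolynomial.isEmptyAlgEquiv k (Fin 0)).toMulEquiv
  · let e : MvPolynomial (Fin 1) k →ₐ[k] k[X] := MvPolynomial.aeval fun _ ↦ X
    let e' : k[X] →ₐ[k] MvPolynomial (Fin 1) k := aeval (MvPolynomial.X 0)
    have h1 : (aeval (R := k) (g (MvPolynomial.X 0))).comp e = g := by
      ext i
      fin_cases i
      simp [e]
    have h2 : g.comp e' = aeval (R := k) (g (MvPolynomial.X 0)) := by ext; simp [e']
    have h3 : e.comp e' = AlgHom.id k _ := by ext; simp [e, e']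
    refine ⟨g (MvPolynomial.X 0), ?_, ?_⟩
    · rw [← h2]
      refine hg.comp (Function.LeftInverse.injective (g := e) fun x ↦ ?_)
      exact DFunLike.congr_fun h3 x
    · refine RingHom.IsIntegral.tower_top e.toRingHom _ ?_
      have : ((aeval (R := k) (g (MvPolynomial.X 0))).toRingHom).comp e.toRingHom = g.toRingHom :=
        RingHom.ext fun x ↦ DFunLike.congr_fun h1 x
      rw [this]
      exact hgi
  -- With two or more variables, the kernel of a map onto `k[X]` that kills `X 0` is a nonzero
  -- nonmaximal prime. A prime of `B` over it is nonzero, so maximal, and then its contraction would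
  -- be maximal too.
  · exfalso
    let e : MvPolynomial (Fin (s + 1 + 1)) k →ₐ[k] k[X] :=
      MvPolynomial.aeval fun i ↦ if i = 1 then X else 0
    have hker : RingHom.ker (algebraMap (MvPolynomial (Fin (s + 1 + 1)) k) B) = ⊥ :=
      (RingHom.injective_iff_ker_eq_bot _).mp hg
    have hp : (RingHom.ker e).IsPrime := RingHom.ker_isPrime _
    obtain ⟨Q, -, hQ, hQe⟩ := Ideal.exists_ideal_over_prime_of_isIntegral
      (R := MvPolynomial (Fin (s + 1 + 1)) k) (S := B) (RingHom.ker e) ⊥ (by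
        rw [← RingHom.ker_eq_comap_bot, hker]
        exact bot_le)
    have hX0 : (MvPolynomial.X 0 : MvPolynomial (Fin (s + 1 + 1)) k) ∈ RingHom.ker e := by
      simp [RingHom.mem_ker, e]
    have hmax := hB Q hQ (by
      rintro rfl
      rw [← RingHom.ker_eq_comap_bot, hker] at hQe
      rw [← hQe] at hX0
      exact MvPolynomial.X_ne_zero _ hX0)
    have hmax' : (RingHom.ker e).IsMaximal := by
      rw [← hQe]
      exact Ideal.isMaximal_comap_of_isIntegral_of_isMaximal Q
    obtain ⟨y, i, hi, hy⟩ := hmax'.exists_inv (x := MvPolynomial.X 1)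
      (by simp [RingHom.mem_ker, e])
    have h4 := congrArg e hy
    rw [map_add, map_mul, (RingHom.mem_ker).mp hi, add_zero, map_one] at h4
    have h5 : e (MvPolynomial.X 1) = X := by simp [e]
    rw [h5] at h4
    exact not_isUnit_X (IsUnit.of_mul_eq_one_right _ h4)

/-- An element integral over `k[w]` becomes integral over `k[w⁻¹]` after multiplication by a high
power of `w⁻¹`. -/
theorem exists_isIntegral_inv_pow_mul {w x : K} (hw : w ≠ 0)
    (hx : IsIntegral (Algebra.adjoin k {w}) x) :
    ∃ N : ℕ, ∀ n ≥ N, IsIntegral (Algebra.adjoin k {w⁻¹}) (w⁻¹ ^ n * x) := by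
  have hz : w⁻¹ ∈ Algebra.adjoin k {w⁻¹} := Algebra.self_mem_adjoin_singleton k _
  have hcoef (c : K) (hc : c ∈ Algebra.adjoin k {w}) :
      ∃ N : ℕ, ∀ n ≥ N, w⁻¹ ^ n * c ∈ Algebra.adjoin k {w⁻¹} := by
    induction hc using Algebra.adjoin_induction with
    | mem y hy =>
      obtain rfl : y = w := hy
      refine ⟨1, fun n hn ↦ ?_⟩
      obtain ⟨m, rfl⟩ := Nat.exists_eq_add_of_le hn
      rw [add_comm, pow_succ, mul_assoc, inv_mul_cancel₀ hw, mul_one]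
      exact pow_mem hz m
    | algebraMap r => exact ⟨0, fun n _ ↦ mul_mem (pow_mem hz n) (algebraMap_mem _ r)⟩
    | add a b _ _ ha hb =>
      obtain ⟨N, hN⟩ := ha
      obtain ⟨N', hN'⟩ := hb
      refine ⟨max N N', fun n hn ↦ ?_⟩
      rw [mul_add]
      exact add_mem (hN n (le_of_max_le_left hn)) (hN' n (le_of_max_le_right hn))
    | mul a b _ _ ha hb =>
      obtain ⟨N, hN⟩ := ha
      obtain ⟨N', hN'⟩ := hb
      refine ⟨N + N', fun n hn ↦ ?_⟩
      obtain ⟨m, rfl⟩ := Nat.exists_eq_add_of_le hn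
      have : w⁻¹ ^ (N + N' + m) * (a * b) = (w⁻¹ ^ N * a) * (w⁻¹ ^ (N' + m) * b) := by ring
      rw [this]
      exact mul_mem (hN N le_rfl) (hN' _ (by lia))
  obtain ⟨p, hp, hpx⟩ := hx
  choose N hN using fun j : ℕ ↦ hcoef (p.coeff j) (p.coeff j).2
  refine ⟨(Finset.range p.natDegree).sup N, fun n hn ↦ ?_⟩
  set P : K[X] := p.map (algebraMap _ K) with hP
  have hPm : P.Monic := hp.map _
  have hPdeg : P.natDegree = p.natDegree := hp.natDegree_map _
  let T : Subring K := (Algebra.adjoin k {w⁻¹}).toSubring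
  -- In degree `j` below the degree `d` of `P` the coefficient is multiplied by `w⁻¹ ^ (n * (d -
  -- j))`. As `d - j ≥ 1`, one factor `w⁻¹ ^ n` already turns it into an element of `k[w⁻¹]`.
  have hlift : scaleRoots P (w⁻¹ ^ n) ∈ lifts (algebraMap T K) := by
    rw [lifts_iff_coeff_lifts]
    intro j
    rw [coeff_scaleRoots]
    rcases lt_trichotomy j P.natDegree with hj | hj | hj
    · refine ⟨⟨_, ?_⟩, rfl⟩
      change P.coeff j * (w⁻¹ ^ n) ^ (P.natDegree - j) ∈ Algebra.adjoin k {w⁻¹}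
      obtain ⟨m, hm⟩ : ∃ m, P.natDegree - j = m + 1 := ⟨P.natDegree - j - 1, by lia⟩
      have : P.coeff j * (w⁻¹ ^ n) ^ (P.natDegree - j) = (w⁻¹ ^ n) ^ m * (w⁻¹ ^ n * P.coeff j) := by
        rw [hm]; ring
      rw [this]
      refine mul_mem (pow_mem (pow_mem hz n) m) ?_
      rw [hP, coeff_map]
      exact hN j n ((Finset.le_sup (Finset.mem_range.mpr (hPdeg ▸ hj))).trans hn)
    · refine ⟨1, ?_⟩
      subst hj
      rw [hPm.coeff_natDegree]
      simp
    · refine ⟨0, ?_⟩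
      rw [coeff_eq_zero_of_natDegree_lt hj]
      simp
  obtain ⟨q, hq, -, hqm⟩ := lifts_and_natDegree_eq_and_monic hlift
    ((monic_scaleRoots_iff _).mpr hPm)
  refine ⟨q, hqm, ?_⟩
  have h1 : (scaleRoots P (w⁻¹ ^ n)).eval₂ (RingHom.id K) (RingHom.id K (w⁻¹ ^ n) * x) = 0 :=
    scaleRoots_eval₂_eq_zero _ (by rw [hP, eval₂_map]; exact hpx)
  rw [← hq, eval₂_map] at h1
  exact h1

/-- Let `B ⊆ K` be the coordinate ring of an affine curve and `t ∈ B` a nonzero nonunit. There is a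
function `b` whose poles are among the zeros of `t` on that curve, with a pole at each of them. -/
theorem exists_pole (B : Subalgebra k K) [Algebra.FiniteType k B]
    (hB : ∀ p : Ideal B, p.IsPrime → p ≠ ⊥ → p.IsMaximal) {t : K} (htB : t ∈ B) (ht0 : t ≠ 0)
    (ht : t⁻¹ ∉ B) :
    ∃ b : K, (∀ R : Subring K, (B : Set K) ⊆ R → b ∈ R → IsIntegral R t⁻¹) ∧
      ∀ O : ValuationSubring K, (∀ c : k, algebraMap k K c ∈ O) →
        b ∈ O ∨ ((B : Set K) ⊆ O ∧ t⁻¹ ∉ O) := by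
  classical
  have hBf : ¬ IsField B := by
    intro h
    obtain ⟨y, hy⟩ := h.mul_inv_cancel (a := ⟨t, htB⟩) (by simpa [Subtype.ext_iff] using ht0)
    apply ht
    rw [inv_eq_of_mul_eq_one_right (congrArg Subtype.val hy)]
    exact y.2
  obtain ⟨x, hxinj, hxint⟩ := exists_isIntegral_aeval (k := k) hB hBf
  -- a nonzero element `w = q(x)` of `t B`
  obtain ⟨q, hq, hq0⟩ : ∃ q : k[X], aeval x q ∈ Ideal.span {(⟨t, htB⟩ : B)} ∧ q ≠ 0 := by
    algebraize [(aeval (R := k) x).toRingHom]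
    have h1 := Ideal.comap_ne_bot_of_integral_mem (R := k[X]) (S := B) (x := ⟨t, htB⟩)
      (I := Ideal.span {(⟨t, htB⟩ : B)}) (by simpa [Subtype.ext_iff] using ht0)
      (Ideal.mem_span_singleton_self _) (hxint _)
    obtain ⟨q, hq, hq0⟩ := Submodule.exists_mem_ne_zero_of_ne_bot h1
    exact ⟨q, hq, hq0⟩
  obtain ⟨a, ha⟩ := Ideal.mem_span_singleton'.mp hq
  -- If `q` were a nonzero constant, `t` would be a unit of `B`.
  have hqdeg : q.natDegree ≠ 0 := by
    intro h
    obtain ⟨c, rfl⟩ := natDegree_eq_zero.mp h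
    have hc : c ≠ 0 := by rintro rfl; simp at hq0
    rw [aeval_C] at ha
    apply ht
    have h2 : a.1 * t = algebraMap k K c := congrArg Subtype.val ha
    have h3 : t⁻¹ = algebraMap k K c⁻¹ * a.1 := by
      rw [map_inv₀, ← h2]
      have : a.1 ≠ 0 := by
        intro h4
        rw [h4, zero_mul] at h2
        exact hc ((map_eq_zero _).mp h2.symm)
      field_simp
    rw [h3]
    exact mul_mem (algebraMap_mem _ _) a.2
  set w : K := ((aeval x q : B) : K) with hw
  have hwB : w ∈ B := (aeval x q : B).2
  have hat : a.1 * t = w := congrArg Subtype.val ha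
  have hw0 : w ≠ 0 := by
    rw [hw, Ne, ZeroMemClass.coe_eq_zero, map_eq_zero_iff _ hxinj]
    exact hq0
  have hwx : aeval x.1 q = w := (aeval_algebraMap_apply K x q)
  have hxw : IsIntegral (Algebra.adjoin k {w}) x.1 := by
    refine IsIntegral.of_aeval_monic (p := (q * C q.leadingCoeff⁻¹).map (algebraMap k _))
      ((monic_mul_leadingCoeff_inv hq0).map _) ?_ ?_
    · rw [natDegree_map, natDegree_mul_C (by simpa using hq0)]
      exact hqdeg
    · rw [aeval_map_algebraMap, map_mul, hwx, aeval_C]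
      refine IsIntegral.mul ?_ ?_
      · exact isIntegral_algebraMap (x := (⟨w, Algebra.self_mem_adjoin_singleton k w⟩ :
          Algebra.adjoin k {w}))
      · exact isIntegral_algebraMap (x := (algebraMap k (Algebra.adjoin k {w}) q.leadingCoeff⁻¹))
  have hBw (y : B) : IsIntegral (Algebra.adjoin k {w}) y.1 := by
    let R := Algebra.adjoin k {w}
    let I := integralClosure R K
    obtain ⟨p, hp, hp'⟩ := hxint y
    have : IsIntegral I y.1 := by
      let xi : I := ⟨x.1, hxw⟩
      refine ⟨p.map (aeval xi).toRingHom, hp.map _, ?_⟩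
      rw [eval₂_map]
      have h1 := congrArg (algebraMap B K) hp'
      rw [hom_eval₂, map_zero] at h1
      have h2 : (algebraMap I K).comp (aeval (R := k) xi).toRingHom =
          (algebraMap B K).comp (aeval (R := k) x).toRingHom := RingHom.ext fun f ↦
        (aeval_algebraMap_apply K xi f).symm.trans (aeval_algebraMap_apply K x f)
      rw [h2]
      exact h1
    exact isIntegral_trans (R := R) (A := I) _ this
  -- `B` is finite over `k[w]`
  have hfin : (aeval (R := k) (aeval x q : B)).toRingHom.Finite := by
    refine RingHom.IsIntegral.to_finite ?_ ?_
    · intro y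
      obtain ⟨p, hp, hp'⟩ := hBw y
      have hsurj : Function.Surjective ((aeval (R := k) w).codRestrict (Algebra.adjoin k {w})
          fun f ↦ aeval_mem_adjoin_singleton k w) := by
        rintro ⟨c, hc⟩
        rw [Algebra.adjoin_singleton_eq_range_aeval] at hc
        obtain ⟨f, rfl⟩ := hc
        exact ⟨f, rfl⟩
      obtain ⟨p', hp1, -, hp2⟩ := lifts_and_natDegree_eq_and_monic (f := RingHomClass.toRingHom
        ((aeval (R := k) w).codRestrict (Algebra.adjoin k {w})
          fun f ↦ aeval_mem_adjoin_singleton k w)) (p := p) (by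
        rw [lifts_iff_coeff_lifts]
        intro n
        exact hsurj _) hp
      refine ⟨p', hp2, Subtype.val_injective ?_⟩
      rw [← hp1, eval₂_map] at hp'
      change (algebraMap B K) _ = 0
      rw [hom_eval₂, ← hp']
      congr 1
      refine RingHom.ext fun f ↦ ?_
      exact (aeval_algebraMap_apply K (aeval x q) f).symm
    · refine RingHom.FiniteType.of_comp_finiteType (f := algebraMap k k[X]) ?_
      have : ((aeval (R := k) (aeval x q : B)).toRingHom).comp (algebraMap k k[X]) =
        algebraMap k B := (aeval (R := k) (aeval x q : B)).comp_algebraMap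
      rw [this]
      exact (RingHom.finiteType_algebraMap).mpr inferInstance
  algebraize [(aeval (R := k) (aeval x q : B)).toRingHom]
  obtain ⟨E, hE⟩ := Module.Finite.fg_top (R := k[X]) (M := B)
  choose N hN using fun e : B ↦ exists_isIntegral_inv_pow_mul hw0 (hBw e)
  -- `B` and `Binf` play the role of the functions on the two charts of a curve finite over the
  -- projective line via `w`. The aim is that `B + Binf` has finite codimension in the span of all
  -- `w⁻¹ ^ n * y` with `y ∈ B`. The finite set `F` collects the products `w⁻¹ ^ n * e`, for
  -- generators `e` of `B` over `k[w]`, with `n` too small for integrality over `k[w⁻¹]` to be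
  -- guaranteed.
  let Binf : Submodule k K :=
    Subalgebra.toSubmodule ((integralClosure (Algebra.adjoin k {w⁻¹}) K).restrictScalars k)
  let L : Submodule k K := Subalgebra.toSubmodule B ⊔ Binf
  let F : Set K := ⋃ e ∈ E, (fun n : ℕ ↦ w⁻¹ ^ n * (e : K)) '' Set.Iio (N e)
  have hF : F.Finite := E.finite_toSet.biUnion fun e _ ↦ (Set.finite_Iio _).image _
  let T : Submodule k K := L ⊔ Submodule.span k F
  have hTB (y : K) (hy : y ∈ B) : y ∈ T := Submodule.mem_sup_left (Submodule.mem_sup_left hy)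
  have hTe (e : B) (he : e ∈ E) (n : ℕ) : w⁻¹ ^ n * (e : K) ∈ T := by
    by_cases hn : n < N e
    · refine Submodule.mem_sup_right (Submodule.subset_span ?_)
      exact Set.mem_biUnion he ⟨n, hn, rfl⟩
    · exact Submodule.mem_sup_left (Submodule.mem_sup_right (hN e n (by lia)))
  -- Multiplying by `w ^ m` either cancels all of `w⁻¹ ^ n`, leaving an element of `B`, or merely
  -- lowers the exponent `n`. So the generators `e` suffice.
  have hTpow (n : ℕ) (y : B) : w⁻¹ ^ n * (y : K) ∈ T := by
    have hy : y ∈ Submodule.span k[X] (E : Set B) := hE ▸ Submodule.mem_top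
    induction hy using Submodule.span_induction generalizing n with
    | mem e he => exact hTe e he n
    | zero => simp
    | add y z _ _ hy hz =>
      have : w⁻¹ ^ n * ((y + z : B) : K) = w⁻¹ ^ n * (y : K) + w⁻¹ ^ n * (z : K) := by
        push_cast; ring
      rw [this]
      exact add_mem (hy n) (hz n)
    | smul f y _ hy =>
      have hsm (f : k[X]) : ((f • y : B) : K) = aeval w f * y := by
        rw [Algebra.smul_def]
        change ((aeval (aeval x q : B) f : B) : K) * y = _
        congr 1
        exact (aeval_algebraMap_apply K (aeval x q) f).symm
      induction f using Polynomial.induction_on' with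
      | add f g hf hg =>
        rw [hsm] at hf hg ⊢
        rw [map_add, add_mul, mul_add]
        exact add_mem hf hg
      | monomial m c =>
        rw [hsm, aeval_monomial]
        have : w⁻¹ ^ n * (algebraMap k K c * w ^ m * (y : K)) =
          c • (w⁻¹ ^ n * w ^ m * (y : K)) := by rw [Algebra.smul_def]; ring
        rw [this]
        refine Submodule.smul_mem _ _ ?_
        rcases le_total n m with h | h
        · obtain ⟨l, rfl⟩ := Nat.exists_eq_add_of_le h
          rw [pow_add, ← mul_assoc, ← mul_pow, inv_mul_cancel₀ hw0, one_pow, one_mul]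
          exact hTB _ (mul_mem (pow_mem hwB l) y.2)
        · obtain ⟨l, rfl⟩ := Nat.exists_eq_add_of_le h
          rw [add_comm m l, pow_add, mul_assoc (w⁻¹ ^ l), ← mul_pow, inv_mul_cancel₀ hw0, one_pow,
            mul_one]
          exact hy l
  -- Since `w = a t`, one has `t⁻¹ = w⁻¹ a` with `a ∈ B`; this is why `w` was chosen in `t B`.
  have hTt (n : ℕ) : t⁻¹ ^ n ∈ T := by
    have : t⁻¹ = w⁻¹ * a.1 := by
      rw [← hat]
      have : a.1 ≠ 0 := by rintro h; rw [h, zero_mul] at hat; exact hw0 hat.symm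
      field_simp
    rw [this, mul_pow]
    exact hTpow n (a ^ n)
  -- Modulo `L` the powers of `t⁻¹` span a finite-dimensional space, so they satisfy a linear
  -- relation. Starting with exponent `1` makes the relation a nonconstant polynomial.
  obtain ⟨f, hf0, hfL⟩ : ∃ f : k[X], f.natDegree ≠ 0 ∧ aeval t⁻¹ f ∈ L := by
    let W : Submodule k (K ⧸ L) := (Submodule.span k F).map L.mkQ
    have : FiniteDimensional k (Submodule.span k F) := FiniteDimensional.span_of_finite k hF
    have hW : FiniteDimensional k W := inferInstance
    have hmem (n : ℕ) : L.mkQ (t⁻¹ ^ (n + 1)) ∈ W := by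
      obtain ⟨y, hy, z, hz, hyz⟩ := Submodule.mem_sup.mp (hTt (n + 1))
      refine ⟨z, hz, ?_⟩
      rw [← hyz, map_add, Submodule.mkQ_apply, Submodule.mkQ_apply,
        (Submodule.Quotient.mk_eq_zero L).mpr hy, zero_add]
    have hdep : ¬ LinearIndependent k (fun n : ℕ ↦ (⟨_, hmem n⟩ : W)) := by
      intro h
      have := h.finite
      exact not_finite ℕ
    obtain ⟨s, g, hs, i, hi, hgi⟩ := not_linearIndependent_iff.mp hdep
    refine ⟨∑ n ∈ s, monomial (n + 1) (g n), ?_, ?_⟩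
    · have hc : (∑ n ∈ s, monomial (n + 1) (g n)).coeff (i + 1) = g i := by
        rw [finsetSum_coeff, Finset.sum_eq_single i]
        · simp
        · intro n _ hn
          rw [coeff_monomial, if_neg (by simpa using hn)]
        · exact fun h ↦ absurd hi h
      intro h
      rw [coeff_eq_zero_of_natDegree_lt (by lia)] at hc
      exact hgi hc.symm
    · have h1 := congrArg Subtype.val hs
      rw [← Submodule.Quotient.mk_eq_zero, ← Submodule.mkQ_apply, map_sum, map_sum]
      simp only [AddSubmonoidClass.coe_finsetSum, SetLike.val_smul, ZeroMemClass.coe_zero] at h1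
      rw [← h1]
      refine Finset.sum_congr rfl fun n _ ↦ ?_
      rw [aeval_monomial, ← Algebra.smul_def, map_smul]
  have hf00 : f ≠ 0 := by rintro rfl; simp at hf0
  obtain ⟨b', hb', b, hb, hbb⟩ := Submodule.mem_sup.mp hfL
  have hb' : b' ∈ B := hb'
  have hb : IsIntegral (Algebra.adjoin k {w⁻¹}) b := hb
  -- The identity `f(t⁻¹) = b' + b` is, up to scaling, a monic equation for `t⁻¹` over any ring
  -- containing `B` and `b`. A valuation ring containing `w` contains `B`, and if it also contains
  -- `t⁻¹` it contains `b = f(t⁻¹) - b'`. One containing `w⁻¹` contains `b`, which is integral over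
  -- `k[w⁻¹]`.
  refine ⟨b, fun R hBR hbR ↦ ?_, fun O hO ↦ ?_⟩
  · have hkR (c : k) : algebraMap k K c ∈ R := hBR (algebraMap_mem B c)
    let i : k →+* R := (algebraMap k K).codRestrict R hkR
    refine IsIntegral.of_aeval_monic (p := (f * C f.leadingCoeff⁻¹).map i)
      ((monic_mul_leadingCoeff_inv hf00).map _) ?_ ?_
    · rw [natDegree_map, natDegree_mul_C (by simpa using hf00)]
      exact hf0
    · have h1 : aeval t⁻¹ ((f * C f.leadingCoeff⁻¹).map i) =
          (b' + b) * algebraMap k K f.leadingCoeff⁻¹ := by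
        rw [aeval_def, eval₂_map, hbb, eval₂_mul, eval₂_C]
        rfl
      rw [h1]
      exact isIntegral_algebraMap (x := (⟨_, mul_mem (add_mem (hBR hb') hbR) (hkR _)⟩ : R))
  · have hint (y z : K) (hz : z ∈ O) (hy : IsIntegral (Algebra.adjoin k {z}) y) : y ∈ O := by
      have hle (c : K) (hc : c ∈ Algebra.adjoin k {z}) : c ∈ O := by
        induction hc using Algebra.adjoin_induction with
        | mem y hy => obtain rfl : y = z := hy; exact hz
        | algebraMap r => exact hO r
        | add a b _ _ ha hb => exact add_mem ha hb
        | mul a b _ _ ha hb => exact mul_mem ha hb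
      obtain ⟨p, hp, hp'⟩ := hy
      have : IsIntegral O y := by
        let i : Algebra.adjoin k {z} →+* O :=
          (algebraMap (Algebra.adjoin k {z}) K).codRestrict O.toSubring fun c ↦ hle _ c.2
        refine ⟨p.map i, hp.map _, ?_⟩
        rw [eval₂_map]
        exact hp'
      obtain ⟨y', rfl⟩ := IsIntegrallyClosed.isIntegral_iff.mp this
      exact y'.2
    rcases O.mem_or_inv_mem w with hwO | hwO
    · have hBO : (B : Set K) ⊆ O := fun y hy ↦ hint y w hwO (hBw ⟨y, hy⟩)
      by_cases htO : t⁻¹ ∈ O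
      · left
        have h1 : aeval t⁻¹ f ∈ O := by
          rw [aeval_eq_sum_range]
          refine sum_mem fun n _ ↦ ?_
          rw [Algebra.smul_def]
          exact mul_mem (hO _) (pow_mem htO n)
        have h2 : b = aeval t⁻¹ f - b' := by rw [← hbb]; ring
        rw [h2]
        exact sub_mem h1 (hBO hb')
      · exact .inr ⟨hBO, htO⟩
    · exact .inl (hint b _ hwO hb)

end Pole

end PolyDiv

namespace PolyDiv

/-! ## Rational functions and local rings on a curve -/

section LocalRings

/-- An ideal of the regular functions on an affine open is trivial if at each point it has an
element that does not vanish there. -/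
theorem eq_top_of_forall_exists_mem_basicOpen {Y : Scheme.{0}} {V : Y.Opens} (hV : IsAffineOpen V)
    (I : Ideal Γ(Y, V)) (h : ∀ y ∈ V, ∃ t ∈ I, y ∈ Y.basicOpen t) : I = ⊤ := by
  by_contra hI
  obtain ⟨m, hm, hIm⟩ := Ideal.exists_le_maximal I hI
  let q : PrimeSpectrum Γ(Y, V) := ⟨m, hm.isPrime⟩
  have hq : hV.fromSpec q ∈ V := by
    have := Set.mem_range_self (f := hV.fromSpec) q
    rwa [hV.range_fromSpec] at this
  obtain ⟨t, ht, hqt⟩ := h _ hq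
  have : q ∈ hV.fromSpec ⁻¹ᵁ Y.basicOpen t := hqt
  rw [hV.fromSpec_preimage_basicOpen] at this
  exact this (hIm ht)

variable {Y : Scheme.{0}} [Y.Over SpecC] [IsNonsingularCurve Y]

theorem coheight_closedPoint (P : closedPoints Y) : Order.coheight P.1 = 1 := by
  have h1 := ringKrullDim_stalk_eq_coheight P.1
  rw [IsDiscreteValuationRing.ringKrullDim_eq_one] at h1
  exact_mod_cast h1.symm

theorem genericPoint_mem {V : Y.Opens} [Nonempty V] : genericPoint Y ∈ V :=
  ((genericPoint_spec Y).mem_open_set_iff V.isOpen).mpr (by simpa using ‹Nonempty V›)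

/-- A rational function has no pole at `P` if and only if it belongs to the local ring of `P`. -/
theorem ord_nonneg_iff (P : closedPoints Y) {f : Y.functionField} (hf : f ≠ 0) :
    0 ≤ Scheme.ord f P.1 ↔ ∃ a, algebraMap (Y.presheaf.stalk P.1) Y.functionField a = f := by
  constructor
  · intro h
    rw [Scheme.le_ord_iff (coheight_closedPoint P) hf] at h
    change _ ≤ Ring.ordFrac (Y.presheaf.stalk P.1) f at h
    rw [Ring.ordFrac_eq_valuation_inv] at h
    refine IsDiscreteValuationRing.exists_lift_of_le_one ?_
    rw [ofAdd_zero, WithZero.coe_one, one_le_inv₀] at h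
    · exact h
    · exact zero_lt_iff.mpr (by simpa using hf)
  · rintro ⟨a, rfl⟩
    obtain ⟨V, hV, a, rfl⟩ := Y.presheaf.exists_germ_eq a
    exact ord_germ_nonneg hV a

theorem ord_one (x : Y) : Scheme.ord (1 : Y.functionField) x = 0 := by
  have := Scheme.ord_mul (x := x) (one_ne_zero (α := Y.functionField)) one_ne_zero
  rw [mul_one] at this
  lia

theorem ord_pow {f : Y.functionField} (hf : f ≠ 0) (n : ℕ) (x : Y) :
    Scheme.ord (f ^ n) x = n * Scheme.ord f x := by
  induction n with
  | zero => simp [ord_one]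
  | succ n ih => rw [pow_succ, Scheme.ord_mul (pow_ne_zero _ hf) hf, ih]; push_cast; ring

theorem ord_inv {f : Y.functionField} (hf : f ≠ 0) (x : Y) :
    Scheme.ord f⁻¹ x = - Scheme.ord f x := by
  have := Scheme.ord_mul (x := x) hf (inv_ne_zero hf)
  rw [mul_inv_cancel₀ hf, ord_one] at this
  lia

/-- The elements of the local ring at a point `y` of an affine open `V` are quotients `s / t` of
regular functions on `V` with `t` invertible at `y`. -/
theorem exists_mul_eq_of_stalk {V : Y.Opens} (hV : IsAffineOpen V) [Nonempty V] {y : Y} (hy : y ∈ V)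
    (a : Y.presheaf.stalk y) :
    ∃ t s : Γ(Y, V), y ∈ Y.basicOpen t ∧
      Y.germToFunctionField V t * algebraMap (Y.presheaf.stalk y) Y.functionField a =
        Y.germToFunctionField V s := by
  let : Algebra Γ(Y, V) (Y.presheaf.stalk y) := (Y.presheaf.germ V y hy).hom.toAlgebra
  have : IsLocalization.AtPrime (Y.presheaf.stalk y) (hV.primeIdealOf ⟨y, hy⟩).asIdeal :=
    hV.isLocalization_stalk ⟨y, hy⟩
  obtain ⟨⟨s, t⟩, h⟩ := IsLocalization.surj
    (hV.primeIdealOf ⟨y, hy⟩).asIdeal.primeCompl a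
  refine ⟨t.1, s, ?_, ?_⟩
  · rw [Y.mem_basicOpen _ _ hy]
    exact IsLocalization.map_units (Y.presheaf.stalk y) t
  · rw [← Scheme.algebraMap_germ_eq_germToFunctionField (X := Y) hy,
      ← Scheme.algebraMap_germ_eq_germToFunctionField (X := Y) hy, ← map_mul]
    congr 1
    rw [mul_comm]
    exact h

/-- On an affine open `V`, every rational function without pole at `y` is a quotient `s / t` of
regular functions on `V` with `t` invertible at `y`. -/
theorem exists_mul_eq_of_ord_nonneg {V : Y.Opens} (hV : IsAffineOpen V) [Nonempty V] {y : Y}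
    (hy : y ∈ V) {f : Y.functionField} (hf : f ≠ 0)
    (h : y ∈ closedPoints Y → 0 ≤ Scheme.ord f y) :
    ∃ t s : Γ(Y, V), y ∈ Y.basicOpen t ∧
      Y.germToFunctionField V t * f = Y.germToFunctionField V s := by
  by_cases hyc : y ∈ closedPoints Y
  · obtain ⟨a, rfl⟩ := (ord_nonneg_iff ⟨y, hyc⟩ hf).mp (h hyc)
    exact exists_mul_eq_of_stalk hV hy a
  · obtain rfl : y = genericPoint Y := by
      by_contra hne
      exact hyc (mem_closedPoints_of_ne hne)
    have := functionField_isFractionRing_of_isAffineOpen Y V hV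
    obtain ⟨⟨s, t⟩, h⟩ := IsLocalization.surj (nonZeroDivisors Γ(Y, V)) f
    refine ⟨t.1, s, ?_, by rw [mul_comm]; exact h⟩
    rw [Y.mem_basicOpen _ _ hy]
    refine isUnit_iff_ne_zero.mpr ?_
    change Y.germToFunctionField V t.1 ≠ 0
    rw [Ne, map_eq_zero_iff _ (Y.germToFunctionField_injective V)]
    exact nonZeroDivisors.ne_zero t.2

end LocalRings

/-! ### Integrality of the sections over an affine open, from semiampleness -/

namespace PolyhedralDivisor

variable {M : Type} [AddCommGroup M] {Y : Scheme.{0}} {σ : PointedCone ℚ (NQ M)}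
  (D : PolyhedralDivisor Y σ)

theorem nsmul_eval_le {u : M} (hu : u ∈ weightMonoid σ) (n : ℕ) (P : closedPoints Y) :
    n * D.eval u P ≤ D.eval (n • u) P := by
  induction n with
  | zero => simp [D.eval_zero]
  | succ n ih =>
    have := D.eval_add_le (nsmul_mem hu n) hu P
    rw [succ_nsmul]
    push_cast
    linarith

variable [Y.Over SpecC] [IsNonsingularCurve Y]

theorem single_mem_sections {V : Y.Opens} {u : M} (hu : u ∈ weightMonoid σ) {f : Y.functionField}
    (hf : f ∈ divisorSections (D.eval u) V) : AddMonoidAlgebra.single u f ∈ D.sections V := by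
  classical
  intro w hw
  rw [AddMonoidAlgebra.coeff_single, Finsupp.single_apply] at hw ⊢
  split_ifs at hw ⊢ with h
  · subst h; exact ⟨hu, hf⟩
  · exact absurd rfl hw

/-- If `𝒟(u)` is semiample for all weights `u`, then `Γ(V, 𝒜)` is integral over the subring
generated by `Γ(Y, 𝒜)` and `Γ(V, 𝒪_Y)`. -/
theorem isIntegral_of_mem_sections (hD : ∀ u ∈ weightMonoid σ, IsSemiample (D.eval u))
    {V : Y.Opens} (hV : IsAffineOpen V) [Nonempty V]
    {R : Subring (AddMonoidAlgebra Y.functionField M)} (hR : D.sections ⊤ ≤ R)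
    (hR' : ∀ g : Γ(Y, V), AddMonoidAlgebra.single 0 (Y.germToFunctionField V g) ∈ R)
    {a : AddMonoidAlgebra Y.functionField M} (ha : a ∈ D.sections V) : IsIntegral R a := by
  have key (u : M) (f : Y.functionField) (hu : u ∈ weightMonoid σ)
      (hf : f ∈ divisorSections (D.eval u) V) (hf0 : f ≠ 0) :
      IsIntegral R (AddMonoidAlgebra.single u f) := by
    obtain ⟨n, hn, hcov⟩ := hD u hu
    refine IsIntegral.of_pow hn ?_
    suffices h : (AddMonoidAlgebra.single u f) ^ n ∈ R from
      isIntegral_algebraMap (x := (⟨_, h⟩ : R))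
    -- The denominators that bring `(f χ^u)^n` into `R`. The ideal is shown to be trivial by
    -- finding, at each point, a denominator that is invertible there.
    let I : Ideal Γ(Y, V) :=
      { carrier := {t | AddMonoidAlgebra.single 0 (Y.germToFunctionField V t) *
          (AddMonoidAlgebra.single u f) ^ n ∈ R}
        zero_mem' := by simp [R.zero_mem]
        add_mem' := fun {s t} hs ht ↦ by
          simp only [Set.mem_ofPred_eq, map_add, AddMonoidAlgebra.single_add, add_mul] at *
          exact add_mem hs ht
        smul_mem' := fun c t ht ↦ by
          have h1 : AddMonoidAlgebra.single (0 : M) (Y.germToFunctionField V (c * t)) =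
              AddMonoidAlgebra.single 0 (Y.germToFunctionField V c) *
              AddMonoidAlgebra.single 0 (Y.germToFunctionField V t) := by
            rw [AddMonoidAlgebra.single_mul_single, add_zero, map_mul]
          simp only [Set.mem_ofPred_eq, smul_eq_mul] at *
          rw [h1, mul_assoc]
          exact mul_mem (hR' c) ht }
    have hI : I = ⊤ := by
      refine eq_top_of_forall_exists_mem_basicOpen hV I fun y hy ↦ ?_
      -- Semiampleness gives a global section `g` of `n𝒟(u)` generating it at `y`, so `f^n / g` is
      -- regular at `y` and equals some `s / t`. Then `t (f χ^u)^n = s · g χ^{nu}`, and `g χ^{nu}`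
      -- is a section of `𝒜` because `n𝒟(u) ≤ 𝒟(nu)`.
      obtain ⟨g, hg0, hg, hyg⟩ := hcov y
      obtain ⟨t, s, hyt, hts⟩ := exists_mul_eq_of_ord_nonneg hV hy (f := f ^ n * g⁻¹)
        (mul_ne_zero (pow_ne_zero _ hf0) (inv_ne_zero hg0)) (fun hyc ↦ by
          rw [Scheme.ord_mul (pow_ne_zero _ hf0) (inv_ne_zero hg0), ord_pow hf0, ord_inv hg0]
          have h1 := hf hf0 ⟨y, hyc⟩ hy
          have h2 := hyg hyc
          simp only [Pi.smul_apply, nsmul_eq_mul] at h1 h2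
          have h3 : (0 : ℚ) ≤ n * ((Scheme.ord f y : ℚ) + D.eval u ⟨y, hyc⟩) := by positivity
          have : (0 : ℚ) ≤ ((n * Scheme.ord f y + - Scheme.ord g y : ℤ) : ℚ) := by
            push_cast
            linarith
          exact_mod_cast this)
      refine ⟨t, ?_, hyt⟩
      change AddMonoidAlgebra.single 0 (Y.germToFunctionField V t) * _ ∈ R
      have h1 : AddMonoidAlgebra.single 0 (Y.germToFunctionField V t) *
          (AddMonoidAlgebra.single u f) ^ n = AddMonoidAlgebra.single 0
            (Y.germToFunctionField V s) * AddMonoidAlgebra.single (n • u) g := by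
        rw [← hts, AddMonoidAlgebra.single_pow, AddMonoidAlgebra.single_mul_single,
          AddMonoidAlgebra.single_mul_single]
        congr 1
        field_simp
      rw [h1]
      refine mul_mem (hR' s) (hR (D.single_mem_sections (nsmul_mem hu n) fun _ P hP ↦ ?_))
      have h2 := hg hg0 P hP
      have h3 := D.nsmul_eval_le hu n P
      simp only [Pi.smul_apply, nsmul_eq_mul] at h2
      linarith
    have h1 : (1 : Γ(Y, V)) ∈ I := hI ▸ Submodule.mem_top
    have h2 : AddMonoidAlgebra.single 0 (Y.germToFunctionField V 1) *
      (AddMonoidAlgebra.single u f) ^ n ∈ R := h1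
    rwa [map_one, ← AddMonoidAlgebra.one_def, one_mul] at h2
  rw [← AddMonoidAlgebra.sum_coeff_single a, Finsupp.sum]
  refine IsIntegral.sum _ fun u hu ↦ ?_
  have hu' := Finsupp.mem_support_iff.mp hu
  exact key u _ (ha u hu').1 (ha u hu').2 hu'

end PolyhedralDivisor

end PolyDiv

namespace PolyDiv

/-! ## Open subsets of curves -/

section OpenSubcurve

variable {C : Scheme.{0}} [C.Over SpecC] [IsNonsingularCurve C]

/-- A nonzero prime is not the generic point, and every other point of a curve is closed. -/
theorem isMaximal_of_isPrime {V : C.Opens} (hV : IsAffineOpen V) [Nonempty V] (p : Ideal Γ(C, V))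
    (hp : p.IsPrime) (hp0 : p ≠ ⊥) : p.IsMaximal := by
  let q : PrimeSpectrum Γ(C, V) := ⟨p, hp⟩
  have hne : hV.fromSpec q ≠ genericPoint C := by
    intro h
    have h1 := hV.fromSpec_primeIdealOf ⟨genericPoint C, genericPoint_mem⟩
    have h2 : hV.primeIdealOf ⟨genericPoint C, genericPoint_mem⟩ = q :=
      hV.fromSpec.isOpenEmbedding.injective (h1.trans h.symm)
    rw [hV.primeIdealOf_genericPoint] at h2
    have h3 := genericPoint_eq_bot_of_affine Γ(C, V)
    rw [h3] at h2
    exact hp0 (congrArg PrimeSpectrum.asIdeal h2).symm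
  have h1 := mem_closedPoints_iff.mp (mem_closedPoints_of_ne hne)
  have h2 : IsClosed ({q} : Set (PrimeSpectrum Γ(C, V))) := by
    have h3 : hV.fromSpec ⁻¹' {hV.fromSpec q} = {q} :=
      Set.ext fun q' ↦ hV.fromSpec.isOpenEmbedding.injective.eq_iff
    have h4 := h1.preimage hV.fromSpec.continuous
    rw [h3] at h4
    exact h4
  exact (PrimeSpectrum.isClosed_singleton_iff_isMaximal q).mp h2

/-- A closed point of a curve has an affine neighborhood contained in a given neighborhood of the
generic point, except possibly for that point, on which the point is the only zero of some function
vanishing there. -/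
theorem exists_affine_nhds_single_zero (c : C) (hc : c ∈ closedPoints C) (G : C.Opens)
    (hG : genericPoint C ∈ G) :
    ∃ (V : C.Opens) (_ : IsAffineOpen V) (_ : c ∈ V) (t : Γ(C, V)), c ∉ C.basicOpen t ∧ t ≠ 0 ∧
      ∀ x ∈ V, x ≠ c → x ∈ C.basicOpen t ∧ x ∈ G := by
  have : IsDiscreteValuationRing (C.presheaf.stalk c) := isDVR_curve C ⟨c, hc⟩
  obtain ⟨ϖ, hϖ⟩ := IsDiscreteValuationRing.exists_irreducible (C.presheaf.stalk c)
  obtain ⟨W, hcW, t, rfl⟩ := C.presheaf.exists_germ_eq ϖ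
  have : Nonempty W := ⟨⟨c, hcW⟩⟩
  have ht0 : t ≠ 0 := by rintro rfl; exact hϖ.ne_zero (map_zero _)
  have hgen : genericPoint C ∈ C.basicOpen t := by
    rw [C.mem_basicOpen _ _ genericPoint_mem]
    refine isUnit_iff_ne_zero.mpr ?_
    change C.germToFunctionField W t ≠ 0
    rwa [Ne, map_eq_zero_iff _ (C.germToFunctionField_injective W)]
  -- Only finitely many points lie outside `G'`, and all of them are closed. Removing those other
  -- than `c` leaves a neighborhood of `c`.
  let G' : C.Opens := C.basicOpen t ⊓ G
  have hG' : genericPoint C ∈ G' := ⟨hgen, hG⟩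
  have hfin : ((G' : Set C)ᶜ \ {c}).Finite := (finite_compl hG').subset Set.sdiff_subset
  have hcl : IsClosed ((G' : Set C)ᶜ \ {c}) := by
    rw [← Set.biUnion_of_singleton ((G' : Set C)ᶜ \ {c})]
    refine hfin.isClosed_biUnion fun x hx ↦ mem_closedPoints_iff.mp (mem_closedPoints_of_ne ?_)
    rintro rfl
    exact hx.1 hG'
  let W₀ : C.Opens := W ⊓ ⟨_, hcl.isOpen_compl⟩
  obtain ⟨V, hV, hcV, hVW⟩ := exists_isAffineOpen_mem_and_subset (U := W₀) (x := c)
    ⟨hcW, fun h ↦ h.2 rfl⟩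
  have hVW' : V ≤ W := fun x hx ↦ (hVW hx).1
  refine ⟨V, hV, hcV, C.presheaf.map (homOfLE hVW').op t, ?_, ?_, ?_⟩
  · rw [Scheme.basicOpen_res]
    intro h
    exact hϖ.not_isUnit ((C.mem_basicOpen _ _ hcW).mp h.2)
  · intro h
    have : Nonempty V := ⟨⟨c, hcV⟩⟩
    apply ht0
    refine C.germToFunctionField_injective W ?_
    rw [map_zero]
    have h1 := congrArg (C.germToFunctionField V) h
    rw [map_zero] at h1
    rw [← h1]
    exact (C.presheaf.germ_res_apply (homOfLE hVW') _ _ _).symm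
  · intro x hx hxc
    have h1 : x ∈ G' := by
      by_contra h
      exact (hVW hx).2 ⟨h, hxc⟩
    rw [Scheme.basicOpen_res]
    exact ⟨⟨hx, h1.1⟩, h1.2⟩

end OpenSubcurve

end PolyDiv

namespace PolyDiv

/-! ## Regular functions on a curve and on an open subset -/

theorem isDominant_specMap {R S : CommRingCat.{0}} (f : R ⟶ S) (hf : Function.Injective f) :
    IsDominant (Spec.map f) := by
  refine ⟨(PrimeSpectrum.denseRange_comap_iff_ker_le_nilRadical f.hom).mpr ?_⟩
  rw [(RingHom.injective_iff_ker_eq_bot f.hom).mp hf]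
  exact bot_le

section Pullback

variable {Y C : Scheme.{0}} [Y.Over SpecC] [IsNonsingularCurve Y] (j : Y ⟶ C)

/-- Pullback of regular functions on an open of `C` to rational functions on `Y`. -/
def pullbackFunction (V : C.Opens) [Nonempty (j ⁻¹ᵁ V)] : Γ(C, V) →+* Y.functionField :=
  (Y.germToFunctionField (j ⁻¹ᵁ V)).hom.comp (j.app V).hom

theorem pullbackFunction_apply (V : C.Opens) [Nonempty (j ⁻¹ᵁ V)] (g : Γ(C, V)) :
    pullbackFunction j V g = Y.germToFunctionField (j ⁻¹ᵁ V) (j.app V g) := rfl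

theorem germToFunctionField_map {V W : Y.Opens} [Nonempty V] [Nonempty W] (h : V ≤ W)
    (g : Γ(Y, W)) : Y.germToFunctionField V (Y.presheaf.map (homOfLE h).op g) =
      Y.germToFunctionField W g :=
  Y.presheaf.germ_res_apply (homOfLE h) _ _ _

theorem pullbackFunction_map {V W : C.Opens} [Nonempty (j ⁻¹ᵁ V)] [Nonempty (j ⁻¹ᵁ W)] (h : V ≤ W)
    (g : Γ(C, W)) : pullbackFunction j V (C.presheaf.map (homOfLE h).op g) =
      pullbackFunction j W g := by
  rw [pullbackFunction_apply, pullbackFunction_apply,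
    ← germToFunctionField_map (show j ⁻¹ᵁ V ≤ j ⁻¹ᵁ W from fun x hx ↦ h hx)]
  congr 1
  exact congr($(j.naturality (homOfLE h).op).hom g)

theorem exists_stalk_eq_of_mem {V : Y.Opens} [Nonempty V] {y : Y} (hy : y ∈ V) (g : Γ(Y, V)) :
    ∃ a, algebraMap (Y.presheaf.stalk y) Y.functionField a = Y.germToFunctionField V g :=
  ⟨_, Scheme.algebraMap_germ_eq_germToFunctionField (X := Y) hy g⟩

section

variable [IsOpenImmersion j]

/-- Functions on the part of `Y` over the basic open of `t` are quotients by powers of `t`. -/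
theorem exists_pullbackFunction_mul_pow {V : C.Opens} (hV : IsAffineOpen V) [Nonempty (j ⁻¹ᵁ V)]
    {t : Γ(C, V)} (ht : C.basicOpen t ≤ j.opensRange) (hV' : j ⁻¹ᵁ V ≤ j ⁻¹ᵁ C.basicOpen t)
    (x : Γ(Y, j ⁻¹ᵁ V)) :
    ∃ (n : ℕ) (s : Γ(C, V)), Y.germToFunctionField _ x * pullbackFunction j V t ^ n =
      pullbackFunction j V s := by
  have hle : j ⁻¹ᵁ C.basicOpen t ≤ j ⁻¹ᵁ V := fun x hx ↦ C.basicOpen_le t hx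
  have hn : Nonempty (j ⁻¹ᵁ C.basicOpen t) := by
    rw [le_antisymm hle hV']; infer_instance
  have : IsIso (j.app (C.basicOpen t)) := j.isIso_app _ ht
  obtain ⟨z, hz⟩ := (ConcreteCategory.bijective_of_isIso (j.app (C.basicOpen t))).2
    (Y.presheaf.map (homOfLE hle).op x)
  have := hV.isLocalization_basicOpen t
  obtain ⟨⟨s, ⟨_, n, rfl⟩⟩, hs⟩ := IsLocalization.surj (Submonoid.powers t) z
  refine ⟨n, s, ?_⟩
  rw [← germToFunctionField_map hle x, ← hz, ← map_pow, ← pullbackFunction_map j (C.basicOpen_le t),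
    ← pullbackFunction_map j (C.basicOpen_le t), ← pullbackFunction_apply, ← map_mul]
  exact congrArg _ hs

end

variable [C.Over SpecC] [IsNonsingularCurve C]

/-- A point of `Y` maps to the affine open `V` if all functions on `V` pull back to functions
without pole at the point. -/
theorem mem_of_forall_pullbackFunction {V : C.Opens} (hV : IsAffineOpen V) [Nonempty (j ⁻¹ᵁ V)]
    (hW : IsAffineOpen (j ⁻¹ᵁ V)) (y : Y)
    (h : ∀ g : Γ(C, V), ∃ a, algebraMap (Y.presheaf.stalk y) Y.functionField a =
      pullbackFunction j V g) : j y ∈ V := by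
  have hinj := IsFractionRing.injective (Y.presheaf.stalk y) Y.functionField
  choose β hβ using h
  let β' : Γ(C, V) →+* Y.presheaf.stalk y :=
    { toFun := β
      map_one' := hinj (by rw [hβ, map_one, map_one])
      map_mul' := fun a b ↦ hinj (by rw [map_mul, hβ, hβ, hβ, map_mul])
      map_zero' := hinj (by rw [hβ, map_zero, map_zero])
      map_add' := fun a b ↦ hinj (by rw [map_add, hβ, hβ, hβ, map_add]) }
  have hsp : genericPoint Y ⤳ y := (genericPoint_spec Y).specializes trivial
  let ι := Spec.map (Y.presheaf.stalkSpecializes hsp)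
  have : IsDominant ι := isDominant_specMap _ hinj
  -- Two morphisms from the spectrum of the local ring at `y` to `C`: one factors through `V`, the
  -- other is the restriction of `j`. They agree at the generic point, hence everywhere since `C` is
  -- separated; comparing the images of the closed point puts `j y` in `V`.
  have heq : Spec.map (CommRingCat.ofHom β') ≫ hV.fromSpec = Y.fromSpecStalk y ≫ j := by
    refine ext_of_isDominant (ι := ι) ?_
    rw [Scheme.SpecMap_stalkSpecializes_fromSpecStalk_assoc,
      ← hW.fromSpecStalk_eq_fromSpecStalk genericPoint_mem, IsAffineOpen.fromSpecStalk,
      Category.assoc, ← IsAffineOpen.SpecMap_appLE_fromSpec j hV hW le_rfl, ← Spec.map_comp_assoc,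
      ← Spec.map_comp_assoc]
    congr 2
    ext g
    exact (hβ g).trans (by
      rw [pullbackFunction_apply, Scheme.Hom.app_eq_appLE]; rfl)
  let q : Spec (Y.presheaf.stalk y) := IsLocalRing.closedPoint (Y.presheaf.stalk y)
  have h1 : hV.fromSpec (Spec.map (CommRingCat.ofHom β') q) = j (Y.fromSpecStalk y q) :=
    congr($heq q)
  rw [Scheme.fromSpecStalk_closedPoint] at h1
  rw [← h1]
  have := Set.mem_range_self (f := hV.fromSpec) (Spec.map (CommRingCat.ofHom β') q)
  rwa [hV.range_fromSpec] at this

variable [IsOpenImmersion j]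

/-- Every point of `C` has an affine neighborhood `V` such that the functions on `V ∩ Y` are
integral over the functions on `V` together with those on `Y`. -/
theorem exists_affine_nhds_isIntegral (c : C) :
    ∃ (V : C.Opens) (_ : c ∈ V) (_ : IsAffineOpen V) (_ : IsAffineOpen (j ⁻¹ᵁ V))
      (_ : Nonempty (j ⁻¹ᵁ V)),
      ∀ R : Subring Y.functionField, (∀ g, pullbackFunction j V g ∈ R) →
        (∀ b ∈ divisorSections (Y := Y) 0 ⊤, b ∈ R) →
          ∀ x : Γ(Y, j ⁻¹ᵁ V), IsIntegral R (Y.germToFunctionField _ x) := by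
  have hY : Nonempty j.opensRange := ⟨⟨j (genericPoint Y), Set.mem_range_self _⟩⟩
  by_cases hc : c ∈ j.opensRange
  · obtain ⟨V, hV, hcV, hVj⟩ := exists_isAffineOpen_mem_and_subset (U := j.opensRange) hc
    obtain ⟨y, rfl⟩ := hc
    have hn : Nonempty (j ⁻¹ᵁ V) := ⟨⟨y, hcV⟩⟩
    refine ⟨V, hcV, hV, hV.preimage_of_isOpenImmersion j hVj, hn, fun R hR _ x ↦ ?_⟩
    have : IsIso (j.app V) := j.isIso_app _ hVj
    obtain ⟨z, rfl⟩ := (ConcreteCategory.bijective_of_isIso (j.app V)).2 x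
    exact isIntegral_algebraMap (x := (⟨_, hR z⟩ : R))
  have hcc : c ∈ closedPoints C := mem_closedPoints_of_ne (by
    rintro rfl
    exact hc genericPoint_mem)
  obtain ⟨V, hV, hcV, t, hct, ht0, hVt⟩ :=
    exists_affine_nhds_single_zero c hcc j.opensRange genericPoint_mem
  have hVn : Nonempty V := ⟨⟨c, hcV⟩⟩
  have htj : C.basicOpen t ≤ j.opensRange := fun x hx ↦
    (hVt x (C.basicOpen_le t hx) (by rintro rfl; exact hct hx)).2
  have hVtj : j ⁻¹ᵁ V ≤ j ⁻¹ᵁ C.basicOpen t := fun y hy ↦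
    (hVt (j y) hy (by rintro rfl; exact hc (Set.mem_range_self _))).1
  have heq : j ⁻¹ᵁ V = j ⁻¹ᵁ C.basicOpen t :=
    le_antisymm hVtj (fun x hx ↦ C.basicOpen_le t hx)
  have hW : IsAffineOpen (j ⁻¹ᵁ V) := by
    rw [heq]
    exact (hV.basicOpen t).preimage_of_isOpenImmersion j htj
  have hWn : Nonempty (j ⁻¹ᵁ V) := by
    obtain ⟨y, hy⟩ : genericPoint C ∈ j.opensRange := genericPoint_mem
    refine ⟨⟨y, ?_⟩⟩
    change j y ∈ V
    rw [hy]
    exact genericPoint_mem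
  refine ⟨V, hcV, hV, hW, hWn, fun R hR hRY x ↦ ?_⟩
  have h0 : pullbackFunction j V t ≠ 0 := by
    have h1 : genericPoint Y ∈ j ⁻¹ᵁ C.basicOpen t := hVtj genericPoint_mem
    rw [Scheme.preimage_basicOpen, Y.mem_basicOpen _ _ genericPoint_mem] at h1
    exact h1.ne_zero
  -- Functions on `V ∩ Y = V ∖ {c}` are quotients `s / t^n`, so only `t⁻¹` matters.
  suffices hmain : IsIntegral R (pullbackFunction j V t)⁻¹ by
    obtain ⟨n, s, hs⟩ := exists_pullbackFunction_mul_pow j hV htj hVtj x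
    rw [← eq_div_iff (pow_ne_zero _ h0)] at hs
    rw [hs, div_eq_mul_inv, ← inv_pow]
    exact (isIntegral_algebraMap (x := (⟨_, hR s⟩ : R))).mul (hmain.pow n)
  let γ : ℂ →+* Γ(C, V) := ((C ↘ SpecC).appLE ⊤ V le_top).hom.comp
    (Scheme.ΓSpecIso (CommRingCat.of ℂ)).inv.hom
  have hγ : γ.FiniteType := ((C ↘ SpecC).finiteType_appLE (isAffineOpen_top _) hV le_top).comp
    (.of_surjective _ (ConcreteCategory.bijective_of_isIso
      (Scheme.ΓSpecIso (CommRingCat.of ℂ)).inv).2)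
  let _ : Algebra ℂ Γ(C, V) := γ.toAlgebra
  have _ : Algebra.FiniteType ℂ Γ(C, V) := hγ
  let _ : Algebra ℂ Y.functionField := ((pullbackFunction j V).comp γ).toAlgebra
  let ρ : Γ(C, V) →ₐ[ℂ] Y.functionField := ⟨pullbackFunction j V, fun _ ↦ rfl⟩
  let B := ρ.range
  have hBR : (B : Set Y.functionField) ⊆ R := by
    rintro _ ⟨g, rfl⟩
    exact hR g
  by_cases htB : (pullbackFunction j V t)⁻¹ ∈ B
  · exact isIntegral_algebraMap (x := (⟨_, hBR htB⟩ : R))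
  have _ : Algebra.FiniteType ℂ B := .of_surjective ρ.rangeRestrict ρ.rangeRestrict_surjective
  have hB (p : Ideal B) (hp : p.IsPrime) (hp0 : p ≠ ⊥) : p.IsMaximal := by
    have hmax : (p.comap ρ.rangeRestrict).IsMaximal := by
      refine isMaximal_of_isPrime hV _ inferInstance fun h ↦ hp0 ?_
      rw [eq_bot_iff]
      intro b hb
      obtain ⟨g, rfl⟩ := ρ.rangeRestrict_surjective b
      have hg : g ∈ p.comap ρ.rangeRestrict := hb
      rw [h, Submodule.mem_bot] at hg
      simp [hg]
    have := Ideal.map_eq_top_or_isMaximal_of_surjective _ ρ.rangeRestrict_surjective hmax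
    rw [Ideal.map_comap_of_surjective _ ρ.rangeRestrict_surjective] at this
    exact this.resolve_left hp.ne_top
  obtain ⟨b, hb, hb'⟩ := exists_pole B hB (t := pullbackFunction j V t) ⟨t, rfl⟩ h0 htB
  -- What remains is that `b` has no pole on `Y`. This is tested on the valuation ring of each
  -- closed point `P`.
  refine hb R hBR (hRY b fun hb0 P _ ↦ ?_)
  simp only [Pi.zero_apply, add_zero]
  suffices 0 ≤ Scheme.ord b P.1 by exact_mod_cast this
  rw [ord_nonneg_iff P hb0]
  let O : ValuationSubring Y.functionField :=
    { (algebraMap (Y.presheaf.stalk P.1) Y.functionField).range with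
      mem_or_inv_mem' := fun x ↦ by
        by_cases hx : x = 0
        · exact .inl ⟨0, by rw [map_zero, hx]⟩
        rcases le_total 0 (Scheme.ord x P.1) with h | h
        · exact .inl ((ord_nonneg_iff P hx).mp h)
        · refine .inr ((ord_nonneg_iff P (inv_ne_zero hx)).mp ?_)
          rw [ord_inv hx]
          lia }
  rcases hb' O (fun c ↦ by
    have : Nonempty (j ⁻¹ᵁ (⊤ : C.Opens)) := ⟨⟨P.1, trivial⟩⟩
    change pullbackFunction j V (γ c) ∈ O
    have h1 : γ c = C.presheaf.map (homOfLE le_top).op ((C ↘ SpecC).app ⊤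
      ((Scheme.ΓSpecIso (CommRingCat.of ℂ)).inv c)) := rfl
    rw [h1]
    erw [pullbackFunction_map j le_top]
    exact exists_stalk_eq_of_mem (V := j ⁻¹ᵁ ⊤) trivial _) with h | ⟨h1, h2⟩
  · exact h
  -- If all functions on `V` are regular at `P`, then `P` lies over `V`; it is not over `c`, so `t`
  -- is invertible at `P` and `t⁻¹` is regular there.
  · exfalso
    have hPV := mem_of_forall_pullbackFunction j hV hW P.1 fun g ↦ h1 ⟨g, rfl⟩
    have h3 : P.1 ∈ j ⁻¹ᵁ C.basicOpen t := hVtj hPV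
    rw [Scheme.preimage_basicOpen, Y.mem_basicOpen _ _ hPV] at h3
    obtain ⟨w, hw⟩ := h3
    refine h2 ⟨↑w⁻¹, eq_inv_of_mul_eq_one_left ?_⟩
    rw [pullbackFunction_apply, ← Scheme.algebraMap_germ_eq_germToFunctionField (X := Y) hPV, ← hw,
      ← map_mul, Units.inv_mul, map_one]

end Pullback

end PolyDiv

namespace PolyDiv

/-! ## Algebraic properties of the rings of sections -/

section Valuations

/-- The trivial additive valuation of a field. -/
def trivialAddValuation (K : Type*) [Field K] : AddValuation K (WithTop ℚ) := by
  classical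
  exact AddValuation.of (fun x ↦ if x = 0 then ⊤ else 0) (by simp) (by simp)
    (fun x y ↦ by
      by_cases hx : x = 0
      · simp [hx]
      by_cases hy : y = 0
      · simp [hy]
      by_cases hxy : x + y = 0 <;> simp [hx, hy, hxy])
    (fun x y ↦ by
      by_cases hx : x = 0
      · simp [hx]
      by_cases hy : y = 0
      · simp [hy]
      simp [hx, hy])

theorem trivialAddValuation_apply {K : Type*} [Field K] {x : K} (hx : x ≠ 0) :
    trivialAddValuation K x = 0 := if_neg hx

variable {Y : Scheme.{0}} [Y.Over SpecC] [IsNonsingularCurve Y]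

/-- The order of vanishing of rational functions at a point, as an additive valuation. -/
def ordAddValuation (x : closedPoints Y) : AddValuation Y.functionField (WithTop ℚ) := by
  classical
  exact AddValuation.of (fun f ↦ if f = 0 then ⊤ else ((Scheme.ord f x.1 : ℚ) : WithTop ℚ))
    (by simp) (by simp [ord_one])
    (fun f g ↦ by
      by_cases hf : f = 0
      · simp [hf]
      by_cases hg : g = 0
      · simp [hg]
      by_cases hfg : f + g = 0
      · simp [hfg]
      simp only [hf, hg, hfg, if_false]
      have := Scheme.ord_add (x := x.1) hfg
      exact_mod_cast this)
    (fun f g ↦ by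
      by_cases hf : f = 0
      · simp [hf]
      by_cases hg : g = 0
      · simp [hg]
      simp only [hf, hg, mul_eq_zero, or_self, if_false]
      rw [Scheme.ord_mul hf hg]
      norm_cast)

theorem ordAddValuation_apply (x : closedPoints Y) {f : Y.functionField} (hf : f ≠ 0) :
    ordAddValuation x f = ((Scheme.ord f x.1 : ℚ) : WithTop ℚ) := if_neg hf

theorem genericPoint_notMem_closedPoints : genericPoint Y ∉ closedPoints Y := fun h ↦ by
  have := isDVR_curve Y ⟨_, h⟩
  exact IsDiscreteValuationRing.not_isField (Y.presheaf.stalk (genericPoint Y))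
    (Field.toIsField Y.functionField)

theorem ord_eq_zero_of_mem_basicOpen {V : Y.Opens} [Nonempty V] (h : Γ(Y, V)) {P : closedPoints Y}
    (hP : P.1 ∈ Y.basicOpen h) : Scheme.ord (Y.germToFunctionField V h) P.1 = 0 := by
  have hPV := Y.basicOpen_le h hP
  rw [Y.mem_basicOpen _ _ hPV] at hP
  obtain ⟨w, hw⟩ := hP
  rw [← Scheme.algebraMap_germ_eq_germToFunctionField (X := Y) hPV, ← hw]
  have h0 : algebraMap (Y.presheaf.stalk P.1) Y.functionField w ≠ 0 := (w.isUnit.map _).ne_zero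
  have h1 : (algebraMap (Y.presheaf.stalk P.1) Y.functionField w)⁻¹ =
      algebraMap (Y.presheaf.stalk P.1) Y.functionField ↑w⁻¹ :=
    inv_eq_of_mul_eq_one_right (by rw [← map_mul, Units.mul_inv, map_one])
  have h2 := (ord_nonneg_iff P h0).mpr ⟨_, rfl⟩
  have h3 := (ord_nonneg_iff P (inv_ne_zero h0)).mpr ⟨_, h1.symm⟩
  rw [ord_inv h0] at h3
  lia

theorem ord_pos_of_notMem_basicOpen {V : Y.Opens} [Nonempty V] {P : closedPoints Y} (hPV : P.1 ∈ V)
    (h : Γ(Y, V)) (h0 : Y.germToFunctionField V h ≠ 0) (hP : P.1 ∉ Y.basicOpen h) :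
    0 < Scheme.ord (Y.germToFunctionField V h) P.1 := by
  by_contra hle
  refine hP ((Y.mem_basicOpen _ _ hPV).mpr ?_)
  obtain ⟨a, ha⟩ := (ord_nonneg_iff P (inv_ne_zero h0)).mp (by rw [ord_inv h0]; lia)
  refine IsUnit.of_mul_eq_one a
    (IsFractionRing.injective (Y.presheaf.stalk P.1) Y.functionField ?_)
  rw [map_mul, ha, Scheme.algebraMap_germ_eq_germToFunctionField, mul_inv_cancel₀ h0, map_one]

end Valuations

theorem uniqueSums_of_free (M : Type*) [AddCommGroup M] [Module.Free ℤ M] : TwoUniqueSums M :=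
  (Module.Free.chooseBasis ℤ M).repr.toAddEquiv.twoUniqueSums_iff.mpr inferInstance

namespace PolyhedralDivisor

variable {M : Type} [AddCommGroup M] {Y : Scheme.{0}} {σ : PointedCone ℚ (NQ M)}
  (D : PolyhedralDivisor Y σ)

theorem IsTrivialOn.eval_eq_zero {D : PolyhedralDivisor Y σ} {U : Y.Opens}
    (h : D.IsTrivialOn U) {u : M} (hu : u ∈ weightMonoid σ) {P : closedPoints Y} (hP : P.1 ∈ U) :
    D.eval u P = 0 := by
  have h1 := (D.isPolyhedron P).isLeast hu
  rw [h P hP] at h1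
  have h2 : IsLeast ((fun v : NQ M ↦ v u) '' (σ : Set (NQ M))) 0 :=
    ⟨⟨0, σ.zero_mem, rfl⟩, by rintro _ ⟨v, hv, rfl⟩; exact hu v hv⟩
  rw [eval, h P hP]
  exact h1.unique h2

variable [Y.Over SpecC] [IsNonsingularCurve Y]

/-- The trivial valuation with `v ∈ σ` detects whether the exponents lie in `ω`. For `u ∈ ω`, the
inequalities with `v ∈ Δ_P` together express the bound by `min ⟨u, Δ_P⟩`, because the minimum is
attained. Each condition is stable under integral dependence, which is the source of normality. -/
theorem mem_sections_iff_gaussMin {V : Y.Opens} {a : AddMonoidAlgebra Y.functionField M} :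
    a ∈ D.sections V ↔
      (∀ v ∈ σ, 0 ≤ gaussMin (trivialAddValuation Y.functionField) v.toAddMonoidHom a) ∧
      ∀ P : closedPoints Y, P.1 ∈ V → ∀ v ∈ D.coeff P,
        0 ≤ gaussMin (ordAddValuation P) v.toAddMonoidHom a := by
  simp only [le_gaussMin_iff]
  constructor
  · intro h
    refine ⟨fun v hv u ↦ ?_, fun P hP v hv u ↦ ?_⟩
    · by_cases hu : a.coeff u = 0
      · simp [hu]
      rw [trivialAddValuation_apply hu, zero_add]
      exact_mod_cast (h u hu).1 v hv
    · by_cases hu : a.coeff u = 0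
      · simp [hu]
      rw [ordAddValuation_apply _ hu]
      have h1 := (h u hu).2 hu P hP
      have h2 := ((D.isPolyhedron P).isLeast (h u hu).1).2 ⟨v, hv, rfl⟩
      have h3 : 0 ≤ (Scheme.ord (a.coeff u) P.1 : ℚ) + v u := by
        change minPairing u (D.coeff P) ≤ v u at h2
        rw [eval] at h1
        linarith
      exact_mod_cast h3
  · rintro ⟨h1, h2⟩ u hu
    have hω : u ∈ weightMonoid σ := fun v hv ↦ by
      have := h1 v hv u
      rw [trivialAddValuation_apply hu, zero_add] at this
      exact_mod_cast this
    refine ⟨hω, fun _ P hP ↦ ?_⟩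
    obtain ⟨v, hv, hv'⟩ := ((D.isPolyhedron P).isLeast hω).1
    have := h2 P hP v hv u
    rw [ordAddValuation_apply _ hu] at this
    rw [eval, ← hv']
    exact_mod_cast this

theorem mem_sections_of_isIntegral [Module.Free ℤ M] {V : Y.Opens}
    {a : AddMonoidAlgebra Y.functionField M} (ha : IsIntegral (D.sections V) a) :
    a ∈ D.sections V := by
  have := uniqueSums_of_free M
  rw [mem_sections_iff_gaussMin]
  exact ⟨fun v hv ↦ gaussMin_nonneg_of_isIntegral _ _
      (fun b hb ↦ (D.mem_sections_iff_gaussMin.mp hb).1 v hv) ha,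
    fun P hP v hv ↦ gaussMin_nonneg_of_isIntegral _ _
      (fun b hb ↦ (D.mem_sections_iff_gaussMin.mp hb).2 P hP v hv) ha⟩

/-- An integral fraction lies in `K[M]`, since `K[M]` is normal, and then in the ring of sections,
which is integrally closed in `K[M]`. -/
theorem isIntegrallyClosed_sections [Module.Free ℤ M] (V : Y.Opens) :
    IsIntegrallyClosed (D.sections V) := by
  have := uniqueSums_of_free M
  have : IsDomain (AddMonoidAlgebra Y.functionField M) := { }
  have := isIntegrallyClosed_addMonoidAlgebra Y.functionField M
  let L := FractionRing (AddMonoidAlgebra Y.functionField M)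
  have hinj : Function.Injective (algebraMap (D.sections V) L) :=
    (IsFractionRing.injective (AddMonoidAlgebra Y.functionField M) L).comp Subtype.val_injective
  have : FaithfulSMul (D.sections V) L := (faithfulSMul_iff_algebraMap_injective _ _).mpr hinj
  let ψ : FractionRing (D.sections V) →ₐ[D.sections V] L := IsFractionRing.liftAlgHom
    (g := Algebra.ofId (D.sections V) L) hinj
  refine (isIntegrallyClosed_iff (FractionRing (D.sections V))).mpr fun {x} hx ↦ ?_
  have h1 : IsIntegral (D.sections V) (ψ x) := hx.map ψ
  have h2 : IsIntegral (AddMonoidAlgebra Y.functionField M) (ψ x) := h1.tower_top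
  obtain ⟨y, hy⟩ := IsIntegrallyClosed.isIntegral_iff.mp h2
  have h3 : IsIntegral (D.sections V) y := by
    rw [← hy] at h1
    exact (isIntegral_algebraMap_iff
      (IsFractionRing.injective (AddMonoidAlgebra Y.functionField M) L)).mp h1
  refine ⟨⟨y, D.mem_sections_of_isIntegral h3⟩, ψ.toRingHom.injective ?_⟩
  exact (ψ.commutes _).trans hy

/-- If `𝒟(u)` is big, then a multiple has a section whose nonvanishing locus is affine and contains
no nontrivial point of `𝒟`. -/
theorem exists_section_vanishing {u : M} (hu : IsBig (D.eval u)) :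
    ∃ (U : Y.Opens) (_ : IsAffineOpen U) (_ : Nonempty U) (_ : D.IsTrivialOn U) (m : ℕ)
      (g : Y.functionField), 0 < m ∧ g ≠ 0 ∧
      (∀ P : closedPoints Y, P.1 ∉ U → 0 < (Scheme.ord g P.1 : ℚ) + m * D.eval u P) ∧
      ∀ P : closedPoints Y, P.1 ∈ U → (Scheme.ord g P.1 : ℚ) + m * D.eval u P = 0 := by
  obtain ⟨n, hn, f, hf0, hf, W, hWf, hW⟩ := hu
  -- The condition defining the nonvanishing locus is vacuous at a point that is not closed.
  have hgW : genericPoint Y ∈ W := by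
    rw [← SetLike.mem_coe, hWf]
    exact fun h ↦ absurd h genericPoint_notMem_closedPoints
  have hWn : Nonempty W := ⟨⟨_, hgW⟩⟩
  let G : Y.Opens := ⟨(Subtype.val '' {P : closedPoints Y | D.coeff P ≠ (σ : Set (NQ M))})ᶜ, by
    rw [isOpen_compl_iff, ← Set.biUnion_of_singleton (Subtype.val '' _)]
    refine (D.finite_nontrivial.image _).isClosed_biUnion ?_
    rintro _ ⟨P, -, rfl⟩
    exact mem_closedPoints_iff.mp P.2⟩
  have hgG : genericPoint Y ∈ G := by
    rintro ⟨P, -, hP⟩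
    exact genericPoint_notMem_closedPoints (hP ▸ P.2)
  -- `h` cuts the nontrivial points of `𝒟` out of the affine `W`. The section sought is `f ^ k * h`.
  obtain ⟨h, hhG, hgh⟩ := hW.exists_basicOpen_le ⟨genericPoint Y, hgG⟩ hgW
  have hUn : Nonempty (Y.basicOpen h) := ⟨⟨_, hgh⟩⟩
  have hh0 : Y.germToFunctionField W h ≠ 0 := by
    rw [Y.mem_basicOpen _ _ hgW] at hgh
    exact hgh.ne_zero
  have hfin : {P : closedPoints Y | P.1 ∉ W}.Finite :=
    (finite_compl hgW).preimage Subtype.val_injective.injOn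
  have hfW (P : closedPoints Y) (hP : P.1 ∈ W) : (Scheme.ord f P.1 : ℚ) + n * D.eval u P = 0 := by
    rw [← SetLike.mem_coe, hWf] at hP
    simpa using hP P.2
  have hfW' (P : closedPoints Y) (hP : P.1 ∉ W) : 0 < (Scheme.ord f P.1 : ℚ) + n * D.eval u P := by
    have h1 := hf hf0 P trivial
    simp only [Pi.smul_apply, nsmul_eq_mul] at h1
    refine h1.lt_of_ne fun h2 ↦ hP ?_
    rw [← SetLike.mem_coe, hWf]
    intro hPc
    simpa using h2.symm
  -- Outside `W` the divisor `div f + n𝒟(u)` is strictly positive, so a large multiple outweighs the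
  -- poles of `h` at these finitely many points.
  have hev : ∀ᶠ k : ℕ in Filter.atTop, 0 < k ∧ ∀ P ∈ {P : closedPoints Y | P.1 ∉ W},
      0 < k * ((Scheme.ord f P.1 : ℚ) + n * D.eval u P) +
        Scheme.ord (Y.germToFunctionField W h) P.1 := by
    refine (Filter.eventually_gt_atTop 0).and ((Filter.eventually_all_finite hfin).mpr fun P hP ↦ ?_)
    obtain ⟨k₀, hk₀⟩ := exists_nat_gt (-(Scheme.ord (Y.germToFunctionField W h) P.1 : ℚ) /
      ((Scheme.ord f P.1 : ℚ) + n * D.eval u P))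
    rw [div_lt_iff₀ (hfW' P hP)] at hk₀
    filter_upwards [Filter.eventually_ge_atTop k₀] with k hk
    have : (k₀ : ℚ) * ((Scheme.ord f P.1 : ℚ) + n * D.eval u P) ≤
        k * ((Scheme.ord f P.1 : ℚ) + n * D.eval u P) :=
      mul_le_mul_of_nonneg_right (by exact_mod_cast hk) (hfW' P hP).le
    linarith
  obtain ⟨k, hk, hkP⟩ := hev.exists
  have hord (P : closedPoints Y) :
      (Scheme.ord (f ^ k * Y.germToFunctionField W h) P.1 : ℚ) + (k * n : ℕ) * D.eval u P =
        k * ((Scheme.ord f P.1 : ℚ) + n * D.eval u P) +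
          Scheme.ord (Y.germToFunctionField W h) P.1 := by
    rw [Scheme.ord_mul (pow_ne_zero _ hf0) hh0, ord_pow hf0]
    push_cast
    ring
  refine ⟨Y.basicOpen h, hW.basicOpen h, hUn, fun P hP ↦ ?_, k * n,
    f ^ k * Y.germToFunctionField W h, Nat.mul_pos hk hn, mul_ne_zero (pow_ne_zero _ hf0) hh0,
    fun P hP ↦ ?_, fun P hP ↦ ?_⟩
  · by_contra hne
    exact hhG hP ⟨P, hne, rfl⟩
  · rw [hord]
    by_cases hPW : P.1 ∈ W
    · rw [hfW P hPW, mul_zero, zero_add]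
      exact_mod_cast ord_pos_of_notMem_basicOpen hPW h hh0 hP
    · exact hkP P hPW
  · rw [hord, hfW P (Y.basicOpen_le h hP), ord_eq_zero_of_mem_basicOpen h hP]
    simp

/-- `Γ(U, 𝒪_Y)[M]` arises from `Γ(Y, 𝒜)` by inverting one homogeneous section. Its weight `w` is a
multiple of an interior weight, so adding copies of `w` moves any exponent into `ω`. It is
invertible over `U`, and as a section of `𝒟(w)` it vanishes at every point outside `U`, so its
powers absorb all poles there. -/
theorem exists_section_localizing [Module.Free ℤ M] [Module.Finite ℤ M] (hσ : σ.FG)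
    (hσ' : (σ : ConvexCone ℚ (NQ M)).Salient)
    (hD : ∀ u ∈ interiorWeights σ, IsBig (D.eval u)) :
    ∃ (U : Y.Opens) (_ : IsAffineOpen U) (_ : Nonempty U) (_ : D.IsTrivialOn U) (w : M)
      (g : Y.functionField), g ≠ 0 ∧ AddMonoidAlgebra.single w g ∈ D.sections ⊤ ∧
      AddMonoidAlgebra.single (-w) g⁻¹ ∈ torusSections M U ∧
      ∀ b ∈ torusSections M U, ∃ N : ℕ, AddMonoidAlgebra.single w g ^ N * b ∈ D.sections ⊤ := by
  classical
  obtain ⟨u, hu, hu'⟩ := exists_interior hσ hσ'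
  obtain ⟨U, hU, hUn, hT, m, g, hm, hg0, hpos, hzero⟩ := D.exists_section_vanishing (hD u hu)
  have hmu : m • u ∈ weightMonoid σ := nsmul_mem hu.1 m
  have hUm (P : closedPoints Y) (hP : P.1 ∈ U) : Scheme.ord g P.1 = 0 := by
    have h1 := hzero P hP
    rw [hT.eval_eq_zero hu.1 hP, mul_zero, add_zero] at h1
    exact_mod_cast h1
  have hpos' (P : closedPoints Y) (hP : P.1 ∉ U) :
      0 < (Scheme.ord g P.1 : ℚ) + D.eval (m • u) P := by
    have := hpos P hP
    have := D.nsmul_eval_le hu.1 m P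
    linarith
  refine ⟨U, hU, hUn, hT, m • u, g, hg0, ?_, ?_, fun b hb ↦ ?_⟩
  · refine D.single_mem_sections hmu fun _ P _ ↦ ?_
    by_cases hP : P.1 ∈ U
    · rw [hUm P hP, hT.eval_eq_zero hmu hP]
      simp
    · exact (hpos' P hP).le
  · intro w hw
    rw [AddMonoidAlgebra.coeff_single, Finsupp.single_apply] at hw ⊢
    split_ifs at hw ⊢ with h
    · refine ⟨trivial, fun _ P hP ↦ ?_⟩
      rw [ord_inv hg0, hUm P hP]
      simp
    · exact absurd rfl hw
  have hfin : {P : closedPoints Y | P.1 ∉ U}.Finite :=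
    (finite_compl (genericPoint_mem (V := U))).preimage Subtype.val_injective.injOn
  have hw1 (w : M) : ∀ᶠ N : ℕ in Filter.atTop, N • m • u + w ∈ weightMonoid σ := by
    obtain ⟨n, hn⟩ := hu' w
    filter_upwards [Filter.eventually_ge_atTop n] with N hN
    rw [← mul_smul]
    exact hn _ (hN.trans (Nat.le_mul_of_pos_right N hm))
  -- By superadditivity, from some `N₀` on the left side grows at least linearly in `N`, with slope
  -- `ord g + 𝒟(m • u)`, which is positive at `P`.
  have hw2 (w : M) (P : closedPoints Y) (hP : P.1 ∉ U) : ∀ᶠ N : ℕ in Filter.atTop,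
      0 ≤ N * (Scheme.ord g P.1 : ℚ) + Scheme.ord (b.coeff w) P.1 + D.eval (N • m • u + w) P := by
    obtain ⟨N₀, hN₀⟩ := (hw1 w).exists
    obtain ⟨k, hk⟩ := exists_nat_ge (-(N₀ * (Scheme.ord g P.1 : ℚ) + Scheme.ord (b.coeff w) P.1 +
      D.eval (N₀ • m • u + w) P) / ((Scheme.ord g P.1 : ℚ) + D.eval (m • u) P))
    rw [div_le_iff₀ (hpos' P hP)] at hk
    filter_upwards [Filter.eventually_ge_atTop (k + N₀)] with N hN
    obtain ⟨l, rfl⟩ := Nat.exists_eq_add_of_le hN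
    have h1 := D.eval_add_le (nsmul_mem hmu (k + l)) hN₀ P
    have h2 := D.nsmul_eval_le hmu (k + l) P
    have h3 : (k + l) • m • u + (N₀ • m • u + w) = (k + N₀ + l) • m • u + w := by module
    rw [h3] at h1
    have h4 : 0 ≤ (l : ℚ) * ((Scheme.ord g P.1 : ℚ) + D.eval (m • u) P) :=
      mul_nonneg l.cast_nonneg (hpos' P hP).le
    push_cast at h2 ⊢
    linarith
  have hall : ∀ᶠ N : ℕ in Filter.atTop, ∀ w ∈ b.coeff.support, N • m • u + w ∈ weightMonoid σ ∧
      ∀ P ∈ {P : closedPoints Y | P.1 ∉ U}, 0 ≤ N * (Scheme.ord g P.1 : ℚ) +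
        Scheme.ord (b.coeff w) P.1 + D.eval (N • m • u + w) P := by
    refine (Filter.eventually_all_finset _).mpr fun w _ ↦ (hw1 w).and ?_
    exact (Filter.eventually_all_finite hfin).mpr fun P hP ↦ hw2 w P hP
  obtain ⟨N, hN⟩ := hall.exists
  refine ⟨N, ?_⟩
  rw [← AddMonoidAlgebra.sum_coeff_single b, Finsupp.sum, Finset.mul_sum]
  refine sum_mem fun w hw ↦ ?_
  have hw0 := Finsupp.mem_support_iff.mp hw
  rw [AddMonoidAlgebra.single_pow, AddMonoidAlgebra.single_mul_single]
  refine D.single_mem_sections (hN w hw).1 fun _ P _ ↦ ?_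
  rw [Scheme.ord_mul (pow_ne_zero _ hg0) hw0, ord_pow hg0]
  push_cast
  by_cases hP : P.1 ∈ U
  · rw [hUm P hP, hT.eval_eq_zero (hN w hw).1 hP]
    simpa using (hb w hw0).2 hw0 P hP
  · exact (hN w hw).2 P hP

end PolyhedralDivisor

end PolyDiv

namespace PolyDiv

/-! ## Charts of the relative spectrum -/

theorem isIntegral_of_isDominant {Z W : Scheme.{0}} (f : Z ⟶ W) [IsDominant f] [IsIntegral Z]
    [IsReduced W] : IsIntegral W := by
  have : IrreducibleSpace W := by
    have h1 : IsIrreducible (closure (Set.range f)) := by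
      rw [← Set.image_univ]
      exact ((IrreducibleSpace.isIrreducible_univ Z).image _ f.continuous.continuousOn).closure
    rw [f.denseRange.closure_range] at h1
    exact { toPreirreducibleSpace := ⟨h1.2⟩, toNonempty := Set.nonempty_iff_univ_nonempty.mpr h1.1 }
  exact isIntegral_of_irreducibleSpace_of_isReduced W

namespace PolyhedralDivisor

variable {M : Type} [AddCommGroup M] {Y : Scheme.{0}} {σ : PointedCone ℚ (NQ M)}
  [Y.Over SpecC] [IsNonsingularCurve Y] (D : PolyhedralDivisor Y σ)

/-- The inclusion `Γ(V, 𝒜) ⊆ K(Y)[M]` for nonempty `V`. -/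
def evalGeneric (V : Y.Opens) [Nonempty V] :
    D.sheafSections V →+* AddMonoidAlgebra Y.functionField M :=
  (Pi.evalRingHom (fun _ : V ↦ AddMonoidAlgebra Y.functionField M)
    ⟨genericPoint Y, genericPoint_mem⟩).comp (D.sheafSections V).subtype

theorem evalGeneric_injective (V : Y.Opens) [Nonempty V] :
    Function.Injective (D.evalGeneric V) := by
  rintro ⟨_, a, ha, rfl⟩ ⟨_, b, hb, rfl⟩ hab
  have h1 : a = b := hab
  subst h1
  rfl

theorem range_evalGeneric (V : Y.Opens) [Nonempty V] :
    (D.evalGeneric V).range = D.sections V := by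
  ext a
  constructor
  · rintro ⟨⟨_, a, ha, rfl⟩, rfl⟩
    exact ha
  · intro ha
    exact ⟨⟨_, a, ha, rfl⟩, rfl⟩

theorem evalGeneric_res {V W : Y.Opens} [Nonempty V] [Nonempty W] (h : V ≤ W)
    (a : D.sheafSections W) : D.evalGeneric V (D.res h a) = D.evalGeneric W a := rfl

theorem evalGeneric_structureMap (V : Y.Opens) [Nonempty V] (f : Γ(Y, V)) :
    D.evalGeneric V (D.structureMap V f) =
      AddMonoidAlgebra.single 0 (Y.germToFunctionField V f) := by
  rw [← Scheme.algebraMap_germ_eq_germToFunctionField (X := Y) genericPoint_mem]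
  rfl

/-- The ring `Γ(V, 𝒜)` for nonempty `V` as a subring of `K(Y)[M]`. -/
def sectionsEquiv (V : Y.Opens) [Nonempty V] : D.sheafSections V ≃+* D.sections V :=
  RingEquiv.ofBijective ((D.evalGeneric V).codRestrict (D.sections V) fun a ↦
      (D.range_evalGeneric V).le ⟨a, rfl⟩)
    ⟨fun _ _ h ↦ D.evalGeneric_injective V congr(($h).1), fun a ↦ by
      obtain ⟨b, hb⟩ := (D.range_evalGeneric V).ge a.2
      exact ⟨b, Subtype.ext hb⟩⟩

theorem isDomain_sheafSections [Module.Free ℤ M] (V : Y.Opens) [Nonempty V] :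
    IsDomain (D.sheafSections V) := by
  have := uniqueSums_of_free M
  have : IsDomain (AddMonoidAlgebra Y.functionField M) := { }
  exact (D.evalGeneric_injective V).isDomain _

theorem isIntegrallyClosed_sheafSections [Module.Free ℤ M] (V : Y.Opens) [Nonempty V] :
    IsIntegrallyClosed (D.sheafSections V) :=
  have := D.isIntegrallyClosed_sections V
  IsIntegrallyClosed.of_equiv (D.sectionsEquiv V).symm

/-- The open subscheme `Spec Γ(V, 𝒜)` of `X̃`. -/
def chart {V : Y.Opens} (hV : IsAffineOpen V) :
    Spec (CommRingCat.of (D.sheafSections V)) ⟶ D.Xtilde :=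
  colimit.ι D.glueData.functor ⟨V, hV⟩

instance {V : Y.Opens} (hV : IsAffineOpen V) : IsOpenImmersion (D.chart hV) :=
  D.glueData.cover.map_prop ⟨V, hV⟩

theorem chart_contraction {V : Y.Opens} (hV : IsAffineOpen V) :
    D.chart hV ≫ D.contraction = Spec.map (CommRingCat.ofHom (D.res le_top)) :=
  colimit.ι_desc _ _

theorem chart_π {V : Y.Opens} (hV : IsAffineOpen V) :
    D.chart hV ≫ D.π = Spec.map (CommRingCat.ofHom (D.structureMap V)) ≫ hV.fromSpec :=
  (D.glueData.ι_toBase ⟨V, hV⟩).trans (by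
    change (Spec.map (CommRingCat.ofHom (D.structureMap V)) ≫ hV.isoSpec.inv) ≫ V.ι = _
    rw [Category.assoc]
    rfl)

theorem opensRange_chart {V : Y.Opens} (hV : IsAffineOpen V) :
    (D.chart hV).opensRange = D.π ⁻¹ᵁ V := by
  have h1 := D.glueData.toBase_preimage_eq_opensRange_ι ⟨V, hV⟩
  refine h1.symm.trans ?_
  change D.π ⁻¹ᵁ V.ι.opensRange = _
  rw [Scheme.Opens.opensRange_ι]

theorem map_chart {V : Y.Opens} (hV : IsAffineOpen V) (f : Γ(Y, V)) :
    Spec.map (CommRingCat.ofHom (D.res (Y.basicOpen_le f))) ≫ D.chart hV =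
      D.chart (hV.basicOpen f) :=
  colimit.w D.glueData.functor (homOfLE (Scheme.AffineZariskiSite.basicOpen_le ⟨V, hV⟩ f))

/-- The morphism `Spec K(Y)[M] ⟶ Spec Γ(V, 𝒜) ⊆ X̃`. -/
def fromTorus {V : Y.Opens} (hV : IsAffineOpen V) [Nonempty V] :
    Spec (CommRingCat.of (AddMonoidAlgebra Y.functionField M)) ⟶ D.Xtilde :=
  Spec.map (CommRingCat.ofHom (D.evalGeneric V)) ≫ D.chart hV

theorem fromTorus_basicOpen {V : Y.Opens} (hV : IsAffineOpen V) [Nonempty V] (f : Γ(Y, V))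
    [Nonempty (Y.basicOpen f)] : D.fromTorus (hV.basicOpen f) = D.fromTorus hV := by
  rw [fromTorus, fromTorus, ← D.map_chart hV f, ← Spec.map_comp_assoc]
  rfl

/-- Two charts share a common basic open neighborhood of the generic point, so the generic torus in
`X̃` does not depend on the chart. -/
theorem fromTorus_eq {V W : Y.Opens} (hV : IsAffineOpen V) (hW : IsAffineOpen W) [Nonempty V]
    [Nonempty W] : D.fromTorus hV = D.fromTorus hW := by
  obtain ⟨f, g, h, hf⟩ := exists_basicOpen_le_affine_inter hV hW (genericPoint Y)
    ⟨genericPoint_mem, genericPoint_mem⟩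
  have h1 : Nonempty (Y.basicOpen f) := ⟨⟨_, hf⟩⟩
  have h2 : Nonempty (Y.basicOpen g) := ⟨⟨_, h ▸ hf⟩⟩
  rw [← D.fromTorus_basicOpen hV f, ← D.fromTorus_basicOpen hW g]
  congr 1

theorem exists_mem_range_chart (x : D.Xtilde) : ∃ (V : Y.Opens) (hV : IsAffineOpen V) 
    (_ : Nonempty V), x ∈ Set.range (D.chart hV) := by
  obtain ⟨V, hV, hxV, -⟩ := exists_isAffineOpen_mem_and_subset (U := ⊤) (x := D.π x) trivial
  refine ⟨V, hV, ⟨⟨_, hxV⟩⟩, ?_⟩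
  change x ∈ (D.chart hV).opensRange
  rw [opensRange_chart]
  exact hxV

variable [Module.Free ℤ M]

/-- Density can be tested in each chart, where `Γ(W, 𝒜)` is a subring of `K[M]`. -/
instance isDominant_fromTorus {V : Y.Opens} (hV : IsAffineOpen V) [Nonempty V] :
    IsDominant (D.fromTorus hV) := by
  refine ⟨fun x ↦ mem_closure_iff.mpr fun O hO hxO ↦ ?_⟩
  obtain ⟨W, hW, hWn, y, rfl⟩ := D.exists_mem_range_chart x
  have h1 : IsDominant (Spec.map (CommRingCat.ofHom (D.evalGeneric W))) :=
    isDominant_specMap _ (D.evalGeneric_injective W)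
  obtain ⟨_, hz, z, rfl⟩ := mem_closure_iff.mp (h1.denseRange y) _
    (hO.preimage (D.chart hW).continuous) hxO
  refine ⟨D.fromTorus hV z, ?_, z, rfl⟩
  rw [D.fromTorus_eq hV hW]
  exact hz

instance isReduced_Xtilde : IsReduced D.Xtilde := by
  have (V : D.glueData.cover.I₀) : IsReduced (D.glueData.cover.X V) := by
    have h : _root_.IsReduced (D.sheafSections V.1) := by
      have := uniqueSums_of_free M
      have : IsDomain (AddMonoidAlgebra Y.functionField M) := { }
      have : _root_.IsReduced (V.1 → AddMonoidAlgebra Y.functionField M) := inferInstance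
      exact isReduced_of_injective (D.sheafSections V.1).subtype Subtype.val_injective
    exact inferInstanceAs (IsReduced (Spec (CommRingCat.of (D.sheafSections V.1))))
  exact IsReduced.of_openCover _ D.glueData.cover

instance isIntegral_Xtilde : IsIntegral D.Xtilde := by
  have := uniqueSums_of_free M
  have : IsDomain (AddMonoidAlgebra Y.functionField M) := { }
  obtain ⟨V, hV, hxV, -⟩ := exists_isAffineOpen_mem_and_subset (U := ⊤) (x := genericPoint Y) trivial
  have : Nonempty V := ⟨⟨_, hxV⟩⟩
  exact isIntegral_of_isDominant (D.fromTorus hV)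

end PolyhedralDivisor

end PolyDiv

namespace PolyDiv

/-! ## The rational quotient map -/

instance nonempty_top (Y : Scheme.{0}) [Y.Over SpecC] [IsNonsingularCurve Y] :
    Nonempty (⊤ : Y.Opens) := ⟨⟨genericPoint Y, trivial⟩⟩

/-- Two partial maps from a reduced scheme to a separated scheme represent the same rational map if
they agree on the image of a dominant morphism. -/
theorem toRationalMap_eq_of_isDominant {X C Z : Scheme.{0}} [IsReduced X] [C.IsSeparated]
    {f f' : X.PartialMap C} (ε : Z ⟶ X) [IsDominant ε] {k : Z ⟶ f.domain} {k' : Z ⟶ f'.domain}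
    (hk : k ≫ f.domain.ι = ε) (hk' : k' ≫ f'.domain.ι = ε) (h : k ≫ f.hom = k' ≫ f'.hom) :
    f.toRationalMap = f'.toRationalMap := by
  have hW : Dense ((f.domain ⊓ f'.domain : X.Opens) : Set X) :=
    f.dense_domain.inter_of_isOpen_left f'.dense_domain f.domain.2
  have hr : Set.range ε ⊆ Set.range (f.domain ⊓ f'.domain).ι := by
    rw [Scheme.Opens.range_ι]
    rintro _ ⟨z, rfl⟩
    refine ⟨?_, ?_⟩
    · rw [← hk]; exact (k z).2
    · rw [← hk']; exact (k' z).2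
  let l := IsOpenImmersion.lift (f.domain ⊓ f'.domain).ι ε hr
  have hl : l ≫ (f.domain ⊓ f'.domain).ι = ε := IsOpenImmersion.lift_fac _ _ _
  have hl1 : l ≫ X.homOfLE inf_le_left = k := by
    rw [← cancel_mono f.domain.ι, Category.assoc, Scheme.homOfLE_ι, hl, hk]
  have hl2 : l ≫ X.homOfLE inf_le_right = k' := by
    rw [← cancel_mono f'.domain.ι, Category.assoc, Scheme.homOfLE_ι, hl, hk']
  have : IsDominant l := by
    refine ⟨fun x ↦ mem_closure_iff.mpr fun O hO hxO ↦ ?_⟩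
    obtain ⟨_, ⟨y, hy, hyz⟩, z, rfl⟩ := mem_closure_iff.mp (ε.denseRange x.1) _
      ((f.domain ⊓ f'.domain).ι.isOpenEmbedding.isOpenMap _ hO) ⟨x, hxO, rfl⟩
    refine ⟨l z, ?_, z, rfl⟩
    have : l z = y := (f.domain ⊓ f'.domain).ι.isOpenEmbedding.injective (by
      rw [hyz, ← hl]; rfl)
    rwa [this]
  -- The common domain is reduced and dominated by `l`, and `C` is separated.
  have key : X.homOfLE inf_le_left ≫ f.hom =
      X.homOfLE (inf_le_right : f.domain ⊓ f'.domain ≤ _) ≫ f'.hom :=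
    ext_of_isDominant (ι := l) (by rw [reassoc_of% hl1, reassoc_of% hl2, h])
  exact Scheme.PartialMap.toRationalMap_eq_iff.mpr ⟨f.domain ⊓ f'.domain, hW, inf_le_left,
    inf_le_right, key⟩

section

variable {M : Type} [AddCommGroup M] {Y : Scheme.{0}} [Y.Over SpecC] [IsNonsingularCurve Y]

variable (M Y) in
/-- The projection of the generic torus to the generic point of `Y`. -/
def genericProj : Spec (CommRingCat.of (AddMonoidAlgebra Y.functionField M)) ⟶ Y :=
  Spec.map (CommRingCat.ofHom (AddMonoidAlgebra.singleZeroRingHom (R := Y.functionField) (M := M)))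
    ≫ Y.fromSpecStalk (genericPoint Y)

variable (M) in
theorem genericProj_eq {U : Y.Opens} (hU : IsAffineOpen U) [Nonempty U] :
    Spec.map (CommRingCat.ofHom (torusSections M U).subtype) ≫ torusProj M hU =
      genericProj M Y := by
  rw [genericProj, torusProj, ← hU.fromSpecStalk_eq_fromSpecStalk genericPoint_mem,
    IsAffineOpen.fromSpecStalk]
  erw [← Spec.map_comp_assoc, ← Spec.map_comp_assoc]
  rfl

end

namespace PolyhedralDivisor

variable {M : Type} [AddCommGroup M] {Y : Scheme.{0}} {σ : PointedCone ℚ (NQ M)}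
  [Y.Over SpecC] [IsNonsingularCurve Y] (D : PolyhedralDivisor Y σ)

/-- The morphism `Spec K(Y)[M] ⟶ X`. -/
def toX : Spec (CommRingCat.of (AddMonoidAlgebra Y.functionField M)) ⟶ D.X :=
  Spec.map (CommRingCat.ofHom (D.evalGeneric ⊤))

instance : IsDominant D.toX := isDominant_specMap _ (D.evalGeneric_injective ⊤)

theorem fromTorus_contraction {V : Y.Opens} (hV : IsAffineOpen V) [Nonempty V] :
    D.fromTorus hV ≫ D.contraction = D.toX := by
  rw [fromTorus, Category.assoc, chart_contraction]
  exact (Spec.map_comp _ _).symm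

theorem fromTorus_π {V : Y.Opens} (hV : IsAffineOpen V) [Nonempty V] :
    D.fromTorus hV ≫ D.π = genericProj M Y := by
  rw [fromTorus, Category.assoc, chart_π, genericProj,
    ← hV.fromSpecStalk_eq_fromSpecStalk genericPoint_mem, IsAffineOpen.fromSpecStalk,
    ← Spec.map_comp_assoc, ← Spec.map_comp_assoc]
  congr 2
  exact CommRingCat.hom_ext (RingHom.ext (D.evalGeneric_structureMap V))

theorem torusToX_eq {U : Y.Opens} (h : D.IsTrivialOn U) :
    Spec.map (CommRingCat.ofHom (torusSections M U).subtype) ≫ D.torusToX h = D.toX := by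
  exact (Spec.map_comp _ _).symm

/-- A morphism from an affine scheme to `X` and a morphism to an affine open of `Y` are compatible
over `ℂ` if they are compatible with the inclusion `Γ(Y, 𝒪_Y) ⊆ Γ(Y, 𝒜)`. -/
theorem specMap_over {R : CommRingCat.{0}} {U : Y.Opens} (hU : IsAffineOpen U) (α : Γ(Y, U) ⟶ R)
    (β : CommRingCat.of (D.sheafSections ⊤) ⟶ R)
    (h : ∀ x : Γ(Y, ⊤), α (Y.presheaf.map (homOfLE (le_top : U ≤ ⊤)).op x) =
      β (D.structureMap ⊤ x)) :
    (Spec.map α ≫ hU.fromSpec) ≫ (Y ↘ SpecC) = (show _ ⟶ D.X from Spec.map β) ≫ (D.X ↘ SpecC) := by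
  have h1 := IsAffineOpen.SpecMap_appLE_fromSpec (Y ↘ SpecC) (isAffineOpen_top _) hU le_top
  rw [IsAffineOpen.fromSpec_top, Scheme.isoSpec_Spec_inv, ← Spec.map_comp] at h1
  rw [Category.assoc, ← h1]
  refine (Spec.map_comp _ _).symm.trans (Eq.trans ?_ (Spec.map_comp _ _))
  exact congrArg Spec.map (CommRingCat.hom_ext (RingHom.ext fun c ↦
    h ((Y ↘ SpecC).app ⊤ ((Scheme.ΓSpecIso (CommRingCat.of ℂ)).inv c))))

theorem torusToX_over {U : Y.Opens} (hU : IsAffineOpen U) [Nonempty U] (h : D.IsTrivialOn U) :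
    torusProj M hU ≫ (Y ↘ SpecC) = D.torusToX h ≫ (D.X ↘ SpecC) := by
  refine D.specMap_over hU (CommRingCat.ofHom (toTorusSections M U)) _ fun x ↦ Subtype.ext ?_
  change AddMonoidAlgebra.single (0 : M) (Y.germToFunctionField U
    (Y.presheaf.map (homOfLE (le_top : U ≤ ⊤)).op x)) = D.evalGeneric ⊤ (D.structureMap ⊤ x)
  rw [evalGeneric_structureMap, germToFunctionField_map]

theorem chart_over {U : Y.Opens} (hU : IsAffineOpen U) :
    D.chart hU ≫ D.π ≫ (Y ↘ SpecC) = D.chart hU ≫ D.contraction ≫ (D.X ↘ SpecC) := by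
  rw [← Category.assoc, ← Category.assoc, chart_π, chart_contraction]
  exact D.specMap_over hU _ _ fun x ↦
    congr($(D.structureHom.naturality (homOfLE (le_top : U ≤ ⊤)).op).hom x)

/-- `Γ(U, 𝒪_Y)[M]` is the localization of `Γ(Y, 𝒜)` at `g χ^w`, so the morphism is the inclusion of
a principal open subset. No relations need to be killed, as both rings lie in `K[M]`. -/
theorem isOpenImmersion_torusToX {U : Y.Opens} (hT : D.IsTrivialOn U) {w : M}
    {g : Y.functionField} (hg0 : g ≠ 0) (hg : AddMonoidAlgebra.single w g ∈ D.sections ⊤)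
    (hg' : AddMonoidAlgebra.single (-w) g⁻¹ ∈ torusSections M U)
    (h : ∀ b ∈ torusSections M U, ∃ N : ℕ, AddMonoidAlgebra.single w g ^ N * b ∈ D.sections ⊤) :
    IsOpenImmersion (D.torusToX hT) := by
  let ρ : D.sheafSections ⊤ →+* torusSections M U := (Pi.evalRingHom
    (fun _ : (⊤ : Y.Opens) ↦ AddMonoidAlgebra Y.functionField M) ⟨genericPoint Y, trivial⟩).restrict
      (D.sheafSections ⊤) (torusSections M U) (by
        rintro _ ⟨a, ha, rfl⟩
        exact hT.mem_torusSections ha)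
  let _ : Algebra (D.sheafSections ⊤) (torusSections M U) := ρ.toAlgebra
  have hρ : Function.Injective ρ := fun a b hab ↦ D.evalGeneric_injective ⊤ congr(($hab).1)
  have : IsLocalization.Away (⟨_, _, hg, rfl⟩ : D.sheafSections ⊤) (torusSections M U) := by
    refine IsLocalization.Away.mk _ ?_ ?_ ?_
    · refine IsUnit.of_mul_eq_one ⟨_, hg'⟩ (Subtype.ext ?_)
      change AddMonoidAlgebra.single w g * AddMonoidAlgebra.single (-w) g⁻¹ = 1
      rw [AddMonoidAlgebra.single_mul_single, add_neg_cancel, mul_inv_cancel₀ hg0]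
      rfl
    · rintro ⟨b, hb⟩
      obtain ⟨N, hN⟩ := h b hb
      refine ⟨N, ⟨_, _, hN, rfl⟩, Subtype.ext ?_⟩
      change b * AddMonoidAlgebra.single w g ^ N = AddMonoidAlgebra.single w g ^ N * b
      rw [mul_comm]
    · intro a b hab
      exact ⟨0, by rw [hρ hab]⟩
  exact IsOpenImmersion.of_isLocalization (⟨_, _, hg, rfl⟩ : D.sheafSections ⊤)

variable {D} in
/-- A rational quotient map restricts to the projection on the generic torus. -/
theorem IsRationalQuotientMap.exists_lift {C : Scheme.{0}} {j : Y ⟶ C} {p : D.X ⤏ C}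
    (hp : D.IsRationalQuotientMap j p) :
    ∃ f : D.X.PartialMap C, f.toRationalMap = p ∧
      ∃ k : Spec (CommRingCat.of (AddMonoidAlgebra Y.functionField M)) ⟶ f.domain,
        k ≫ f.domain.ι = D.toX ∧ k ≫ f.hom = genericProj M Y ≫ j := by
  obtain ⟨U, hU, hUn, hT, -, f, rfl, g, hg, hg'⟩ := hp
  refine ⟨f, rfl, Spec.map (CommRingCat.ofHom (torusSections M U).subtype) ≫ g, ?_, ?_⟩
  · rw [← D.torusToX_eq hT, ← hg]
    exact Category.assoc _ _ _
  · rw [← genericProj_eq M hU]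
    exact (Category.assoc _ _ _).trans
      ((congrArg (Spec.map _ ≫ ·) hg').trans (Category.assoc _ _ _).symm)

variable [Module.Free ℤ M]

/-- The graph is formed over the full domain of definition of `p`, so the lift found for one
representative is extended to it. -/
theorem IsRationalQuotientMap.exists_lift_toPartialMap {D : PolyhedralDivisor Y σ} {C : Scheme.{0}}
    [C.IsSeparated] {j : Y ⟶ C} {p : D.X ⤏ C} (hp : D.IsRationalQuotientMap j p) :
    ∃ k : Spec (CommRingCat.of (AddMonoidAlgebra Y.functionField M)) ⟶ p.toPartialMap.domain,
        k ≫ p.toPartialMap.domain.ι = D.toX ∧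
        k ≫ p.toPartialMap.hom = genericProj M Y ≫ j := by
  obtain ⟨f, rfl, k, hk, hk'⟩ := hp.exists_lift
  refine ⟨k ≫ D.X.homOfLE f.le_domain_toRationalMap, ?_, ?_⟩
  · rw [Category.assoc]
    exact (congrArg (k ≫ ·) (Scheme.homOfLE_ι _ _)).trans hk
  · rw [← hk', Category.assoc]
    exact congrArg (k ≫ ·) f.toPartialMap_toRationalMap_restrict

/-- On `Spec K(Y)[M]`, which dominates `X`, both maps are the projection to the generic point of
`Y`. -/
theorem IsRationalQuotientMap.unique {D : PolyhedralDivisor Y σ} {C : Scheme.{0}} [C.IsSeparated]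
    {j : Y ⟶ C} {p p' : D.X ⤏ C} (hp : D.IsRationalQuotientMap j p)
    (hp' : D.IsRationalQuotientMap j p') : p = p' := by
  obtain ⟨f, rfl, k, hk, hkf⟩ := hp.exists_lift
  obtain ⟨f', rfl, k', hk', hkf'⟩ := hp'.exists_lift
  exact toRationalMap_eq_of_isDominant D.toX hk hk' (hkf.trans hkf'.symm)

/-- The map is the projection on the open subscheme `U × T`, which is dense because `X` is
irreducible. -/
theorem exists_isRationalQuotientMap [Module.Finite ℤ M] (hσ : σ.FG)
    (hσ' : (σ : ConvexCone ℚ (NQ M)).Salient)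
    (hD : ∀ u ∈ interiorWeights σ, IsBig (D.eval u)) {C : Scheme.{0}} [C.Over SpecC] (j : Y ⟶ C)
    [j.IsOver SpecC] : ∃ p : D.X ⤏ C, p.IsOver SpecC ∧ D.IsRationalQuotientMap j p := by
  obtain ⟨U, hU, hUn, hT, w, g, hg0, hg, hg', h⟩ := D.exists_section_localizing hσ hσ' hD
  have hτ := D.isOpenImmersion_torusToX hT hg0 hg hg' h
  have hne : (Set.range (D.torusToX hT)).Nonempty := by
    have := uniqueSums_of_free M
    have : IsDomain (AddMonoidAlgebra Y.functionField M) := { }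
    have z : Spec (CommRingCat.of (AddMonoidAlgebra Y.functionField M)) := genericPoint _
    exact ⟨_, Spec.map (CommRingCat.ofHom (torusSections M U).subtype) z, rfl⟩
  let f : D.X.PartialMap C :=
    { domain := (D.torusToX hT).opensRange
      dense_domain := (D.torusToX hT).opensRange.2.dense hne
      hom := (D.torusToX hT).isoOpensRange.inv ≫ torusProj M hU ≫ j }
  have hf : f.IsOver SpecC := by
    refine ⟨?_⟩
    change ((D.torusToX hT).isoOpensRange.inv ≫ torusProj M hU ≫ j) ≫ (C ↘ SpecC) =
      (D.torusToX hT).opensRange.ι ≫ (D.X ↘ SpecC)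
    rw [Category.assoc, Category.assoc, comp_over, D.torusToX_over hU hT,
      Scheme.Hom.isoOpensRange_inv_comp_assoc]
  refine ⟨f.toRationalMap, inferInstance, U, hU, hUn, hT, hτ, f, rfl,
    (D.torusToX hT).isoOpensRange.hom, ?_, ?_⟩
  · exact Scheme.Hom.isoOpensRange_hom_ι _
  · exact Iso.hom_inv_id_assoc _ _

end PolyhedralDivisor

end PolyDiv

namespace PolyDiv

/-! ## The relative spectrum is integral over `X × C` -/

/-- A property that is local on the target can be checked on open immersions covering the target. -/
theorem of_forall_isPullback {P : MorphismProperty Scheme.{0}} [IsZariskiLocalAtTarget P]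
    {X Y : Scheme.{0}} (f : X ⟶ Y)
    (H : ∀ y : Y, ∃ (V U : Scheme.{0}) (i : V ⟶ Y) (c : U ⟶ X) (l : U ⟶ V) (_ : IsOpenImmersion i),
      y ∈ Set.range i ∧ IsPullback c l f i ∧ P l) : P f := by
  choose V U i c l hi hy hp hl using H
  refine IsZariskiLocalAtTarget.of_iSup_eq_top (fun y ↦ (i y).opensRange) ?_ fun y ↦ ?_
  · exact top_le_iff.mp fun y _ ↦ Opens.mem_iSup.mpr ⟨y, hy y⟩
  · refine (P.arrow_mk_iso_iff (morphismRestrictOpensRange f _)).mpr ?_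
    rw [← (hp y).isoPullback_inv_snd]
    exact (P.cancel_left_of_respectsIso _ _).mpr (hl y)

/-- Lets integrality be tested inside `K(Y)[M]`: the coefficients of an equation over the image of
`R` lift to `R`, and injectivity of `g` brings the equation back to `S`. -/
theorem isIntegralElem_of_isIntegral {R S T : Type*} [CommRing R] [CommRing S] [CommRing T]
    (f : R →+* S) (g : S →+* T) (hg : Function.Injective g) {s : S}
    (h : IsIntegral (g.comp f).range (g s)) : f.IsIntegralElem s := by
  obtain ⟨q, hq, hqs⟩ := h
  obtain ⟨q', hq', -, hq'm⟩ := Polynomial.lifts_and_natDegree_eq_and_monic (p := q)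
    (f := (g.comp f).rangeRestrict)
    ((Polynomial.lifts_iff_coeff_lifts q).mpr fun n ↦ (g.comp f).rangeRestrict_surjective _) hq
  refine ⟨q', hq'm, hg ?_⟩
  rw [← hq', Polynomial.eval₂_map] at hqs
  rw [map_zero, Polynomial.hom_eval₂]
  exact hqs

namespace PolyhedralDivisor

variable {M : Type} [AddCommGroup M] {Y : Scheme.{0}} {σ : PointedCone ℚ (NQ M)}
  [Y.Over SpecC] [IsNonsingularCurve Y] (D : PolyhedralDivisor Y σ)

/-- Transitivity of integrality, through the integral closure of `R` in `K(Y)[M]`. -/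
theorem isIntegral_of_contains (hD : ∀ u ∈ weightMonoid σ, IsSemiample (D.eval u))
    {V : Y.Opens} (hV : IsAffineOpen V) [Nonempty V]
    {R : Subring (AddMonoidAlgebra Y.functionField M)} (hR : D.sections ⊤ ≤ R)
    (hR' : ∀ g : Γ(Y, V), IsIntegral R (AddMonoidAlgebra.single (0 : M) (Y.germToFunctionField V g)))
    {a : AddMonoidAlgebra Y.functionField M} (ha : a ∈ D.sections V) : IsIntegral R a := by
  let R' := (integralClosure R (AddMonoidAlgebra Y.functionField M)).toSubring
  have h1 : IsIntegral R' a := D.isIntegral_of_mem_sections hD hV (R := R')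
    (fun b hb ↦ isIntegral_algebraMap (x := (⟨b, hR hb⟩ : R))) hR' ha
  exact isIntegral_trans (A := integralClosure R (AddMonoidAlgebra Y.functionField M)) a h1

theorem single_zero_mem_sections {b : Y.functionField}
    (hb : b ∈ divisorSections (Y := Y) 0 ⊤) : AddMonoidAlgebra.single (0 : M) b ∈ D.sections ⊤ :=
  D.single_mem_sections (zero_mem _) fun hb0 P hP ↦ by
    rw [D.eval_zero]
    exact hb hb0 P hP

variable [Module.Free ℤ M]

theorem contraction_over : D.contraction ≫ (D.X ↘ SpecC) = D.π ≫ (Y ↘ SpecC) := by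
  obtain ⟨V, hV, hxV, -⟩ := exists_isAffineOpen_mem_and_subset (U := ⊤) (x := genericPoint Y) trivial
  have : Nonempty V := ⟨⟨_, hxV⟩⟩
  refine ext_of_isDominant (ι := D.fromTorus hV) ?_
  rw [fromTorus, Category.assoc, Category.assoc, chart_over]

variable {C : Scheme.{0}} [C.Over SpecC] (j : Y ⟶ C) [j.IsOver SpecC]

/-- The morphism `X̃ ⟶ X × C`. -/
def toProduct : D.Xtilde ⟶ pullback (D.X ↘ SpecC) (C ↘ SpecC) :=
  pullback.lift D.contraction (D.π ≫ j) (by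
    rw [contraction_over, Category.assoc, comp_over j SpecC])

theorem toProduct_fst : D.toProduct j ≫ pullback.fst _ _ = D.contraction := pullback.lift_fst _ _ _

theorem toProduct_snd : D.toProduct j ≫ pullback.snd _ _ = D.π ≫ j := pullback.lift_snd _ _ _

/-- Integrality is local on `X × C`. Since `X` is affine, `X × V'` is affine for `V' ⊆ C` affine,
and its preimage is the chart `Spec Γ(V' ∩ Y, 𝒜)`. The image of its ring contains `Γ(Y, 𝒜)` and the
functions on `V'`. Taking `V'` as in `exists_affine_nhds_isIntegral`, the functions on `V' ∩ Y` are
integral over this image, and semiampleness does the rest. -/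
theorem isIntegralHom_toProduct [IsNonsingularCurve C] [IsOpenImmersion j]
    (hD : ∀ u ∈ weightMonoid σ, IsSemiample (D.eval u)) : IsIntegralHom (D.toProduct j) := by
  have : IsZariskiLocalAtTarget (@IsIntegralHom : MorphismProperty Scheme.{0}) :=
    (HasAffineProperty.iff.mp IsIntegralHom.hasAffineProperty).1
  refine of_forall_isPullback (P := @IsIntegralHom) _ fun z ↦ ?_
  obtain ⟨V', hc, hV', hV, hVn, hint⟩ :=
    exists_affine_nhds_isIntegral j (pullback.snd (D.X ↘ SpecC) (C ↘ SpecC) z)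
  let P := pullback (D.X ↘ SpecC) (C ↘ SpecC)
  have : IsAffineHom (D.X ↘ SpecC) := inferInstance
  have : IsAffineHom (pullback.snd (D.X ↘ SpecC) (C ↘ SpecC)) :=
    isAffineHom_isStableUnderBaseChange.of_isPullback
      (IsPullback.of_hasPullback (D.X ↘ SpecC) (C ↘ SpecC)) inferInstance
  let W : P.Opens := pullback.snd (D.X ↘ SpecC) (C ↘ SpecC) ⁻¹ᵁ V'
  have hW : IsAffineOpen W := hV'.preimage _
  have hrange : D.toProduct j ⁻¹ᵁ hW.fromSpec.opensRange = (D.chart hV).opensRange := by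
    rw [hW.opensRange_fromSpec, opensRange_chart, ← Scheme.Hom.comp_preimage,
      ← Scheme.Hom.comp_preimage, toProduct_snd]
  have hsub : Set.range (D.chart hV ≫ D.toProduct j) ⊆ Set.range hW.fromSpec := by
    rintro _ ⟨x, rfl⟩
    have : D.chart hV x ∈ (D.chart hV).opensRange := ⟨x, rfl⟩
    rw [← hrange] at this
    exact this
  let l := IsOpenImmersion.lift hW.fromSpec (D.chart hV ≫ D.toProduct j) hsub
  have hl : l ≫ hW.fromSpec = D.chart hV ≫ D.toProduct j := IsOpenImmersion.lift_fac _ _ _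
  refine ⟨_, _, hW.fromSpec, D.chart hV, l, inferInstance, ?_,
    (IsOpenImmersion.isPullback l (D.chart hV) hW.fromSpec (D.toProduct j) hl.symm hrange).flip, ?_⟩
  · rw [hW.range_fromSpec]
    exact hc
  obtain ⟨α, hα⟩ := Spec.map_surjective l
  rw [← hα] at hl ⊢
  rw [IsIntegralHom.SpecMap_iff]
  obtain ⟨μ, hμ⟩ := Spec.map_surjective (R := CommRingCat.of (D.sheafSections ⊤))
    (hW.fromSpec ≫ pullback.fst (D.X ↘ SpecC) (C ↘ SpecC))
  -- The first projection shows that `α` extends the restriction map from `Γ(Y, 𝒜)`; the second, in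
  -- `h2`, gives its values on functions pulled back from `V'`.
  have h1 : μ ≫ α = CommRingCat.ofHom (D.res le_top) := by
    refine Spec.map_injective ((Spec.map_comp _ _).trans ?_)
    rw [hμ]
    exact (Category.assoc _ _ _).symm.trans ((congrArg (· ≫ pullback.fst _ _) hl).trans
      ((Category.assoc _ _ _).trans
        ((congrArg (D.chart hV ≫ ·) (D.toProduct_fst j)).trans (D.chart_contraction hV))))
  have h2 : (pullback.snd (D.X ↘ SpecC) (C ↘ SpecC)).appLE V' W le_rfl ≫ α =
      j.app V' ≫ CommRingCat.ofHom (D.structureMap (j ⁻¹ᵁ V')) := by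
    refine Spec.map_injective ?_
    rw [← cancel_mono hV'.fromSpec, Spec.map_comp, Spec.map_comp, Category.assoc, Category.assoc,
      IsAffineOpen.SpecMap_appLE_fromSpec _ hV' hW le_rfl, Scheme.Hom.app_eq_appLE,
      IsAffineOpen.SpecMap_appLE_fromSpec _ hV' hV le_rfl, reassoc_of% hl, toProduct_snd,
      ← Category.assoc, ← Category.assoc, chart_π]
  intro a
  refine isIntegralElem_of_isIntegral α.hom (D.evalGeneric (j ⁻¹ᵁ V')) (D.evalGeneric_injective _) ?_
  set R := ((D.evalGeneric (j ⁻¹ᵁ V')).comp α.hom).range with hR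
  have hRY : D.sections ⊤ ≤ R := by
    rw [← range_evalGeneric]
    rintro _ ⟨b, rfl⟩
    refine ⟨μ b, ?_⟩
    have h3 : α (μ b) = D.res le_top b := congr($h1 b)
    change D.evalGeneric _ (α (μ b)) = _
    rw [h3, evalGeneric_res]
  refine D.isIntegral_of_contains hD hV hRY (fun g ↦ ?_) ((D.range_evalGeneric _).le ⟨a, rfl⟩)
  let s : Y.functionField →+* AddMonoidAlgebra Y.functionField M :=
    AddMonoidAlgebra.singleZeroRingHom
  have hRC (f : Γ(C, V')) : pullbackFunction j V' f ∈ R.comap s := by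
    refine ⟨(pullback.snd (D.X ↘ SpecC) (C ↘ SpecC)).appLE V' W le_rfl f, ?_⟩
    have h4 : α ((pullback.snd (D.X ↘ SpecC) (C ↘ SpecC)).appLE V' W le_rfl f) =
      D.structureMap (j ⁻¹ᵁ V') (j.app V' f) := congr($h2 f)
    change D.evalGeneric _ (α _) = _
    rw [h4, evalGeneric_structureMap]
    rfl
  -- The curve statement is applied to the degree-zero part of `R`, viewed as a subring of `K(Y)`.
  obtain ⟨q, hq, hq0⟩ := hint (R.comap s) hRC (fun b hb ↦ hRY (D.single_zero_mem_sections hb)) g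
  let s' : R.comap s →+* R := s.restrict _ _ fun _ h ↦ h
  refine ⟨q.map s', hq.map _, ?_⟩
  rw [Polynomial.eval₂_map]
  have h5 : s (Polynomial.eval₂ (algebraMap (R.comap s) Y.functionField)
    (Y.germToFunctionField _ g) q) = 0 := by rw [hq0, map_zero]
  rw [Polynomial.hom_eval₂] at h5
  exact h5

end PolyhedralDivisor

end PolyDiv

namespace PolyDiv

/-! ## Birational integral morphisms and normalization -/

/-- The base change of the closed immersion to `W` is a surjective closed immersion into a reduced
scheme, hence an isomorphism. -/
theorem exists_lift_vanishingIdeal {W P : Scheme.{0}} [IsReduced W] (g : W ⟶ P) (Z : Closeds P)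
    (h : Set.range g ⊆ Z) :
    ∃ f : W ⟶ (Scheme.IdealSheafData.vanishingIdeal Z).subscheme,
      f ≫ (Scheme.IdealSheafData.vanishingIdeal Z).subschemeι = g := by
  let ι := (Scheme.IdealSheafData.vanishingIdeal Z).subschemeι
  have : Surjective (pullback.fst g ι) := by
    refine ⟨fun w ↦ ?_⟩
    have hw : g w ∈ Set.range ι := by
      rw [Scheme.IdealSheafData.range_subschemeι, Scheme.IdealSheafData.coe_support_vanishingIdeal]
      exact h ⟨w, rfl⟩
    obtain ⟨z, hz⟩ := hw
    obtain ⟨t, ht, -⟩ := Scheme.Pullback.exists_preimage_pullback w z hz.symm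
    exact ⟨t, ht⟩
  have := isIso_of_isClosedImmersion_of_surjective (pullback.fst g ι)
  refine ⟨inv (pullback.fst g ι) ≫ pullback.snd g ι, ?_⟩
  rw [Category.assoc, ← pullback.condition, IsIso.inv_hom_id_assoc]

/-- A birational morphism has a section over the generic point. -/
theorem exists_section_genericPoint {W Z : Scheme.{0}} [IsIntegral W] [IsIntegral Z] (f : W ⟶ Z)
    (hf : f (genericPoint W) = genericPoint Z)
    (hs : Function.Surjective (f.stalkMap (genericPoint W))) :
    ∃ φ : Spec Z.functionField ⟶ Spec W.functionField, IsIso φ ∧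
      φ ≫ fromGenericPoint W ≫ f = fromGenericPoint Z := by
  -- Stated for a variable point, so that the stalk at the image of the generic point can be
  -- identified with the function field by substitution.
  have key (z : Z) (hz : z = genericPoint Z) (θ : Z.presheaf.stalk z ⟶ W.functionField)
      (hθ : Function.Surjective θ) (h : Spec.map θ ≫ Z.fromSpecStalk z = fromGenericPoint W ≫ f) :
      ∃ φ : Spec Z.functionField ⟶ Spec W.functionField, IsIso φ ∧
        φ ≫ fromGenericPoint W ≫ f = fromGenericPoint Z := by
    subst hz
    have : IsIso θ := (ConcreteCategory.isIso_iff_bijective θ).mpr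
      ⟨RingHom.injective (R := Z.functionField) (S := W.functionField) θ.hom, hθ⟩
    exact ⟨inv (Spec.map θ), inferInstance, by rw [← h, IsIso.inv_hom_id_assoc]⟩
  exact key _ hf _ hs (Scheme.SpecMap_stalkMap_fromSpecStalk f)

/-- Functions on the normalization over `U` are integral over those on `U` and embed into functions
on `T`. If the functions on `U` are integrally closed there, nothing new appears. -/
theorem isIso_normalizationDesc {T W Z : Scheme.{0}} (g : T ⟶ Z) [QuasiCompact g] [QuasiSeparated g]
    (f₁ : T ⟶ W) (f : W ⟶ Z) [IsIntegralHom f] (H : g = f₁ ≫ f)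
    (h : ∀ w : W, ∃ U : W.Opens, w ∈ U ∧ IsAffineOpen U ∧ Function.Injective (f₁.app U) ∧
      ∀ b, (f₁.app U).hom.IsIntegralElem b → b ∈ Set.range (f₁.app U)) :
    IsIso (g.normalizationDesc f₁ f H) := by
  let d := g.normalizationDesc f₁ f H
  change MorphismProperty.isomorphisms _ d
  refine IsZariskiLocalAtTarget.of_forall_exists_morphismRestrict (P := .isomorphisms _) fun w ↦ ?_
  obtain ⟨U, hwU, hU, hinj, hint⟩ := h w
  refine ⟨U, hwU, (isIso_morphismRestrict_iff_isIso_app d hU).mpr ?_⟩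
  have hd : g.toNormalization ≫ d = f₁ := g.toNormalization_normalizationDesc f₁ f H
  have htn : IsSchemeTheoreticallyDominant g.toNormalization := ⟨g.ker_toNormalization⟩
  have hinj' : Function.Injective (g.toNormalization.app (d ⁻¹ᵁ U)) :=
    g.toNormalization.app_injective _
  have hdi : IsIntegralHom d := inferInstance
  clear_value d
  subst hd
  rw [Scheme.Hom.comp_app] at hinj hint
  refine (ConcreteCategory.isIso_iff_bijective _).mpr ⟨fun a b hab ↦ hinj ?_, fun b ↦ ?_⟩
  · change g.toNormalization.app _ (d.app U a) = g.toNormalization.app _ (d.app U b)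
    rw [hab]
  · obtain ⟨q, hq, hqb⟩ := d.isIntegral_app U hU b
    obtain ⟨a, ha⟩ := hint (g.toNormalization.app _ b) ⟨q, hq, by
      have := congr(g.toNormalization.app (d ⁻¹ᵁ U) $hqb)
      rw [map_zero] at this
      exact (Polynomial.hom_eval₂ _ _ (g.toNormalization.app (d ⁻¹ᵁ U)).hom _).symm.trans this⟩
    exact ⟨a, hinj' ha⟩

/-- A normal integral scheme that is integral and birational over `Z` is the normalization. -/
theorem exists_iso_normalization {W Z : Scheme.{0}} [IsIntegral W] [IsIntegral Z]
    [QuasiSeparatedSpace Z] (f : W ⟶ Z) [IsIntegralHom f]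
    (hf : f (genericPoint W) = genericPoint Z)
    (hs : Function.Surjective (f.stalkMap (genericPoint W)))
    (hW : ∀ w : W, ∃ U : W.Opens, w ∈ U ∧ IsAffineOpen U ∧ IsIntegrallyClosed Γ(W, U)) :
    ∃ e : W ≅ normalization Z, e.hom ≫ fromNormalization Z = f := by
  obtain ⟨φ, hφ, hφf⟩ := exists_section_genericPoint f hf hs
  have H : fromGenericPoint Z = (φ ≫ fromGenericPoint W) ≫ f := by rw [Category.assoc, hφf]
  have : IsIso ((fromGenericPoint Z).normalizationDesc _ f H) := by
    refine isIso_normalizationDesc _ _ _ _ fun w ↦ ?_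
    obtain ⟨U, hwU, hU, hc⟩ := hW w
    have hξ : genericPoint W ∈ U :=
      ((genericPoint_spec W).mem_open_set_iff U.isOpen).mpr ⟨w, trivial, hwU⟩
    have : Nonempty U := ⟨⟨w, hwU⟩⟩
    have := functionField_isFractionRing_of_isAffineOpen W U hU
    -- The spectrum of a field is one point, so all of it lies over `U`. Up to isomorphism the map
    -- on sections is therefore the inclusion of `Γ(W, U)` into `K(W)`, its fraction field.
    have happ : ∃ ψ : W.functionField ≅ Γ(Spec Z.functionField, (φ ≫ fromGenericPoint W) ⁻¹ᵁ U),
        (φ ≫ fromGenericPoint W).app U = W.germToFunctionField U ≫ ψ.hom := by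
      have htop : fromGenericPoint W ⁻¹ᵁ U = ⊤ := top_le_iff.mp fun x _ ↦ by
        rw [show x = IsLocalRing.closedPoint W.functionField from
          Subsingleton.elim (α := PrimeSpectrum W.functionField) _ _]
        change W.fromSpecStalk (genericPoint W)
          (IsLocalRing.closedPoint (W.presheaf.stalk (genericPoint W))) ∈ U
        rwa [Scheme.fromSpecStalk_closedPoint]
      have : IsIso (homOfLE (le_top : fromGenericPoint W ⁻¹ᵁ U ≤ ⊤)) :=
        ⟨homOfLE htop.ge, Subsingleton.elim _ _, Subsingleton.elim _ _⟩
      have h1 : IsIso ((Spec W.functionField).presheaf.map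
        (homOfLE (le_top : fromGenericPoint W ⁻¹ᵁ U ≤ ⊤)).op) := inferInstance
      have h2 : IsIso (φ.app (fromGenericPoint W ⁻¹ᵁ U)) := inferInstance
      have h3 : IsIso (((Scheme.ΓSpecIso W.functionField).inv ≫ (Spec W.functionField).presheaf.map
        (homOfLE (le_top : fromGenericPoint W ⁻¹ᵁ U ≤ ⊤)).op) ≫
          φ.app (fromGenericPoint W ⁻¹ᵁ U)) :=
        @IsIso.comp_isIso _ _ _ _ _ _ _ (@IsIso.comp_isIso _ _ _ _ _ _ _ inferInstance h1) h2
      refine ⟨@asIso _ _ _ _ _ h3, ?_⟩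
      refine (Scheme.Hom.comp_app φ (fromGenericPoint W) U).trans ?_
      rw [Scheme.fromSpecStalk_app hξ]
      rfl
    obtain ⟨ψ, hψ⟩ := happ
    refine ⟨U, hwU, hU, ?_⟩
    rw [hψ]
    have hψi : Function.Bijective ψ.hom := (ConcreteCategory.isIso_iff_bijective _).mp inferInstance
    refine ⟨hψi.1.comp (W.germToFunctionField_injective U), fun b hb ↦ ?_⟩
    obtain ⟨b, rfl⟩ := hψi.2 b
    obtain ⟨q, hq, hqb⟩ := hb
    have hb' : _root_.IsIntegral Γ(W, U) b := by
      refine ⟨q, hq, hψi.1 ?_⟩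
      rw [map_zero, ← hqb]
      exact Polynomial.hom_eval₂ _ _ ψ.hom.hom _
    obtain ⟨a, rfl⟩ := IsIntegrallyClosed.isIntegral_iff.mp hb'
    exact ⟨a, rfl⟩
  let e : normalization Z ≅ W := @asIso _ _ _ _ _ this
  exact ⟨e.symm, (Iso.inv_comp_eq e).mpr ((fromGenericPoint Z).normalizationDesc_comp _ f H).symm⟩

/-- A birational separated morphism has no nontrivial automorphisms. -/
theorem eq_id_of_comp_eq {W Z : Scheme.{0}} [IsIntegral W] [IsIntegral Z] (f : W ⟶ Z)
    [IsSeparated f] (hf : f (genericPoint W) = genericPoint Z)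
    (hs : Function.Surjective (f.stalkMap (genericPoint W))) (h : W ⟶ W) [IsIso h]
    (hh : h ≫ f = f) : h = 𝟙 W := by
  obtain ⟨φ, hφ, hφf⟩ := exists_section_genericPoint f hf hs
  have hdom : IsDominant (fromGenericPoint W) := by
    refine ⟨dense_iff_closure_eq.mpr (Set.univ_subset_iff.mp ?_)⟩
    rw [← (genericPoint_spec W).def]
    refine closure_mono (Set.singleton_subset_iff.mpr ?_)
    exact ⟨_, Scheme.fromSpecStalk_closedPoint⟩
  refine ext_of_isDominant_of_isSeparated f (by rw [hh, Category.id_comp]) (fromGenericPoint W) ?_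
  rw [Category.comp_id]
  -- Up to the isomorphism `φ` this is the inclusion of the generic point of `Z`. It forces the map
  -- `k` induced by `h` on `Spec K(W)` to be the identity.
  have hm : Mono (fromGenericPoint W ≫ f) := by
    rw [← (IsIso.inv_comp_eq φ).mpr hφf.symm]
    infer_instance
  have hg : h (genericPoint W) = genericPoint W :=
    genericPoint_eq_of_isOpenImmersion h
  have hfac : ∃ k : Spec W.functionField ⟶ Spec W.functionField,
      k ≫ fromGenericPoint W = fromGenericPoint W ≫ h := by
    have key (w : W) (hw : w = genericPoint W) (θ : W.presheaf.stalk w ⟶ W.functionField)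
        (h' : Spec.map θ ≫ W.fromSpecStalk w = fromGenericPoint W ≫ h) :
        ∃ k : Spec W.functionField ⟶ Spec W.functionField,
          k ≫ fromGenericPoint W = fromGenericPoint W ≫ h := by
      subst hw
      exact ⟨_, h'⟩
    exact key _ hg _ (Scheme.SpecMap_stalkMap_fromSpecStalk h)
  obtain ⟨k, hk⟩ := hfac
  have hk1 : k = 𝟙 _ := by
    rw [← cancel_mono (fromGenericPoint W ≫ f), reassoc_of% hk, hh, Category.id_comp]
  rw [← hk, hk1, Category.id_comp]

/-- The stalk map at the generic point is surjective if the sections over a nonempty affine open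
of the source are fractions of sections over the target. -/
theorem surjective_stalkMap_genericPoint {W : Scheme.{0}} [IsIntegral W] {A B : CommRingCat.{0}}
    [IsDomain B] (r : W ⟶ Spec A) (c : Spec B ⟶ W) [IsOpenImmersion c] (ψ : A ⟶ B)
    (hc : c ≫ r = Spec.map ψ) (h : ∀ b : B, ∃ s t : A, ψ s ≠ 0 ∧ ψ s * b = ψ t) :
    Function.Surjective (r.stalkMap (genericPoint W)) := by
  have hx : c (genericPoint (Spec B)) = genericPoint W := genericPoint_eq_of_isOpenImmersion c
  rw [← hx]
  set x := genericPoint (Spec B)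
  obtain ⟨τ, hτ⟩ : ∃ τ : A →+* (Spec A).presheaf.stalk (r (c x)), ∀ a : A,
      c.stalkMap x (r.stalkMap (c x) (τ a)) = algebraMap B (Spec B).functionField (ψ a) := by
    refine ⟨((Scheme.ΓSpecIso A).inv ≫ (Spec A).presheaf.germ ⊤ _ (Opens.mem_top _)).hom,
      fun a ↦ ?_⟩
    have h1 : (c ≫ r).appTop ((Scheme.ΓSpecIso A).inv a) = (Scheme.ΓSpecIso B).inv (ψ a) := by
      rw [hc]
      exact congr($(Scheme.ΓSpecIso_inv_naturality ψ) a).symm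
    change c.stalkMap x (r.stalkMap (c x)
      ((Spec A).presheaf.germ ⊤ (r (c x)) (Opens.mem_top _) ((Scheme.ΓSpecIso A).inv a))) = _
    rw [Scheme.Hom.germ_stalkMap_apply]
    refine (Scheme.Hom.germ_stalkMap_apply c _ x _ _).trans ?_
    exact congr((Spec B).presheaf.germ ⊤ x trivial $h1)
  have hunit (a : A) (ha : ψ a ≠ 0) : IsUnit (τ a) := by
    refine isUnit_of_map_unit (r.stalkMap (c x)).hom _ (isUnit_of_map_unit (c.stalkMap x).hom _ ?_)
    change IsUnit (c.stalkMap x (r.stalkMap (c x) (τ a)))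
    rw [hτ, isUnit_iff_ne_zero]
    exact (map_ne_zero_iff _ (IsFractionRing.injective B (Spec B).functionField)).mpr ha
  have hinj : Function.Injective (c.stalkMap x) :=
    ((ConcreteCategory.isIso_iff_bijective _).mp inferInstance).1
  intro y
  obtain ⟨b, b', hb', hy⟩ := IsFractionRing.div_surjective (A := B) (c.stalkMap x y :
    (Spec B).functionField)
  obtain ⟨s, t, hs, hst⟩ := h b
  obtain ⟨s', t', hs', hst'⟩ := h b'
  have ht' : ψ t' ≠ 0 := hst' ▸ mul_ne_zero hs' (nonZeroDivisors.ne_zero hb')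
  obtain ⟨v, hv⟩ := ((hunit _ hs).mul (hunit _ ht')).exists_left_inv
  -- With `b = t / s` and `b' = t' / s'`, the fraction `b / b'` is `t s' / (s t')`; `v` is an
  -- inverse of `s t'` in the local ring.
  refine ⟨τ t * τ s' * v, hinj ?_⟩
  let θ : (Spec A).presheaf.stalk (r (c x)) →+* (Spec B).functionField :=
    (c.stalkMap x).hom.comp (r.stalkMap (c x)).hom
  have hθ (a : A) : θ (τ a) = algebraMap B (Spec B).functionField (ψ a) := hτ a
  change θ _ = _
  have hy' : algebraMap B (Spec B).functionField b / algebraMap B (Spec B).functionField b' =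
    c.stalkMap x y := hy
  rw [← hy']
  have hne (b : B) (hb : b ≠ 0) : algebraMap B (Spec B).functionField b ≠ 0 :=
    (map_ne_zero_iff _ (IsFractionRing.injective B (Spec B).functionField)).mpr hb
  refine mul_right_cancel₀ (mul_ne_zero (hne _ hs) (hne _ ht')) ?_
  rw [← hθ, ← hθ, ← map_mul θ, ← map_mul θ, mul_assoc, hv, mul_one, map_mul θ, map_mul θ,
    hθ, hθ, hθ, hθ, ← hst, ← hst', map_mul, map_mul]
  have := hne _ (nonZeroDivisors.ne_zero hb')
  field_simp

end PolyDiv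

namespace PolyDiv

/-! ## The comparison with the normalized graph closure -/

theorem map_genericPoint_of_isDominant {W Z : Scheme.{0}} [IsIntegral W] [IsIntegral Z] (f : W ⟶ Z)
    [IsDominant f] : f (genericPoint W) = genericPoint Z := by
  have h := (genericPoint_spec W).image f.continuous
  rw [Set.image_univ, f.denseRange.closure_range] at h
  exact h.eq (genericPoint_spec Z)

theorem isDominant_of_comp_isOpenImmersion {T U X : Scheme.{0}} (k : T ⟶ U) (i : U ⟶ X)
    [IsOpenImmersion i] [h : IsDominant (k ≫ i)] : IsDominant k := by
  have h1 := h.denseRange.preimage i.isOpenEmbedding.isOpenMap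
  refine ⟨h1.mono ?_⟩
  rintro u ⟨t, ht⟩
  exact ⟨t, i.isOpenEmbedding.injective (by simpa using ht)⟩

theorem surjective_stalkMap_of_comp {W Z X : Scheme.{0}} {f : W ⟶ Z} {q : Z ⟶ X} {r : W ⟶ X}
    (h : f ≫ q = r) (x : W) (hr : Function.Surjective (r.stalkMap x)) :
    Function.Surjective (f.stalkMap x) := by
  subst h
  rw [Scheme.Hom.stalkMap_comp] at hr
  exact fun y ↦ (hr y).imp' _ fun _ ha ↦ ha

section Graph

variable {X C : Scheme.{0}} [X.Over SpecC] [C.Over SpecC] [IsIntegral X] [C.IsSeparated]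
  (p : X ⤏ C) [p.IsOver SpecC]

theorem graph_fst : graph p ≫ pullback.fst _ _ = p.toPartialMap.domain.ι := pullback.lift_fst _ _ _

theorem graph_snd : graph p ≫ pullback.snd _ _ = p.toPartialMap.hom := pullback.lift_snd _ _ _

theorem exists_lift_graphClosureι {W : Scheme.{0}} [IsReduced W]
    (g : W ⟶ pullback (X ↘ SpecC) (C ↘ SpecC)) (h : Set.range g ⊆ graphClosureSet p) :
    ∃ f : W ⟶ graphClosure p, f ≫ graphClosureι p = g :=
  exists_lift_vanishingIdeal g (graphClosureSet p) h

/-- The graph of `p` is dense in its closure. -/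
theorem exists_dominant_lift_graph :
    ∃ l : (p.toPartialMap.domain : Scheme.{0}) ⟶ graphClosure p,
      IsDominant l ∧ l ≫ graphClosureι p = graph p := by
  obtain ⟨l, hl⟩ := exists_lift_graphClosureι p (graph p) subset_closure
  refine ⟨l, ⟨dense_iff_closure_eq.mpr (Set.univ_subset_iff.mp fun z _ ↦ ?_)⟩, hl⟩
  have hz : graphClosureι p z ∈ (graphClosureSet p : Set _) := by
    have h1 : graphClosureι p z ∈ Set.range (graphClosureι p) := ⟨z, rfl⟩
    have h2 : Set.range (graphClosureι p) = graphClosureSet p :=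
      (Scheme.IdealSheafData.range_subschemeι _).trans
        (Scheme.IdealSheafData.coe_support_vanishingIdeal _)
    rwa [h2] at h1
  have hcl : (graphClosureSet p : Set _) = graphClosureι p '' closure (Set.range l) := by
    rw [← (graphClosureι p).isClosedEmbedding.closure_image_eq, ← Set.range_comp]
    change closure (Set.range (graph p)) = closure (Set.range (l ≫ graphClosureι p))
    rw [hl]
  rw [hcl] at hz
  obtain ⟨z', hz', h⟩ := hz
  rwa [← (graphClosureι p).isClosedEmbedding.injective h]

end Graph

namespace PolyhedralDivisor

variable {M : Type} [AddCommGroup M] {Y : Scheme.{0}} {σ : PointedCone ℚ (NQ M)}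
  [Y.Over SpecC] [IsNonsingularCurve Y] (D : PolyhedralDivisor Y σ) [Module.Free ℤ M]

theorem exists_normal_nhds (x : D.Xtilde) :
    ∃ U : D.Xtilde.Opens, x ∈ U ∧ IsAffineOpen U ∧ IsIntegrallyClosed Γ(D.Xtilde, U) := by
  obtain ⟨V, hV, hVn, y, rfl⟩ := D.exists_mem_range_chart x
  refine ⟨D.chart hV ''ᵁ ⊤, ⟨y, trivial, rfl⟩,
    (isAffineOpen_top _).image_of_isOpenImmersion (D.chart hV), ?_⟩
  have := D.isIntegrallyClosed_sheafSections V
  exact IsIntegrallyClosed.of_equiv (((D.chart hV).appIso ⊤) ≪≫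
    Scheme.ΓSpecIso (CommRingCat.of (D.sheafSections V))).symm.commRingCatIsoToRingEquiv

/-- Birationality of the contraction: over `U` every section of `𝒜` becomes a global one after
multiplication by a power of the localizing section, so it is a fraction of global sections. -/
theorem surjective_stalkMap_contraction [Module.Finite ℤ M] (hσ : σ.FG)
    (hσ' : (σ : ConvexCone ℚ (NQ M)).Salient)
    (hD : ∀ u ∈ interiorWeights σ, IsBig (D.eval u)) :
    Function.Surjective (D.contraction.stalkMap (genericPoint D.Xtilde)) := by
  obtain ⟨U, hU, hUn, hT, w, g, hg, hs, -, hloc⟩ := D.exists_section_localizing hσ hσ' hD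
  have := D.isDomain_sheafSections U
  refine surjective_stalkMap_genericPoint (A := .of (D.sheafSections ⊤))
    (B := .of (D.sheafSections U)) D.contraction (D.chart hU) _ (D.chart_contraction hU) fun b ↦ ?_
  have hb : D.evalGeneric U b ∈ torusSections M U := by
    have h1 : D.evalGeneric U b ∈ D.sections U := (D.range_evalGeneric U).le ⟨b, rfl⟩
    intro u hu
    refine ⟨trivial, fun h0 P hP ↦ ?_⟩
    have h2 := (h1 u hu).2 h0 P hP
    rwa [hT.eval_eq_zero (h1 u hu).1 hP] at h2
  obtain ⟨N, hN⟩ := hloc _ hb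
  obtain ⟨s, hs⟩ := (D.range_evalGeneric ⊤).ge (pow_mem hs N)
  obtain ⟨t, ht⟩ := (D.range_evalGeneric ⊤).ge hN
  have hinj := D.evalGeneric_injective U
  refine ⟨s, t, fun h0 ↦ ?_, hinj ?_⟩
  · have h1 : D.evalGeneric U (D.res le_top s) = 0 := by
      rw [show D.res le_top s = 0 from h0, map_zero]
    rw [evalGeneric_res, hs, AddMonoidAlgebra.single_pow] at h1
    exact pow_ne_zero N hg (AddMonoidAlgebra.single_eq_zero.mp h1)
  · change D.evalGeneric U (D.res le_top s * b) = D.evalGeneric U (D.res le_top t)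
    rw [map_mul, evalGeneric_res, evalGeneric_res, hs, ht]

variable {D} {C : Scheme.{0}} [C.Over SpecC] (j : Y ⟶ C) [j.IsOver SpecC] [C.IsSeparated]
  {p : D.X ⤏ C} [p.IsOver SpecC]

/-- On the dense generic torus the map to `X × C` is the graph of `p`, so its image lies in the
closure of the graph. The lift is dominant because the torus also dominates the domain of `p`, whose
graph is dense in its closure. -/
theorem IsRationalQuotientMap.exists_lift_graphClosure (hp : D.IsRationalQuotientMap j p) :
    ∃ f : D.Xtilde ⟶ graphClosure p, IsDominant f ∧ f ≫ graphClosureι p = D.toProduct j := by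
  obtain ⟨k, hk, hk'⟩ := hp.exists_lift_toPartialMap
  obtain ⟨V, hV, hxV, -⟩ := exists_isAffineOpen_mem_and_subset (U := ⊤) (x := genericPoint Y) trivial
  have : Nonempty V := ⟨⟨_, hxV⟩⟩
  have hkg : D.fromTorus hV ≫ D.toProduct j = k ≫ graph p := by
    refine pullback.hom_ext ?_ ?_
    · rw [Category.assoc, Category.assoc, toProduct_fst, fromTorus_contraction, graph_fst, hk]
    · rw [Category.assoc, Category.assoc, toProduct_snd, ← Category.assoc, fromTorus_π, graph_snd,
        hk']
  have hsub : Set.range (D.toProduct j) ⊆ graphClosureSet p := by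
    rintro _ ⟨x, rfl⟩
    have hx : x ∈ closure (Set.range (D.fromTorus hV)) := by
      rw [(D.fromTorus hV).denseRange.closure_range]
      trivial
    have h1 := image_closure_subset_closure_image (D.toProduct j).continuous ⟨x, hx, rfl⟩
    refine closure_mono ?_ h1
    rintro _ ⟨_, ⟨t, rfl⟩, rfl⟩
    exact ⟨k t, congr($hkg t).symm⟩
  obtain ⟨f, hf⟩ := exists_lift_graphClosureι p (D.toProduct j) hsub
  obtain ⟨l, hl, hlg⟩ := exists_dominant_lift_graph p
  have hfl : D.fromTorus hV ≫ f = k ≫ l := by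
    rw [← cancel_mono (graphClosureι p), Category.assoc, Category.assoc, hlg, ← hkg, hf]
  have hkd : IsDominant (k ≫ p.toPartialMap.domain.ι) := hk ▸ inferInstance
  have := isDominant_of_comp_isOpenImmersion k p.toPartialMap.domain.ι
  have : IsDominant (D.fromTorus hV ≫ f) := hfl ▸ inferInstance
  exact ⟨f, .of_comp (D.fromTorus hV) f, hf⟩

theorem IsRationalQuotientMap.existsUnique_iso [Module.Finite ℤ M] (hσ : σ.FG)
    (hσ' : (σ : ConvexCone ℚ (NQ M)).Salient) [IsNonsingularCurve C] [IsOpenImmersion j]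
    (hD : D.IsProper) (hp : D.IsRationalQuotientMap j p) :
    ∃! e : D.Xtilde ≅ Xdd p, e.hom ≫ XddToX p = D.contraction ∧ e.hom ≫ XddToC p = D.π ≫ j := by
  obtain ⟨f, hfd, hf⟩ := hp.exists_lift_graphClosure j
  have hint : IsIntegralHom f := by
    have : IsIntegralHom (f ≫ graphClosureι p) := hf ▸ D.isIntegralHom_toProduct j hD.semiample
    exact .of_comp f (graphClosureι p)
  have hgen := map_genericPoint_of_isDominant f
  have hfst : f ≫ graphClosureι p ≫ pullback.fst _ _ = D.contraction := by
    rw [← Category.assoc, hf, toProduct_fst]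
  have hsnd : f ≫ graphClosureι p ≫ pullback.snd _ _ = D.π ≫ j := by
    rw [← Category.assoc, hf, toProduct_snd]
  have hsurj := surjective_stalkMap_of_comp hfst _
    (D.surjective_stalkMap_contraction hσ hσ' hD.big)
  obtain ⟨e, he⟩ := exists_iso_normalization f hgen hsurj D.exists_normal_nhds
  refine ⟨e, ⟨?_, ?_⟩, fun e' ⟨h1, h2⟩ ↦ ?_⟩
  · exact (Category.assoc _ _ _).symm.trans ((congrArg (· ≫ _) he).trans hfst)
  · exact (Category.assoc _ _ _).symm.trans ((congrArg (· ≫ _) he).trans hsnd)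
  · change D.Xtilde ≅ normalization (graphClosure p) at e'
    change e'.hom ≫ fromNormalization _ ≫ graphClosureι p ≫ pullback.fst _ _ = _ at h1
    change e'.hom ≫ fromNormalization _ ≫ graphClosureι p ≫ pullback.snd _ _ = _ at h2
    -- The two compatibilities determine the morphism to `X'`, a closed subscheme of `X × C`. Any
    -- two isomorphisms thus differ by an automorphism of `X̃` over `X'`.
    have he' : e'.hom ≫ fromNormalization _ = f := by
      rw [← cancel_mono (graphClosureι p)]
      refine pullback.hom_ext ?_ ?_
      · simp only [Category.assoc, h1, hfst]
      · simp only [Category.assoc, h2, hsnd]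
    have h := eq_id_of_comp_eq f hgen hsurj (e'.hom ≫ e.inv) (by
      rw [Category.assoc, (Iso.inv_comp_eq e).mpr he.symm, he'])
    exact Iso.ext ((Iso.comp_inv_eq e).mp h |>.trans (Category.id_comp _))

end PolyhedralDivisor

end PolyDiv

end

/-! ### The rational quotient map and the comparison isomorphism -/

theorem mainTheorem2 {M : Type} [AddCommGroup M] [Module.Free ℤ M] [Module.Finite ℤ M]
    (σ : PointedCone ℚ (PolyDiv.NQ M)) (hσ : σ.FG)
    (hσ' : (σ : ConvexCone ℚ (PolyDiv.NQ M)).Salient)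
    {Y C : Scheme.{0}} [Y.Over PolyDiv.SpecC] [C.Over PolyDiv.SpecC]
    [PolyDiv.IsNonsingularCurve Y] [PolyDiv.IsNonsingularCurve C] [IsProper (C ↘ PolyDiv.SpecC)]
    (j : Y ⟶ C) [IsOpenImmersion j] [j.IsOver PolyDiv.SpecC]
    (D : PolyDiv.PolyhedralDivisor Y σ) (hD : D.IsProper) :
    (∃! p : D.X ⤏ C, p.IsOver PolyDiv.SpecC ∧ D.IsRationalQuotientMap j p) ∧
      ∀ (p : D.X ⤏ C) [p.IsOver PolyDiv.SpecC], D.IsRationalQuotientMap j p →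
        ∃! e : D.Xtilde ≅ PolyDiv.Xdd p,
          e.hom ≫ PolyDiv.XddToX p = D.contraction ∧ e.hom ≫ PolyDiv.XddToC p = D.π ≫ j := by
  constructor
  · obtain ⟨p, hp, hq⟩ := D.exists_isRationalQuotientMap hσ hσ' hD.big j
    exact ⟨p, ⟨hp, hq⟩, fun p' hp' ↦ hp'.2.unique hq⟩
  · intro p _ hp
    exact hp.existsUnique_iso j hσ hσ' hD
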